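/- Let $k\ge 0$ and $n\ge k+1$. $\mathrm{Gr}_{k,n}$ denotes the Grassmannian of $k$-dimensional subspaces of $\mathbb R^n$, $\mathrm{Gr}_{k,n}^{\ge 0}$ (resp. $\mathrm{Gr}_{k,n}^{>0}$) the set of subspaces represented by a $k\times n$ matrix all of whose maximal minors are nonnegative (resp. positive), and, for a matroid $M$ of rank $k$ on $[n]=\{1,\dots,n\}$, $S_M\subseteq \mathrm{Gr}_{k,n}^{\ge 0}$ the set of subspaces represented by a matrix whose maximal minors are positive in the column sets that are bases of $M$ and zero in all others. Matroids of rank $k$ on $[n]$ are ordered by $M'\le M$ iff every basis of $M'$ is a basis of $M$. Let $\mathcal M_{n,k,1}$ be the set of matroids $M_1\oplus\dots\oplus M_{n-k}$, where $[n]=E_1\sqcup\dots\sqcup E_{n-k}$ is a partition into nonempty intervals and $M_j$ is the uniform matroid of rank $|E_j|-1$ on $E_j$; let $\overline{\mathcal M_{n,k,1}}$ be the set of matroids of rank $k$ on $[n]$ that lie below some element of $\mathcal M_{n,k,1}$, and $\mathcal S:=\bigcup_{M\in\overline{\mathcal M_{n,k,1}}}S_M$. The $m=1$ BCFW cells of $\mathrm{Gr}_{k,n}^{\ge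 0}$ are the cells of the plabic graphs with statistics $(n,k)$ obtained as follows: start, for $(n,k)=(1,0)$, with one boundary vertex incident to a black lollipop; then repeatedly either add a new last boundary vertex incident to a black lollipop ($n\mapsto n+1$), or add a new last boundary vertex joined to a new black vertex that subdivides the edge at the previous last boundary vertex ($n\mapsto n+1$, $k\mapsto k+1$). The cell of a graph is the set of points of $\mathrm{Gr}_{k,n}^{\ge0}$ whose nonzero Plücker coordinates are indexed exactly by the source sets of its perfect orientations (orientations of all edges for which each black internal vertex has exactly one outgoing edge and each white one exactly one incoming edge). For a sign vector $\sigma\in\{0,+,-\}^n$ let $\overline{\mathrm{var}}(\sigma)$ be the maximal number of sign changes after a choice of a sign for each zero component. Let $\overline{\mathbb P\mathrm{Sign}_{n,k,1}}$ be the set of nonzero $\sigma$ with $\overline{\mathrm{var}}(\sigma)=k$, modulo $\pm1$, ordered by: $\sigma\le\tau$ iff $\sigma$ or $-\sigma$ is obtained from $\tau$ by setting some components to $0$. Let $W\in \mathrm{Gr}_{k+1,n}^{>0}$. For $\sigma\in\overline{\mathbb P\mathrm{Sign}_{n,k,1}}$ let $\mathcal B_\sigma(W)$ be the set of lines in $W$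 spanned by a vector with sign vector $\pm\sigma$. **Theorem.** (i) For every $V\in \mathrm{Gr}_{k,n}^{\ge0}$, $V^\perp\cap W$ is a line; put $\mathcal B_{n,k,1}(W):=\{V^\perp\cap W: V\in \mathrm{Gr}_{k,n}^{\ge 0}\}$. (ii) The BCFW cells are exactly the cells $S_M$, $M\in\mathcal M_{n,k,1}$, and there are $\binom{n-1}{k}$ of them. For $M\in\overline{\mathcal M_{n,k,1}}$ the cell $S_M$ is nonempty, and $\mathcal S$ is the closure of the union of the BCFW cells. (iii) The map $\phi_W:\mathcal S\to\mathcal B_{n,k,1}(W)$, $V\mapsto V^\perp\cap W$, is a homeomorphism, and it induces a poset isomorphism of stratifications: there is a bijection $\Omega:\overline{\mathcal M_{n,k,1}}\to\overline{\mathbb P\mathrm{Sign}_{n,k,1}}$ such that $\phi_W(S_M)=\mathcal B_{\Omega(M)}(W)$ and $M\le M'\iff\Omega(M)\le\Omega(M')$, and these orders are containment of closures of strata: $S_M\subseteq\overline{S_{M'}}\iff M\le M'$, and $\mathcal B_\sigma(W)\subseteq\overline{\mathcal B_\tau(W)}\iff\sigma\le\tau$. (iv) Let $Z$ be a $(k+1)\times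 n$ real matrix with positive maximal minors and row span $W$. Then $\dim Z(V)=k$ for all $V\in \mathrm{Gr}_{k,n}^{\ge 0}$, and the images of the BCFW cells triangulate the amplituhedron $\mathcal A_{n,k,1}(Z):=\{Z(V):V\in \mathrm{Gr}_{k,n}^{\ge0}\}\subseteq \mathrm{Gr}_{k,k+1}$: the map $V\mapsto Z(V)$ is injective on each BCFW cell, the images of distinct BCFW cells are disjoint, and the closure of the union of these images is $\mathcal A_{n,k,1}(Z)$. Moreover $V\mapsto Z(V)$ restricts to a homeomorphism $\mathcal S\to\mathcal A_{n,k,1}(Z)$. -/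

import Mathlib

open scoped Topology

namespace Amplituhedron

noncomputable section

/-! ### Grassmannians, Pluecker coordinates and positivity -/

/-- The real Grassmannian of `k`-dimensional subspaces of `ℝⁿ`. -/
def Gr (k n : ℕ) : Type :=
  {V : Submodule ℝ (EuclideanSpace ℝ (Fin n)) // Module.finrank ℝ V = k}

/-- The underlying subspace of a point of the Grassmannian. -/
abbrev Gr.sub {k n : ℕ} (V : Gr k n) : Submodule ℝ (EuclideanSpace ℝ (Fin n)) := V.1

/-- The usual topology of the Grassmannian: a subspace is identified with the orthogonal projection
onto it, so the distance of two subspaces is the operator norm of the difference of their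
orthogonal projections. -/
instance (k n : ℕ) : TopologicalSpace (Gr k n) :=
  TopologicalSpace.induced (fun V : Gr k n => V.sub.starProjection) inferInstance

/-- The row span of a matrix. -/
def rowSpan {r n : ℕ} (A : Matrix (Fin r) (Fin n) ℝ) :
    Submodule ℝ (EuclideanSpace ℝ (Fin n)) :=
  Submodule.span ℝ (Set.range fun i => WithLp.toLp 2 (A i))

/-- The maximal minor of a `k × n` matrix located in the column set `I`, where `I` has `k`
elements. -/
def maxMinor {k n : ℕ} (A : Matrix (Fin k) (Fin n) ℝ) (I : Finset (Fin n)) (hI : I.card = k) : ℝ :=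
  (A.submatrix id (I.orderEmbOfFin hI)).det

/-- All maximal minors are positive. -/
def PositiveMinors {k n : ℕ} (A : Matrix (Fin k) (Fin n) ℝ) : Prop :=
  ∀ (I : Finset (Fin n)) (hI : I.card = k), 0 < maxMinor A I hI

/-- The totally nonnegative Grassmannian. Pluecker coordinates are defined up to a common nonzero
factor, so a point belongs to it when some representing matrix has nonnegative maximal minors. -/
def tnnGr (k n : ℕ) : Set (Gr k n) :=
  {V | ∃ A : Matrix (Fin k) (Fin n) ℝ, rowSpan A = V.sub ∧
    ∀ (I : Finset (Fin n)) (hI : I.card = k), 0 ≤ maxMinor A I hI}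

/-- The totally positive Grassmannian. -/
def tpGr (k n : ℕ) : Set (Gr k n) :=
  {V | ∃ A : Matrix (Fin k) (Fin n) ℝ, rowSpan A = V.sub ∧ PositiveMinors A}

/-- The positive Grassmann cell of a collection `M` of subsets of `[n]`: the Pluecker
coordinates in `M` are positive and the others vanish. -/
def posCell (k n : ℕ) (M : Set (Finset (Fin n))) : Set (Gr k n) :=
  {V | ∃ A : Matrix (Fin k) (Fin n) ℝ, rowSpan A = V.sub ∧
    ∀ (I : Finset (Fin n)) (hI : I.card = k),
      (I ∈ M → 0 < maxMinor A I hI) ∧ (I ∉ M → maxMinor A I hI = 0)}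

/-! ### The amplituhedron and the B-amplituhedron -/

/-- The set of all points `Vᗮ ∩ W` of the Grassmannian of `m`-dimensional subspaces, for `V`
totally nonnegative of dimension `k`. -/
def bAmplituhedron (k m n : ℕ) (W : Gr (k + m) n) : Set (Gr m n) :=
  {X | ∃ V ∈ tnnGr k n, X.sub = V.subᗮ ⊓ W.sub}

/-- The set of all points `Z(V)` of the Grassmannian of `k`-dimensional subspaces of `ℝʳ`,
for `V` in `C`. -/
def zImage {k r n : ℕ} (Z : Matrix (Fin r) (Fin n) ℝ) (C : Set (Gr k n)) : Set (Gr k r) :=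
  {Y | ∃ V ∈ C, Y.sub = V.sub.map (Matrix.toLpLin 2 2 Z)}

/-- The tree amplituhedron: the image of the totally nonnegative Grassmannian under `Z`. -/
def amplituhedron (k m n : ℕ) (Z : Matrix (Fin (k + m)) (Fin n) ℝ) : Set (Gr k (k + m)) :=
  zImage Z (tnnGr k n)

/-! ### The positroids and the subcomplex -/

/-- The cell of a matroid on `[n]`, given by the collection of its bases. -/
def matroidCell (k n : ℕ) (M : Matroid (Fin n)) : Set (Gr k n) :=
  posCell k n {I | M.IsBase (I : Set (Fin n))}

/-- The matroids of rank `k` on `[n]` that are direct sums of `n - k` matroids whose ground sets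
are nonempty intervals `E j`, the `j`-th one being uniform of rank `|E j| - 1`. -/
def bcfwMatroids (n k : ℕ) : Set (Matroid (Fin n)) :=
  {M | M.E = Set.univ ∧ M.eRank = (k : ℕ∞) ∧
    ∃ (N : Fin (n - k) → Matroid (Fin n))
      (hN : Pairwise (Function.onFun Disjoint fun j => (N j).E)),
      (∀ j, (N j).E.Nonempty ∧ (N j).E.OrdConnected ∧
        ∀ B : Set (Fin n), (N j).IsBase B ↔ B ⊆ (N j).E ∧ B.ncard + 1 = (N j).E.ncard) ∧
      M = Matroid.disjointSigma N hN}

/-- The weak order on matroids: every basis of `M'` is a basis of `M`. -/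
def WeakLE {n : ℕ} (M' M : Matroid (Fin n)) : Prop :=
  ∀ B : Set (Fin n), M'.IsBase B → M.IsBase B

/-- The matroids of rank `k` on `[n]` that lie weakly below some matroid in `bcfwMatroids n k`. -/
def bcfwMatroidsBar (n k : ℕ) : Set (Matroid (Fin n)) :=
  {M' | M'.E = Set.univ ∧ M'.eRank = (k : ℕ∞) ∧ ∃ M ∈ bcfwMatroids n k, WeakLE M' M}

/-- The union of the cells of the matroids in `bcfwMatroidsBar n k`. -/
def subcomplex (k n : ℕ) : Set (Gr k n) :=
  ⋃ M ∈ bcfwMatroidsBar n k, matroidCell k n M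

/-! ### Sign vectors and the stratification of the B-amplituhedron -/

/-- The number of sign changes of a sign vector, zeros being ignored; it is `-1` for the zero
vector. -/
def signVar {n : ℕ} (σ : Fin n → SignType) : ℤ :=
  if σ = 0 then -1 else
    ((Finset.univ.filter fun p : Fin n × Fin n =>
      p.1 < p.2 ∧ σ p.1 ≠ 0 ∧ σ p.2 = -σ p.1 ∧ ∀ l, p.1 < l → l < p.2 → σ l = 0).card : ℤ)

/-- `σ ≤ τ` for sign vectors: `σ` is obtained from `τ` by setting some components to zero. -/
def SignLE {n : ℕ} (σ τ : Fin n → SignType) : Prop :=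
  ∀ i, σ i ≠ 0 → σ i = τ i

instance {n : ℕ} (σ : Fin n → SignType) : DecidablePred (SignLE σ) :=
  fun _ => inferInstanceAs (Decidable (∀ _, _))

/-- The maximal number of sign changes after a choice of a sign for each zero component. -/
def signVarBar {n : ℕ} (σ : Fin n → SignType) : ℤ :=
  (Finset.univ.filter (SignLE σ)).sup'
    ⟨σ, Finset.mem_filter.2 ⟨Finset.mem_univ _, fun _ _ => rfl⟩⟩ signVar

/-- The nonzero sign vectors `σ` of length `n` with `signVarBar σ = k`. -/
def SignVec (n k : ℕ) : Type :=
  {σ : Fin n → SignType // σ ≠ 0 ∧ signVarBar σ = (k : ℤ)}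

/-- Equality of sign vectors up to multiplication by `±1`. -/
instance signSetoid (n k : ℕ) : Setoid (SignVec n k) where
  r σ τ := σ.1 = τ.1 ∨ σ.1 = -τ.1
  iseqv :=
    { refl := fun _ => Or.inl rfl
      symm := by
        rintro a b (h | h)
        · exact Or.inl h.symm
        · exact Or.inr (by rw [h]; funext i; simp)
      trans := by
        rintro a b c (h | h) (h' | h')
        · exact Or.inl (h.trans h')
        · exact Or.inr (h.trans h')
        · exact Or.inr (h.trans (by rw [h']))
        · exact Or.inl (by rw [h, h']; funext i; simp) }

/-- The nonzero sign vectors `σ` with `signVarBar σ = k`, modulo multiplication by `±1`. -/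
def PSign (n k : ℕ) : Type := Quotient (signSetoid n k)

/-- The partial order on sign vectors modulo `±1`: some representatives are comparable. -/
def PSign.LE' {n k : ℕ} (s t : PSign n k) : Prop :=
  ∃ σ τ : SignVec n k, Quotient.mk _ σ = s ∧ Quotient.mk _ τ = t ∧ SignLE σ.1 τ.1

/-- The sign vector of a vector. -/
def signOf {n : ℕ} (w : EuclideanSpace ℝ (Fin n)) : Fin n → SignType :=
  fun i => SignType.sign (w i)

/-- The stratum of a sign vector modulo `±1`: the lines in `W` that are spanned by a vector with
this sign vector. -/
def stratum {n k : ℕ} (W : Gr (k + 1) n) (s : PSign n k) : Set (Gr 1 n) :=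
  {X | X.sub ≤ W.sub ∧
    ∃ w ∈ X.sub, ∃ σ : SignVec n k, Quotient.mk _ σ = s ∧ signOf w = σ.1}

/-! ### The BCFW recursion for `m = 1` -/

/-- The combinatorial data of a plabic graph with boundary vertices `1, …, n`: a graph on boundary
vertices and internal vertices, the latter coloured black or white, each boundary vertex being
incident to a single edge. Perfect orientations, hence the positroid of the graph, depend on these
data only and not on the planar drawing, which is therefore not recorded. -/
structure BoundaryGraph (n : ℕ) where
  Internal : Type
  graph : SimpleGraph (Fin n ⊕ Internal)
  black : Set Internal
  boundary : ∀ i : Fin n, ∃! v, graph.Adj (Sum.inl i) v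

/-- A perfect orientation, `O u v` meaning that the edge between `u` and `v` is directed from
`u` to `v`: every edge gets exactly one direction, exactly one edge is directed away from each
black vertex, and exactly one edge is directed towards each white vertex. -/
def BoundaryGraph.IsPerfectOrientation {n : ℕ} (G : BoundaryGraph n)
    (O : Fin n ⊕ G.Internal → Fin n ⊕ G.Internal → Prop) : Prop :=
  (∀ u v, O u v → G.graph.Adj u v) ∧
  (∀ u v, G.graph.Adj u v → (O u v ↔ ¬ O v u)) ∧
  (∀ b ∈ G.black, ∃! v, O (Sum.inr b) v) ∧
  (∀ b ∉ G.black, ∃! v, O v (Sum.inr b))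

/-- The bases of the positroid of the graph: the source sets of its perfect orientations. -/
def BoundaryGraph.bases {n : ℕ} (G : BoundaryGraph n) : Set (Finset (Fin n)) :=
  {I | ∃ O, G.IsPerfectOrientation O ∧ ∀ i, i ∈ I ↔ ∃ v, O (Sum.inl i) v}

/-- One boundary vertex, incident to a black lollipop. -/
def startGraph : BoundaryGraph 1 where
  Internal := Unit
  graph := ⊤
  black := Set.univ
  boundary := by
    intro i
    refine ⟨Sum.inr (), by simp, ?_⟩
    rintro (j | j) h
    · exact absurd (congrArg Sum.inl (Subsingleton.elim i j)) h.ne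
    · rfl

/-- The vertices of a graph as vertices of an enlarged graph with one more boundary vertex, which
gets the last label, and one more internal vertex `none`. -/
def oldVertex {n : ℕ} {ι : Type} : Fin n ⊕ ι → Fin (n + 1) ⊕ Option ι :=
  Sum.map Fin.castSucc some

theorem oldVertex_injective {n : ℕ} {ι : Type} :
    Function.Injective (oldVertex : Fin n ⊕ ι → _) :=
  Sum.map_injective.2 ⟨Fin.castSucc_injective n, Option.some_injective ι⟩

/-- Add a boundary vertex with the last label, incident to a black lollipop. -/
def BoundaryGraph.addLollipop {n : ℕ} (G : BoundaryGraph n) : BoundaryGraph (n + 1) where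
  Internal := Option G.Internal
  graph := SimpleGraph.fromRel fun a b =>
    (∃ x y, G.graph.Adj x y ∧ a = oldVertex x ∧ b = oldVertex y) ∨
    (a = Sum.inl (Fin.last n) ∧ b = Sum.inr none)
  black := {b | b = none ∨ ∃ c ∈ G.black, b = some c}
  boundary := by
    intro i
    refine Fin.lastCases ?_ (fun i => ?_) i
    · refine ⟨Sum.inr none, by simp [oldVertex], ?_⟩
      rintro v ⟨_, (⟨x | x, y, _, hx, _⟩ | ⟨_, h⟩) | (⟨x, y | y, _, _, hy⟩ | ⟨_, h⟩)⟩ <;>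
        simp_all [oldVertex, Fin.ext_iff] <;> omega
    · obtain ⟨v, hv, hu⟩ := G.boundary i
      refine ⟨oldVertex v, ?_, ?_⟩
      · refine ⟨fun h => hv.ne (oldVertex_injective h), Or.inl (Or.inl ⟨_, _, hv, rfl, rfl⟩)⟩
      · rintro w ⟨_, (⟨x, y, h, hx, rfl⟩ | ⟨h, _⟩) | (⟨x, y, h, rfl, hy⟩ | ⟨_, h⟩)⟩
        · obtain rfl : Sum.inl i = x := oldVertex_injective hx
          rw [hu _ h]
        · exact absurd (Sum.inl.inj h) (Fin.castSucc_lt_last i).ne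
        · obtain rfl : Sum.inl i = y := oldVertex_injective hy
          rw [hu _ h.symm]
        · cases h

/-- Add a boundary vertex with the last label, incident to the edge at the previous last boundary
vertex: this edge is subdivided by a new black vertex, which is joined to the new boundary
vertex. -/
def BoundaryGraph.attachLast {n : ℕ} (G : BoundaryGraph (n + 1)) : BoundaryGraph (n + 2) where
  Internal := Option G.Internal
  graph := SimpleGraph.fromRel fun a b =>
    (∃ x y, G.graph.Adj x y ∧ x ≠ Sum.inl (Fin.last n) ∧ y ≠ Sum.inl (Fin.last n) ∧
      a = oldVertex x ∧ b = oldVertex y) ∨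
    (∃ x, G.graph.Adj x (Sum.inl (Fin.last n)) ∧ a = oldVertex x ∧ b = Sum.inr none) ∨
    (a = oldVertex (Sum.inl (Fin.last n)) ∧ b = Sum.inr none) ∨
    (a = Sum.inl (Fin.last (n + 1)) ∧ b = Sum.inr none)
  black := {b | b = none ∨ ∃ c ∈ G.black, b = some c}
  boundary := by
    intro i
    refine Fin.lastCases ?_ (fun i => ?_) i
    · refine ⟨Sum.inr none, by simp [oldVertex], ?_⟩
      rintro v ⟨_, h⟩
      rcases h with (⟨x | x, y, _, _, _, hx, _⟩ | ⟨_, _, _, h⟩ | ⟨_, h⟩ | ⟨_, h⟩) |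
        (⟨x, y | y, _, _, _, _, hy⟩ | ⟨_, _, _, h⟩ | ⟨_, h⟩ | ⟨_, h⟩) <;>
        first
        | exact h
        | simp_all [oldVertex, Fin.ext_iff]; done
        | (simp_all [oldVertex, Fin.ext_iff]; omega)
    · obtain ⟨v, hv, hu⟩ := G.boundary i
      by_cases hi : i = Fin.last n
      · subst hi
        refine ⟨Sum.inr none, ?_, ?_⟩
        · exact ⟨by simp, Or.inl (Or.inr (Or.inr (Or.inl ⟨rfl, rfl⟩)))⟩
        · rintro w ⟨_, h⟩
          rcases h with (⟨x, y, _, hx, _, h, _⟩ | ⟨_, _, _, h⟩ | ⟨_, h⟩ | ⟨_, h⟩) |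
            (⟨x, y, _, _, hy, _, h⟩ | ⟨_, _, _, h⟩ | ⟨_, h⟩ | ⟨_, h⟩)
          · exact absurd (oldVertex_injective (a₁ := Sum.inl (Fin.last n)) h).symm hx
          · exact h
          · exact h
          · exact h
          · exact absurd (oldVertex_injective (a₁ := Sum.inl (Fin.last n)) h).symm hy
          · cases h
          · cases h
          · cases h
      have hi' : (Sum.inl i : Fin (n + 1) ⊕ G.Internal) ≠ Sum.inl (Fin.last n) :=
        fun h => hi (Sum.inl.inj h)
      by_cases hv' : v = Sum.inl (Fin.last n)
      · subst hv'
        refine ⟨Sum.inr none, ?_, ?_⟩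
        · exact ⟨by simp, Or.inl (Or.inr (Or.inl ⟨_, hv, rfl, rfl⟩))⟩
        · rintro w ⟨_, h⟩
          rcases h with (⟨x, y, h, _, hy, hx, _⟩ | ⟨_, _, _, h⟩ | ⟨_, h⟩ | ⟨_, h⟩) |
            (⟨x, y, h, hx, _, _, hy⟩ | ⟨_, _, _, h⟩ | ⟨_, h⟩ | ⟨_, h⟩)
          · obtain rfl : Sum.inl i = x := oldVertex_injective hx
            exact absurd (hu _ h) hy
          · exact h
          · exact h
          · exact h
          · obtain rfl : Sum.inl i = y := oldVertex_injective hy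
            exact absurd (hu _ h.symm) hx
          · cases h
          · cases h
          · cases h
      · refine ⟨oldVertex v, ?_, ?_⟩
        · exact ⟨fun h => hv.ne (oldVertex_injective h),
            Or.inl (Or.inl ⟨_, _, hv, hi', hv', rfl, rfl⟩)⟩
        · rintro w ⟨_, h⟩
          rcases h with (⟨x, y, h, _, _, hx, rfl⟩ | ⟨x, h, hx, _⟩ | ⟨h, _⟩ | ⟨h, _⟩) |
            (⟨x, y, h, _, _, rfl, hy⟩ | ⟨_, _, _, h⟩ | ⟨_, h⟩ | ⟨_, h⟩)
          · obtain rfl : Sum.inl i = x := oldVertex_injective hx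
            rw [hu _ h]
          · obtain rfl : Sum.inl i = x := oldVertex_injective hx
            exact absurd (hu _ h).symm hv'
          · exact absurd (oldVertex_injective (a₁ := Sum.inl i) h) hi'
          · exact absurd (Sum.inl.inj h) (Fin.castSucc_lt_last i).ne
          · obtain rfl : Sum.inl i = y := oldVertex_injective hy
            rw [hu _ h.symm]
          · cases h
          · cases h
          · cases h

/-- The graphs that the BCFW recursion for `m = 1` produces, with their statistics `n` and `k`. -/
inductive IsBCFW : (n k : ℕ) → BoundaryGraph n → Prop
  | start : IsBCFW 1 0 startGraph
  | addLollipop {n k : ℕ} {G : BoundaryGraph n} : IsBCFW n k G → IsBCFW (n + 1) k G.addLollipop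
  | attachLast {n k : ℕ} {G : BoundaryGraph (n + 1)} :
      IsBCFW (n + 1) k G → IsBCFW (n + 2) (k + 1) G.attachLast

/-- The `m = 1` BCFW cells of the totally nonnegative Grassmannian. -/
def bcfwCells (k n : ℕ) : Set (Set (Gr k n)) :=
  {C | ∃ G : BoundaryGraph n, IsBCFW n k G ∧ C = posCell k n G.bases}

end

end Amplituhedron

open Amplituhedron

/-!
The theorem is reduced to a combinatorial description of both stratifications by *blocks*: sequences
`A 0, …, A (r - 1)` of nonempty sets of indices, each to the left of the next, with `r = n - k`.

On the side of sign vectors, every second sign is reversed (`twist`). A nonzero sign vector is then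
determined, up to sign, by its blocks, the maximal groups of nonzero entries not separated by a sign
change (`exists_blocks`), and the number `signVarBar σ` is `n` minus the number of blocks of
`twist σ` (`signVarBar_eq`). So the sign vectors modulo `±1` correspond to the blocks, and their
order is containment of blocks (`psign_le_iff`).

On the side of matroids, the bases of a direct sum of uniform matroids of corank one on intervals
are the complements of the transversals of these intervals, and the exchange property forces every
matroid below it to be of the same form for smaller blocks (`exists_isBlockMatroid_of_weakLE`). The
BCFW recursion produces exactly the blocks that cover all indices: a lollipop appends the new index
as a block of its own, and an attached edge adds it to the last block (`bases_addLollipop`,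
`bases_attachLast`, `bcfwCells_eq`). Their number is a binomial coefficient, because such blocks are
given by their least elements (`ncard_full_blocks`).

The cell of blocks consists of the subspaces `V` such that `Vᗮ` has a basis of vectors supported on
the single blocks, of constant sign there after the twist (`posCell_blockBases`). One inclusion is
given by the vectors of signed minors that belong to the circuits of the matroid, the other one by
the fact that exchanges within a block do not change the sign of a minor.

The link between the two sides is total positivity. A nonzero vector orthogonal to a totally
nonnegative `V` has at most `n - k` blocks (`card_blocks_add_le`): otherwise it would have, up to
positive factors, the values of a polynomial of degree less than `k`, against the Cauchy-Binet
formula. A nonzero vector of a totally positive `W` of dimension `k + 1` has at least `n - k` blocks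
(`le_card_blocks_add`), by the alternating relation between its entries and the maximal minors.
Hence the nonzero vectors of `Vᗮ ⊓ W` have exactly `n - k` blocks. If this space were not a line, a
small perturbation of one of its vectors by another one would create an additional block
(`finrank_orthogonal_inf`). If `V` lies in the cell of the blocks `A`, then a nonzero vector `w` of
the line has the blocks `A` (`BlockFrame.signedBlocks_of_mem_span`), and the parts of `w` in these
blocks span `Vᗮ`. So `V` is determined by the line (`eq_of_mem_blockComplex`). Conversely the parts
of any vector with `n - k` blocks span the orthogonal complement of a point of a cell, and the
complex of cells already cuts out all lines (`exists_mem_blockComplex`).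

Closures of cells are computed with unit vectors as basis vectors of `Vᗮ`: letting entries tend to
zero shrinks the blocks (`closure_openCell`). In particular the complex of all cells is compact.
The map `V ↦ Vᗮ ⊓ W` is continuous because its graph is closed and Grassmannians are compact, and a
continuous bijection from a compact space to a Hausdorff space is a homeomorphism
(`exists_homeomorph_lineMap`). If `W` is the row span of `Z`, then `Z(V)` and `Vᗮ ⊓ W` determine
each other (`map_toLpLin_eq_iff`), which carries all of this over to the amplituhedron.
-/

namespace Amplituhedron

/-! ### Blocks of indices -/

/-- A sequence of nonempty sets of indices, each lying entirely to the left of the next ones. -/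
def IsBlocks {n r : ℕ} (A : Fin r → Finset (Fin n)) : Prop :=
  (∀ j, (A j).Nonempty) ∧ ∀ i j, i < j → ∀ a ∈ A i, ∀ b ∈ A j, a < b

/-- The blocks cover all indices; together with `IsBlocks` this makes them intervals. -/
def IsFull {n r : ℕ} (A : Fin r → Finset (Fin n)) : Prop :=
  ∀ i, ∃ j, i ∈ A j

/-- The sign vector `x` vanishes outside of the blocks and has the sign `(-1) ^ j` on the block
number `j`. -/
def HasBlocks {n r : ℕ} (A : Fin r → Finset (Fin n)) (x : Fin n → SignType) : Prop :=
  (∀ j, ∀ i ∈ A j, x i = (-1) ^ (j : ℕ)) ∧ ∀ i, (∀ j, i ∉ A j) → x i = 0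

theorem neg_one_pow_ne_zero_signType (m : ℕ) : ((-1 : SignType)) ^ m ≠ 0 := by
  rcases neg_one_pow_eq_or SignType m with h | h <;> rw [h] <;> decide

theorem IsBlocks.eq_of_mem {n r : ℕ} {A : Fin r → Finset (Fin n)} (hA : IsBlocks A) {i : Fin n}
    {j j' : Fin r} (h : i ∈ A j) (h' : i ∈ A j') : j = j' := by
  rcases lt_trichotomy j j' with hj | hj | hj
  · exact absurd (hA.2 _ _ hj _ h _ h') (lt_irrefl _)
  · exact hj
  · exact absurd (hA.2 _ _ hj _ h' _ h) (lt_irrefl _)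

theorem IsBlocks.le_of_le {n r : ℕ} {A : Fin r → Finset (Fin n)} (hA : IsBlocks A) {i i' : Fin n}
    {j j' : Fin r} (h : i ∈ A j) (h' : i' ∈ A j') (hi : i ≤ i') : j ≤ j' := by
  by_contra hj
  exact absurd (hA.2 _ _ (not_le.1 hj) _ h' _ h) (not_lt.2 hi)

theorem IsBlocks.strictMono {n r : ℕ} {A : Fin r → Finset (Fin n)} (hA : IsBlocks A)
    {b : Fin r → Fin n} (hb : ∀ j, b j ∈ A j) : StrictMono b :=
  fun i j h => hA.2 i j h _ (hb i) _ (hb j)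

theorem IsBlocks.exists_choice {n r : ℕ} {A : Fin r → Finset (Fin n)} (hA : IsBlocks A)
    {i : Fin n} {j : Fin r} (hi : i ∈ A j) : ∃ b : Fin r → Fin n, (∀ j, b j ∈ A j) ∧ b j = i := by
  choose b hb using hA.1
  refine ⟨Function.update b j i, fun l => ?_, by simp⟩
  by_cases h : l = j
  · subst h; simpa using hi
  · simpa [h] using hb l

theorem strictMono_fin_eq_id {r : ℕ} {f : Fin r → Fin r} (hf : StrictMono f) (j : Fin r) :
    f j = j := by
  have h := hf.range_inj (g := id) strictMono_id
  have hs : Function.Surjective f := Finite.injective_iff_surjective.1 hf.injective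
  rw [h.1 (by rw [hs.range_eq, Set.range_id])]
  rfl

/-- Indices at which the signs of `x` alternate lie in different blocks of `x`. -/
theorem exists_strictMono_of_alternating {n r m : ℕ} {A : Fin r → Finset (Fin n)}
    (hA : IsBlocks A) {x : Fin n → SignType} (hx : HasBlocks A x) {b : Fin m → Fin n}
    (hb : StrictMono b) {δ : SignType} (hδ : δ ≠ 0) (h : ∀ l, x (b l) = δ * (-1) ^ (l : ℕ)) :
    ∃ f : Fin m → Fin r, StrictMono f ∧ ∀ l, b l ∈ A (f l) := by
  have h1 : ∀ l, ∃ j, b l ∈ A j := by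
    intro l
    by_contra hc
    push Not at hc
    have := h l
    rw [hx.2 _ hc] at this
    exact mul_ne_zero hδ (neg_one_pow_ne_zero_signType _) this.symm
  choose f hf using h1
  refine ⟨f, ?_, hf⟩
  rcases m with _ | m
  · intro i; exact i.elim0
  rw [Fin.strictMono_iff_lt_succ]
  intro i
  refine lt_of_le_of_ne (hA.le_of_le (hf _) (hf _) (hb (Fin.castSucc_lt_succ)).le) fun he => ?_
  have e1 := h i.castSucc
  have e2 := h i.succ
  rw [hx.1 _ _ (hf _)] at e1 e2
  rw [← he, e1] at e2
  simp only [Fin.val_castSucc, Fin.val_succ, pow_succ, mul_neg, mul_one] at e2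
  have h3 := mul_ne_zero hδ (neg_one_pow_ne_zero_signType i)
  revert e2 h3
  generalize δ * (-1) ^ (i : ℕ) = y
  revert y
  decide

/-- A sign vector that arises from another one, up to a common sign, by setting entries to zero has
at most as many blocks: one index from each of its blocks gives alternating signs. -/
theorem HasBlocks.le_card {n r r' : ℕ} {A : Fin r → Finset (Fin n)} (hA : IsBlocks A)
    {A' : Fin r' → Finset (Fin n)} (hA' : IsBlocks A') {x x' : Fin n → SignType}
    (hx : HasBlocks A x) (hx' : HasBlocks A' x') {δ : SignType} (hδ : δ ≠ 0)
    (h : ∀ i, x i ≠ 0 → x' i = δ * x i) : r ≤ r' := by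
  choose b hb using hA.1
  obtain ⟨f, hf, -⟩ := exists_strictMono_of_alternating hA' hx' (hA.strictMono hb) hδ (fun l => by
    rw [h, hx.1 _ _ (hb l)]
    rw [hx.1 _ _ (hb l)]
    exact neg_one_pow_ne_zero_signType _)
  simpa using Fintype.card_le_of_injective f hf.injective

/-- If the numbers of blocks agree, then the blocks of the vector with the smaller support are
contained in those of the other one. -/
theorem HasBlocks.subset {n r : ℕ} {A : Fin r → Finset (Fin n)} (hA : IsBlocks A)
    {A' : Fin r → Finset (Fin n)} (hA' : IsBlocks A') {x x' : Fin n → SignType}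
    (hx : HasBlocks A x) (hx' : HasBlocks A' x') {δ : SignType} (hδ : δ ≠ 0)
    (h : ∀ i, x i ≠ 0 → x' i = δ * x i) (j : Fin r) : A j ⊆ A' j := by
  intro i hi
  obtain ⟨b, hb, rfl⟩ := hA.exists_choice hi
  obtain ⟨f, hf, hf'⟩ := exists_strictMono_of_alternating hA' hx' (hA.strictMono hb) hδ (fun l => by
    rw [h, hx.1 _ _ (hb l)]
    rw [hx.1 _ _ (hb l)]
    exact neg_one_pow_ne_zero_signType _)
  have := hf' j
  rwa [strictMono_fin_eq_id hf] at this

/-! ### Cutting the index set -/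

/-- The number of cut points up to and including `i`. -/
def cutIndex {n : ℕ} (D : Finset (Fin n)) (i : Fin n) : ℕ := (D.filter (· ≤ i)).card

theorem cutIndex_mono {n : ℕ} (D : Finset (Fin n)) : Monotone (cutIndex D) := fun i j h =>
  Finset.card_le_card fun d hd => by
    rw [Finset.mem_filter] at hd ⊢
    exact ⟨hd.1, hd.2.trans h⟩

theorem cutIndex_le {n : ℕ} (D : Finset (Fin n)) (i : Fin n) : cutIndex D i ≤ D.card :=
  Finset.card_filter_le _ _

theorem cutIndex_lt_of_mem {n : ℕ} {D : Finset (Fin n)} {i d : Fin n} (hd : d ∈ D) (h : i < d) :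
    cutIndex D i < cutIndex D d := by
  refine Finset.card_lt_card ⟨fun e he => ?_, fun hs => ?_⟩
  · rw [Finset.mem_filter] at he ⊢
    exact ⟨he.1, he.2.trans h.le⟩
  · exact absurd (Finset.mem_filter.1 (hs (Finset.mem_filter.2 ⟨hd, le_rfl⟩))).2 (not_le.2 h)

theorem exists_cutIndex_eq {n : ℕ} (D : Finset (Fin n)) (j : ℕ) (h1 : 1 ≤ j) (h2 : j ≤ D.card) :
    ∃ d ∈ D, cutIndex D d = j := by
  induction D using Finset.induction_on_max with
  | empty => simp at h2; omega
  | insert a D ha ih =>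
    have hna : a ∉ D := fun h => lt_irrefl _ (ha a h)
    rw [Finset.card_insert_of_notMem hna] at h2
    rcases Nat.lt_or_ge D.card j with hj | hj
    · refine ⟨a, Finset.mem_insert_self _ _, ?_⟩
      rw [cutIndex, Finset.filter_true_of_mem, Finset.card_insert_of_notMem hna]
      · omega
      · intro d hd
        rcases Finset.mem_insert.1 hd with rfl | hd
        · exact le_rfl
        · exact (ha d hd).le
    · obtain ⟨d, hd, he⟩ := ih hj
      refine ⟨d, Finset.mem_insert_of_mem hd, ?_⟩
      rw [← he, cutIndex, cutIndex, Finset.filter_insert, if_neg (not_le.2 (ha d hd))]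

/-- The intervals into which the index set is cut in front of each element of `D`. -/
def cutBlocks {n : ℕ} (r : ℕ) (D : Finset (Fin n)) : Fin r → Finset (Fin n) :=
  fun j => Finset.univ.filter fun i => cutIndex D i = j

theorem mem_cutBlocks {n r : ℕ} {D : Finset (Fin n)} {j : Fin r} {i : Fin n} :
    i ∈ cutBlocks r D j ↔ cutIndex D i = j := by simp [cutBlocks]

theorem isBlocks_cutBlocks {n r : ℕ} (hn : 0 < n) {D : Finset (Fin n)} (hD : D.card + 1 = r)
    (h0 : ∀ d ∈ D, (d : ℕ) ≠ 0) : IsBlocks (cutBlocks r D) := by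
  refine ⟨fun j => ?_, fun i j hij a ha b hb => ?_⟩
  · rcases Nat.eq_zero_or_pos (j : ℕ) with hj | hj
    · refine ⟨⟨0, hn⟩, mem_cutBlocks.2 ?_⟩
      rw [hj, cutIndex, Finset.card_eq_zero, Finset.filter_eq_empty_iff]
      intro d hd hle
      exact h0 d hd (Nat.le_zero.1 hle)
    · obtain ⟨d, -, hd⟩ := exists_cutIndex_eq D j hj (by omega)
      exact ⟨d, mem_cutBlocks.2 hd⟩
  · by_contra hc
    have := cutIndex_mono D (not_lt.1 hc)
    rw [mem_cutBlocks.1 ha, mem_cutBlocks.1 hb] at this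
    exact absurd this (not_le.2 hij)

theorem isFull_cutBlocks {n r : ℕ} {D : Finset (Fin n)} (hD : D.card + 1 = r) :
    IsFull (cutBlocks r D) := fun i =>
  ⟨⟨cutIndex D i, by have := cutIndex_le D i; omega⟩, mem_cutBlocks.2 rfl⟩

/-- The least elements of all blocks but the first. -/
noncomputable def blockMins {n r : ℕ} {A : Fin r → Finset (Fin n)} (hA : IsBlocks A) :
    Finset (Fin n) :=
  (Finset.univ.filter fun j : Fin r => (j : ℕ) ≠ 0).image fun j => (A j).min' (hA.1 j)

theorem IsBlocks.min'_strictMono {n r : ℕ} {A : Fin r → Finset (Fin n)} (hA : IsBlocks A) :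
    StrictMono fun j => (A j).min' (hA.1 j) :=
  hA.strictMono fun _ => Finset.min'_mem _ _

theorem card_filter_val_ne_zero (r : ℕ) :
    (Finset.univ.filter fun j : Fin r => (j : ℕ) ≠ 0).card = r - 1 := by
  rcases r with _ | r
  · simp
  · have : (Finset.univ.filter fun j : Fin (r + 1) => (j : ℕ) ≠ 0) =
        (Finset.univ : Finset (Fin (r + 1))).erase 0 := by
      ext j
      rw [Finset.mem_filter, Finset.mem_erase, ne_eq, ne_eq, Fin.ext_iff, and_comm]
      rfl
    rw [this, Finset.card_erase_of_mem (Finset.mem_univ _)]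
    simp

theorem card_blockMins {n r : ℕ} {A : Fin r → Finset (Fin n)} (hA : IsBlocks A) :
    (blockMins hA).card = r - 1 := by
  rw [blockMins, Finset.card_image_of_injective _ hA.min'_strictMono.injective,
    card_filter_val_ne_zero]

theorem blockMins_ne_zero {n r : ℕ} {A : Fin r → Finset (Fin n)} (hA : IsBlocks A) :
    ∀ d ∈ blockMins hA, (d : ℕ) ≠ 0 := by
  intro d hd
  obtain ⟨j, hj, rfl⟩ := Finset.mem_image.1 hd
  have hj := (Finset.mem_filter.1 hj).2
  have h := hA.min'_strictMono (show (⟨0, by omega⟩ : Fin r) < j from Nat.pos_of_ne_zero hj)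
  have h' := Fin.lt_def.1 h
  simp only at h'
  omega

/-- Cutting in front of the least elements of the blocks puts each block into the interval of its
own number. -/
theorem cutIndex_blockMins {n r : ℕ} {A : Fin r → Finset (Fin n)} (hA : IsBlocks A) {i : Fin n}
    {j : Fin r} (hi : i ∈ A j) : cutIndex (blockMins hA) i = j := by
  have : (blockMins hA).filter (· ≤ i) =
      (Finset.univ.filter fun l : Fin r => (l : ℕ) ≠ 0 ∧ l ≤ j).image
        fun l => (A l).min' (hA.1 l) := by
    ext d
    simp only [blockMins, Finset.mem_filter, Finset.mem_image, Finset.mem_univ, true_and]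
    constructor
    · rintro ⟨⟨l, hl, rfl⟩, h⟩
      exact ⟨l, ⟨hl, hA.le_of_le (Finset.min'_mem _ _) hi h⟩, rfl⟩
    · rintro ⟨l, ⟨hl, hlj⟩, rfl⟩
      refine ⟨⟨l, hl, rfl⟩, ?_⟩
      rcases hlj.lt_or_eq with h | rfl
      · exact (hA.2 _ _ h _ (Finset.min'_mem _ _) _ hi).le
      · exact Finset.min'_le _ _ hi
  rw [cutIndex, this, Finset.card_image_of_injective _ hA.min'_strictMono.injective]
  have h2 : (Finset.univ.filter fun l : Fin r => (l : ℕ) ≠ 0 ∧ l ≤ j) =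
      (Finset.Iic j).erase ⟨0, j.pos⟩ := by
    ext l
    simp only [Finset.mem_filter, Finset.mem_univ, true_and, Finset.mem_erase, Finset.mem_Iic,
      ne_eq, Fin.ext_iff]
  rw [h2, Finset.card_erase_of_mem (by simp [Fin.le_def])]
  simp

/-- Blocks can be enlarged to intervals that cover the index set. -/
theorem IsBlocks.exists_full {n r : ℕ} (hr : 0 < r) {A : Fin r → Finset (Fin n)}
    (hA : IsBlocks A) :
    ∃ A' : Fin r → Finset (Fin n), IsBlocks A' ∧ IsFull A' ∧ ∀ j, A j ⊆ A' j := by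
  have hc : (blockMins hA).card + 1 = r := by rw [card_blockMins]; omega
  have hn : 0 < n := by
    obtain ⟨i, -⟩ := hA.1 ⟨0, hr⟩
    exact i.pos
  exact ⟨cutBlocks r (blockMins hA), isBlocks_cutBlocks hn hc (blockMins_ne_zero hA),
    isFull_cutBlocks hc, fun j i hi => mem_cutBlocks.2 (cutIndex_blockMins hA hi)⟩

theorem cutBlocks_blockMins {n r : ℕ} {A : Fin r → Finset (Fin n)} (hA : IsBlocks A)
    (hf : IsFull A) : cutBlocks r (blockMins hA) = A := by
  funext j
  ext i
  rw [mem_cutBlocks]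
  constructor
  · intro h
    obtain ⟨j', hj'⟩ := hf i
    rw [cutIndex_blockMins hA hj'] at h
    rwa [← Fin.ext h]
  · exact cutIndex_blockMins hA

/-- The cut points can be recovered from the numbers of the intervals. -/
theorem mem_iff_cutIndex_ne {n : ℕ} {D : Finset (Fin n)} (h0 : ∀ d ∈ D, (d : ℕ) ≠ 0)
    (i : Fin n) : i ∈ D ↔ (i : ℕ) ≠ 0 ∧ ∀ i' < i, cutIndex D i' ≠ cutIndex D i := by
  refine ⟨fun h => ⟨h0 i h, fun i' hi' => (cutIndex_lt_of_mem h hi').ne⟩, fun ⟨h, h'⟩ => ?_⟩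
  by_contra hc
  refine h' ⟨i - 1, by omega⟩ (Fin.lt_def.2 (by simp only; omega)) ?_
  rw [cutIndex, cutIndex]
  congr 1
  ext d
  simp only [Finset.mem_filter, and_congr_right_iff, Fin.le_def]
  intro hd
  have : (d : ℕ) ≠ i := fun h => hc (Fin.ext h ▸ hd)
  omega

/-- The partitions of the `n` indices into `r` nonempty intervals are counted by the choices of
the first elements of all intervals but the first one. -/
theorem ncard_full_blocks {n r : ℕ} (hn : 0 < n) (hr : 0 < r) :
    {A : Fin r → Finset (Fin n) | IsBlocks A ∧ IsFull A}.ncard = (n - 1).choose (r - 1) := by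
  let S : Finset (Finset (Fin n)) :=
    Finset.powersetCard (r - 1) (Finset.univ.filter fun j : Fin n => (j : ℕ) ≠ 0)
  have hS : ∀ D, D ∈ S ↔ D.card = r - 1 ∧ ∀ d ∈ D, (d : ℕ) ≠ 0 := by
    intro D
    simp only [S, Finset.mem_powersetCard]
    rw [and_comm]
    simp [Finset.subset_iff]
  have h : {A : Fin r → Finset (Fin n) | IsBlocks A ∧ IsFull A} =
      cutBlocks r '' (S : Set (Finset (Fin n))) := by
    ext A
    constructor
    · rintro ⟨hA, hf⟩
      exact ⟨blockMins hA, (hS _).2 ⟨card_blockMins hA, blockMins_ne_zero hA⟩,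
        cutBlocks_blockMins hA hf⟩
    · rintro ⟨D, hD, rfl⟩
      obtain ⟨h1, h2⟩ := (hS D).1 hD
      exact ⟨isBlocks_cutBlocks hn (by omega) h2, isFull_cutBlocks (by omega)⟩
  rw [h, Set.InjOn.ncard_image, Set.ncard_coe_finset]
  · simp only [S, Finset.card_powersetCard, card_filter_val_ne_zero]
  · intro D hD D' hD' he
    obtain ⟨h1, h2⟩ := (hS D).1 hD
    obtain ⟨h1', h2'⟩ := (hS D').1 hD'
    have hc : cutIndex D = cutIndex D' := by
      funext i
      have h3 : i ∈ cutBlocks r D ⟨cutIndex D i, by have := cutIndex_le D i; omega⟩ :=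
        mem_cutBlocks.2 rfl
      rw [he] at h3
      exact (mem_cutBlocks.1 h3).symm
    ext i
    rw [mem_iff_cutIndex_ne h2, mem_iff_cutIndex_ne h2', hc]

/-! ### The blocks of a sign vector -/

/-- The indices at which the sign differs from the previous nonzero sign. -/
def changes {n : ℕ} (x : Fin n → SignType) : Finset (Fin n) :=
  Finset.univ.filter fun q => x q ≠ 0 ∧ ∃ p < q, x q = -x p ∧ ∀ l, p < l → l < q → x l = 0

/-- A sign change is a pair of consecutive nonzero entries; it is counted at the second one. -/
theorem signVar_eq_card_changes {n : ℕ} {x : Fin n → SignType} (hx : x ≠ 0) :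
    signVar x = (changes x).card := by
  rw [signVar, if_neg hx]
  congr 1
  refine Finset.card_bij (fun p _ => p.2) ?_ ?_ ?_
  · rintro ⟨p, q⟩ h
    obtain ⟨h1, h2, h3, h4⟩ := (Finset.mem_filter.1 h).2
    refine Finset.mem_filter.2 ⟨Finset.mem_univ _, ?_, p, h1, h3, h4⟩
    simp only at h3 ⊢
    rw [h3]
    revert h2
    generalize x p = y
    revert y
    decide
  · rintro ⟨p, q⟩ h ⟨p', q'⟩ h' (rfl : q = q')
    obtain ⟨h1, h2, h3, h4⟩ := (Finset.mem_filter.1 h).2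
    obtain ⟨h1', h2', h3', h4'⟩ := (Finset.mem_filter.1 h').2
    rcases lt_trichotomy p p' with hp | rfl | hp
    · exact absurd (h4 p' hp h1') h2'
    · rfl
    · exact absurd (h4' p hp h1) h2
  · intro q hq
    obtain ⟨h1, p, h2, h3, h4⟩ := (Finset.mem_filter.1 hq).2
    refine ⟨(p, q), Finset.mem_filter.2 ⟨Finset.mem_univ _, h2, ?_, h3, h4⟩, rfl⟩
    rintro (h : x p = 0)
    rw [h] at h3
    exact h1 (by simpa using h3)

/-- The blocks of a nonzero sign vector `x` are cut out by its sign changes. -/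
theorem exists_blocks {n : ℕ} {x : Fin n → SignType} (hx : x ≠ 0) :
    ∃ A : Fin ((changes x).card + 1) → Finset (Fin n), IsBlocks A ∧
      (HasBlocks A x ∨ HasBlocks A (-x)) := by
  classical
  let s : Finset (Fin n) := Finset.univ.filter fun i => x i ≠ 0
  have hs : s.Nonempty := by
    obtain ⟨i, hi⟩ := Function.ne_iff.1 hx
    exact ⟨i, Finset.mem_filter.2 ⟨Finset.mem_univ _, hi⟩⟩
  let a := s.min' hs
  have ha : x a ≠ 0 := (Finset.mem_filter.1 (s.min'_mem hs)).2
  have hmin : ∀ i < a, x i = 0 := by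
    intro i hi
    by_contra hc
    exact absurd (s.min'_le i (Finset.mem_filter.2 ⟨Finset.mem_univ _, hc⟩)) (not_le.2 hi)
  have ha0 : cutIndex (changes x) a = 0 := by
    rw [cutIndex, Finset.card_eq_zero, Finset.filter_eq_empty_iff]
    intro q hq hqa
    obtain ⟨h1, p, h2, h3, h4⟩ := (Finset.mem_filter.1 hq).2
    rw [hmin p (h2.trans_le hqa)] at h3
    exact h1 (by simpa using h3)
  -- starting with the first nonzero entry `a`, the sign is reversed exactly at the changes
  have key : ∀ m : ℕ, ∀ i : Fin n, (i : ℕ) = m → x i ≠ 0 →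
      x i = x a * (-1) ^ cutIndex (changes x) i := by
    intro m
    induction m using Nat.strong_induction_on with
    | _ m ih =>
    intro i him hi
    let t := s.filter (· < i)
    by_cases ht : t.Nonempty
    -- `p` is the previous nonzero entry
    · let p := t.max' ht
      obtain ⟨hp1, hpi⟩ := Finset.mem_filter.1 (t.max'_mem ht)
      have hp : x p ≠ 0 := (Finset.mem_filter.1 hp1).2
      have hb : ∀ l, p < l → l < i → x l = 0 := by
        intro l h1 h2
        by_contra hc
        exact absurd (t.le_max' l (Finset.mem_filter.2
          ⟨Finset.mem_filter.2 ⟨Finset.mem_univ _, hc⟩, h2⟩)) (not_le.2 h1)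
      have hxp := ih p (by rw [← him]; exact hpi) p rfl hp
      by_cases hc : i ∈ changes x
      · have hcard : cutIndex (changes x) i = cutIndex (changes x) p + 1 := by
          rw [cutIndex, cutIndex]
          have : (changes x).filter (· ≤ i) = insert i ((changes x).filter (· ≤ p)) := by
            ext q
            simp only [Finset.mem_filter, Finset.mem_insert]
            constructor
            · rintro ⟨h1, h2⟩
              rcases h2.lt_or_eq with h | h
              · refine Or.inr ⟨h1, ?_⟩
                by_contra hq
                exact (Finset.mem_filter.1 h1).2.1 (hb q (not_le.1 hq) h)
              · exact Or.inl h
            · rintro (rfl | ⟨h1, h2⟩)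
              · exact ⟨hc, le_rfl⟩
              · exact ⟨h1, h2.trans hpi.le⟩
          rw [this, Finset.card_insert_of_notMem]
          rw [Finset.mem_filter]
          rintro ⟨-, h⟩
          exact absurd hpi (not_lt.2 h)
        obtain ⟨h1, p', h2, h3, h4⟩ := (Finset.mem_filter.1 hc).2
        have hpp : p' = p := by
          rcases lt_trichotomy p p' with h | h | h
          · rw [hb p' h h2] at h3
            exact absurd (by simpa using h3) h1
          · exact h.symm
          · exact absurd (h4 p h hpi) hp
        rw [hcard, pow_succ, ← mul_assoc, ← hxp, h3, hpp]
        simp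
      · have hcard : cutIndex (changes x) i = cutIndex (changes x) p := by
          rw [cutIndex, cutIndex]
          congr 1
          ext q
          simp only [Finset.mem_filter, and_congr_right_iff]
          intro h1
          refine ⟨fun h => ?_, fun h => h.trans hpi.le⟩
          by_contra hq
          rcases h.lt_or_eq with h | h
          · exact (Finset.mem_filter.1 h1).2.1 (hb q (not_le.1 hq) h)
          · exact hc (h ▸ h1)
        rw [hcard, ← hxp]
        have h5 : x i ≠ -x p := fun h =>
          hc (Finset.mem_filter.2 ⟨Finset.mem_univ _, hi, p, hpi, h, hb⟩)
        revert hi hp h5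
        generalize x i = y
        generalize x p = z
        revert y z
        decide
    · have : i = a := by
        refine le_antisymm ?_ (s.min'_le i (Finset.mem_filter.2 ⟨Finset.mem_univ _, hi⟩))
        by_contra hc
        exact ht ⟨a, Finset.mem_filter.2 ⟨s.min'_mem hs, not_le.1 hc⟩⟩
      rw [this, ha0]
      simp
  refine ⟨fun j => Finset.univ.filter fun i => x i ≠ 0 ∧ cutIndex (changes x) i = j,
    ⟨fun j => ?_, fun i j hij c hc d hd => ?_⟩, ?_⟩
  · rcases Nat.eq_zero_or_pos (j : ℕ) with hj | hj
    · exact ⟨a, Finset.mem_filter.2 ⟨Finset.mem_univ _, ha, by rw [ha0, hj]⟩⟩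
    · obtain ⟨d, h1, h2⟩ := exists_cutIndex_eq (changes x) j hj (by omega)
      exact ⟨d, Finset.mem_filter.2 ⟨Finset.mem_univ _, (Finset.mem_filter.1 h1).2.1, h2⟩⟩
  · by_contra h
    have := cutIndex_mono (changes x) (not_lt.1 h)
    rw [(Finset.mem_filter.1 hc).2.2, (Finset.mem_filter.1 hd).2.2] at this
    exact absurd this (not_le.2 hij)
  · have hz : ∀ i, (∀ j : Fin ((changes x).card + 1), i ∉ Finset.univ.filter fun i => x i ≠ 0 ∧
        cutIndex (changes x) i = j) → x i = 0 := by
      intro i hi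
      by_contra hc
      exact hi ⟨cutIndex (changes x) i, Nat.lt_succ_of_le (cutIndex_le _ _)⟩
        (Finset.mem_filter.2 ⟨Finset.mem_univ _, hc, rfl⟩)
    have hxa : x a = 1 ∨ x a = -1 := by
      revert ha
      generalize x a = y
      revert y
      decide
    rcases hxa with h | h
    · refine Or.inl ⟨fun j i hi => ?_, hz⟩
      obtain ⟨h1, h2⟩ := (Finset.mem_filter.1 hi).2
      rw [key _ i rfl h1, h, h2, one_mul]
    · refine Or.inr ⟨fun j i hi => ?_, fun i hi => ?_⟩
      · obtain ⟨h1, h2⟩ := (Finset.mem_filter.1 hi).2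
        rw [Pi.neg_apply, key _ i rfl h1, h, h2]
        simp
      · simp [hz i hi]

/-! ### Sign vectors up to sign -/

/-- `x` or `-x` has the blocks `A`. -/
def SignedBlocks {n r : ℕ} (A : Fin r → Finset (Fin n)) (x : Fin n → SignType) : Prop :=
  HasBlocks A x ∨ HasBlocks A (-x)

theorem SignedBlocks.neg {n r : ℕ} {A : Fin r → Finset (Fin n)} {x : Fin n → SignType}
    (h : SignedBlocks A x) : SignedBlocks A (-x) := by
  rcases h with h | h
  · exact Or.inr (by rwa [neg_neg])
  · exact Or.inl h

theorem SignedBlocks.exists_mul {n r : ℕ} {A : Fin r → Finset (Fin n)} {x : Fin n → SignType}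
    (h : SignedBlocks A x) : ∃ δ : SignType, δ * δ = 1 ∧ HasBlocks A fun i => δ * x i := by
  rcases h with h | h
  · exact ⟨1, by decide, by simpa using h⟩
  · refine ⟨-1, by decide, ?_⟩
    have : (fun i => -1 * x i) = -x := by ext i; simp
    rwa [this]

theorem signType_mul_self_eq_one {δ : SignType} (h : δ ≠ 0) : δ * δ = 1 := by
  revert h; revert δ; decide

theorem SignedBlocks.le_card {n r r' : ℕ} {A : Fin r → Finset (Fin n)} (hA : IsBlocks A)
    {A' : Fin r' → Finset (Fin n)} (hA' : IsBlocks A') {x x' : Fin n → SignType}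
    (hx : SignedBlocks A x) (hx' : SignedBlocks A' x') {δ : SignType} (hδ : δ ≠ 0)
    (h : ∀ i, x i ≠ 0 → x' i = δ * x i) : r ≤ r' := by
  obtain ⟨ε, hε, h1⟩ := hx.exists_mul
  obtain ⟨ε', hε', h1'⟩ := hx'.exists_mul
  refine h1.le_card hA hA' h1' (δ := ε' * δ * ε) ?_ fun i hi => ?_
  · refine mul_ne_zero (mul_ne_zero ?_ hδ) ?_ <;> rintro rfl <;> simp at hε hε'
  · rw [h i fun h0 => hi (by simp [h0])]
    calc ε' * (δ * x i) = ε' * δ * (ε * ε) * x i := by rw [hε]; simp [mul_assoc]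
      _ = _ := by simp only [mul_assoc]

theorem SignedBlocks.subset {n r : ℕ} {A : Fin r → Finset (Fin n)} (hA : IsBlocks A)
    {A' : Fin r → Finset (Fin n)} (hA' : IsBlocks A') {x x' : Fin n → SignType}
    (hx : SignedBlocks A x) (hx' : SignedBlocks A' x') {δ : SignType} (hδ : δ ≠ 0)
    (h : ∀ i, x i ≠ 0 → x' i = δ * x i) (j : Fin r) : A j ⊆ A' j := by
  obtain ⟨ε, hε, h1⟩ := hx.exists_mul
  obtain ⟨ε', hε', h1'⟩ := hx'.exists_mul
  refine h1.subset hA hA' h1' (δ := ε' * δ * ε) ?_ (fun i hi => ?_) j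
  · refine mul_ne_zero (mul_ne_zero ?_ hδ) ?_ <;> rintro rfl <;> simp at hε hε'
  · rw [h i fun h0 => hi (by simp [h0])]
    calc ε' * (δ * x i) = ε' * δ * (ε * ε) * x i := by rw [hε]; simp [mul_assoc]
      _ = _ := by simp only [mul_assoc]

theorem SignedBlocks.eq {n r : ℕ} {A : Fin r → Finset (Fin n)} (hA : IsBlocks A)
    {A' : Fin r → Finset (Fin n)} (hA' : IsBlocks A') {x : Fin n → SignType}
    (hx : SignedBlocks A x) (hx' : SignedBlocks A' x) : A = A' :=
  funext fun j => le_antisymm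
    (hx.subset hA hA' hx' (δ := 1) (by decide) (fun i _ => (one_mul _).symm) j)
    (hx'.subset hA' hA hx (δ := 1) (by decide) (fun i _ => (one_mul _).symm) j)

theorem SignedBlocks.ne_zero_iff {n r : ℕ} {A : Fin r → Finset (Fin n)} {x : Fin n → SignType}
    (hx : SignedBlocks A x) (i : Fin n) : x i ≠ 0 ↔ ∃ j, i ∈ A j := by
  have : ∀ y : Fin n → SignType, HasBlocks A y → (y i ≠ 0 ↔ ∃ j, i ∈ A j) := by
    intro y hy
    constructor
    · intro h
      by_contra hc
      push Not at hc
      exact h (hy.2 i hc)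
    · rintro ⟨j, hj⟩
      rw [hy.1 j i hj]
      exact neg_one_pow_ne_zero_signType _
  rcases hx with hx | hx
  · exact this x hx
  · rw [← this _ hx]
    simp

/-- There is one sign change between any two consecutive blocks. The zero vector has no blocks, in
accordance with the convention that it has `-1` sign changes. -/
theorem SignedBlocks.signVar_eq {n r : ℕ} {A : Fin r → Finset (Fin n)} (hA : IsBlocks A)
    {x : Fin n → SignType} (hx : SignedBlocks A x) : signVar x = r - 1 := by
  by_cases h0 : x = 0
  · have hr : r = 0 := by
      by_contra hr
      obtain ⟨i, hi⟩ := hA.1 ⟨0, Nat.pos_of_ne_zero hr⟩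
      exact (hx.ne_zero_iff i).2 ⟨_, hi⟩ (by simp [h0])
    rw [signVar, if_pos h0, hr]
    simp
  · rw [signVar_eq_card_changes h0]
    obtain ⟨A', hA', hx'⟩ := exists_blocks h0
    have h1 := hx.le_card hA hA' hx' (δ := 1) (by decide) (fun i _ => (one_mul _).symm)
    have h2 := SignedBlocks.le_card hA' hA hx' hx (δ := 1) (by decide) (fun i _ => (one_mul _).symm)
    omega

theorem exists_signedBlocks {n : ℕ} (x : Fin n → SignType) :
    ∃ (r : ℕ) (A : Fin r → Finset (Fin n)), IsBlocks A ∧ SignedBlocks A x := by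
  by_cases hx : x = 0
  · refine ⟨0, fun _ => ∅, ⟨fun j => j.elim0, fun j => j.elim0⟩, Or.inl ⟨fun j => j.elim0, ?_⟩⟩
    simp [hx]
  · obtain ⟨A, h⟩ := exists_blocks hx
    exact ⟨_, A, h⟩

/-- Setting entries to zero does not create sign changes. -/
theorem signVar_mono {n : ℕ} {x x' : Fin n → SignType} (h : SignLE x x') :
    signVar x ≤ signVar x' := by
  obtain ⟨r, A, hA, hx⟩ := exists_signedBlocks x
  obtain ⟨r', A', hA', hx'⟩ := exists_signedBlocks x'
  rw [hx.signVar_eq hA, hx'.signVar_eq hA']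
  have := hx.le_card hA hA' hx' (δ := 1) (by decide) (fun i hi => by rw [one_mul, h i hi])
  omega

/-! ### Alternating twist -/

/-- The sign vector with every second sign reversed. -/
def twist {n : ℕ} (x : Fin n → SignType) : Fin n → SignType := fun i => (-1) ^ (i : ℕ) * x i

theorem twist_twist {n : ℕ} (x : Fin n → SignType) : twist (twist x) = x := by
  funext i
  rw [twist, twist, ← mul_assoc, signType_mul_self_eq_one (neg_one_pow_ne_zero_signType _), one_mul]

theorem twist_neg {n : ℕ} (x : Fin n → SignType) : twist (-x) = -twist x := by
  funext i
  simp [twist]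

theorem twist_ne_zero {n : ℕ} {x : Fin n → SignType} {i : Fin n} : twist x i ≠ 0 ↔ x i ≠ 0 := by
  simp [twist]

theorem twist_eq_zero {n : ℕ} {x : Fin n → SignType} : twist x = 0 ↔ x = 0 := by
  rw [funext_iff, funext_iff]
  exact forall_congr' fun i => not_iff_not.1 twist_ne_zero

theorem SignLE.twist {n : ℕ} {x y : Fin n → SignType} (h : SignLE x y) :
    SignLE (twist x) (twist y) := fun i hi => by
  rw [Amplituhedron.twist, Amplituhedron.twist, h i (twist_ne_zero.1 hi)]

/-- For a vector without zeros, each step from an index to the next one is a sign change either of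
the vector or of its twist. -/
theorem signVar_add_signVar_twist {n : ℕ} (hn : 0 < n) {x : Fin n → SignType}
    (hx : ∀ i, x i ≠ 0) : signVar x + signVar (twist x) = n - 1 := by
  have h0 : x ≠ 0 := fun h => hx ⟨0, hn⟩ (by simp [h])
  have hch : ∀ y : Fin n → SignType, (∀ i, y i ≠ 0) → ∀ q,
      (q ∈ changes y ↔ ∃ p : Fin n, (p : ℕ) + 1 = q ∧ y q = - y p) := by
    intro y hy q
    simp only [changes, Finset.mem_filter, Finset.mem_univ, true_and]
    constructor
    · rintro ⟨-, p, hpq, h1, h2⟩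
      refine ⟨p, ?_, h1⟩
      by_contra hc
      have hpq' := Fin.lt_def.1 hpq
      exact hy ⟨p + 1, by omega⟩ (h2 _ (Fin.lt_def.2 (by simp)) (Fin.lt_def.2 (by simp; omega)))
    · rintro ⟨p, hp, h⟩
      refine ⟨hy q, p, Fin.lt_def.2 (by omega), h, fun l h1 h2 => ?_⟩
      have h1 := Fin.lt_def.1 h1
      have h2 := Fin.lt_def.1 h2
      omega
  have hx' : ∀ i, twist x i ≠ 0 := fun i => twist_ne_zero.2 (hx i)
  have htw : ∀ p q : Fin n, (p : ℕ) + 1 = q → (twist x q = -twist x p ↔ x q = x p) := by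
    intro p q h
    have e1 := neg_one_pow_ne_zero_signType p
    have e2 := hx p
    have e3 := hx q
    rw [twist, twist, ← h, pow_succ]
    revert e1 e2 e3
    generalize x p = a
    generalize x q = b
    generalize (-1 : SignType) ^ (p : ℕ) = c
    revert a b c
    decide
  rw [signVar_eq_card_changes h0, signVar_eq_card_changes (twist_eq_zero.not.2 h0), ← Nat.cast_add,
    ← Finset.card_union_of_disjoint]
  · have : changes x ∪ changes (twist x) =
        Finset.univ.filter fun i : Fin n => (i : ℕ) ≠ 0 := by
      ext q
      rw [Finset.mem_union, hch x hx, hch _ hx', Finset.mem_filter]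
      constructor
      · rintro (⟨p, h, -⟩ | ⟨p, h, -⟩) <;> exact ⟨Finset.mem_univ _, by omega⟩
      · rintro ⟨-, h⟩
        have hp : ((⟨q - 1, by omega⟩ : Fin n) : ℕ) + 1 = q := by simp only; omega
        have : x q = - x ⟨q - 1, by omega⟩ ∨ x q = x ⟨q - 1, by omega⟩ := by
          have e1 := hx ⟨q - 1, by omega⟩
          have e2 := hx q
          revert e1 e2
          generalize x q = a
          generalize x ⟨q - 1, _⟩ = b
          revert a b
          decide
        rcases this with h | h
        · exact Or.inl ⟨_, hp, h⟩
        · exact Or.inr ⟨_, hp, (htw _ _ hp).2 h⟩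
    rw [this, card_filter_val_ne_zero]
    omega
  · rw [Finset.disjoint_left]
    intro q h1 h2
    obtain ⟨p, hp, h⟩ := (hch x hx q).1 h1
    obtain ⟨p', hp', h'⟩ := (hch _ hx' q).1 h2
    obtain rfl : p = p' := Fin.ext (by omega)
    rw [htw _ _ hp, h] at h'
    have e2 := hx p
    revert e2 h'
    generalize x p = a
    revert a
    decide

/-- The sign vector with given blocks. -/
noncomputable def blockSign {n r : ℕ} (A : Fin r → Finset (Fin n)) : Fin n → SignType :=
  open Classical in fun i => if h : ∃ j, i ∈ A j then (-1) ^ (h.choose : ℕ) else 0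

theorem hasBlocks_blockSign {n r : ℕ} {A : Fin r → Finset (Fin n)} (hA : IsBlocks A) :
    HasBlocks A (blockSign A) := by
  refine ⟨fun j i hi => ?_, fun i hi => ?_⟩
  · have h : ∃ j, i ∈ A j := ⟨j, hi⟩
    rw [blockSign, dif_pos h, hA.eq_of_mem h.choose_spec hi]
  · rw [blockSign, dif_neg (by simpa using hi)]

theorem HasBlocks.eq_blockSign {n r : ℕ} {A : Fin r → Finset (Fin n)} (hA : IsBlocks A)
    {x : Fin n → SignType} (hx : HasBlocks A x) : x = blockSign A := by
  funext i
  by_cases h : ∃ j, i ∈ A j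
  · obtain ⟨j, hj⟩ := h
    rw [hx.1 j i hj, (hasBlocks_blockSign hA).1 j i hj]
  · push Not at h
    rw [hx.2 i h, (hasBlocks_blockSign hA).2 i h]

theorem blockSign_signLE {n r : ℕ} {A A' : Fin r → Finset (Fin n)} (hA : IsBlocks A)
    (hA' : IsBlocks A') (h : ∀ j, A j ⊆ A' j) : SignLE (blockSign A) (blockSign A') := by
  intro i hi
  obtain ⟨j, hj⟩ := (SignedBlocks.ne_zero_iff (Or.inl (hasBlocks_blockSign hA)) i).1 hi
  rw [(hasBlocks_blockSign hA).1 j i hj, (hasBlocks_blockSign hA').1 j i (h j hj)]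

theorem le_signVarBar {n : ℕ} {σ τ : Fin n → SignType} (h : SignLE σ τ) :
    signVar τ ≤ signVarBar σ :=
  Finset.le_sup' signVar (Finset.mem_filter.2 ⟨Finset.mem_univ _, h⟩)

theorem signVarBar_neg {n : ℕ} (σ : Fin n → SignType) : signVarBar (-σ) = signVarBar σ := by
  have key : ∀ σ : Fin n → SignType, signVarBar (-σ) ≤ signVarBar σ := by
    intro σ
    refine Finset.sup'_le _ _ fun τ hτ => ?_
    have hτ := (Finset.mem_filter.1 hτ).2
    have h : SignLE σ (-τ) := fun i hi => by
      have := hτ i (by simpa using hi)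
      rw [Pi.neg_apply] at this ⊢
      rw [← this, neg_neg]
    obtain ⟨r, A, hA, hx⟩ := exists_signedBlocks τ
    rw [hx.signVar_eq hA, ← hx.neg.signVar_eq hA]
    exact le_signVarBar h
  refine le_antisymm (key σ) ?_
  have := key (-σ)
  rwa [neg_neg] at this

/-- The numbers of sign changes of a vector, with the zeros replaced in the best way, and of its
twist, with the zeros ignored, add up to `n - 1`. -/
theorem signVarBar_eq {n r : ℕ} (hr : 0 < r) {A : Fin r → Finset (Fin n)} (hA : IsBlocks A)
    {σ : Fin n → SignType} (h : SignedBlocks A (twist σ)) : signVarBar σ = n - r := by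
  have hn : 0 < n := (hA.1 ⟨0, hr⟩).choose.pos
  -- it suffices to treat one of `σ` and `-σ`
  wlog hx : HasBlocks A (twist σ) generalizing σ with H
  · rw [← signVarBar_neg]
    have h' : HasBlocks A (twist (-σ)) := by
      rw [twist_neg]; exact h.resolve_left hx
    exact H (Or.inl h') h'
  refine le_antisymm (Finset.sup'_le _ _ fun τ hτ => ?_) ?_
  -- filling the remaining zeros of `τ` makes the two numbers of sign changes add up to `n - 1`
  · have hτ := (Finset.mem_filter.1 hτ).2
    let τ' : Fin n → SignType := fun i => if τ i = 0 then 1 else τ i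
    have h1 : SignLE τ τ' := fun i hi => by simp [τ', hi]
    have h2 : ∀ i, τ' i ≠ 0 := fun i => by
      by_cases hi : τ i = 0
      · simp [τ', hi]
      · simp [τ', hi]
    have h3 := signVar_add_signVar_twist hn h2
    have h4 := signVar_mono h1
    have h5 : SignLE σ τ' := fun i hi => by
      rw [hτ i hi, h1 i]
      rw [← hτ i hi]; exact hi
    have h6 := signVar_mono h5.twist
    rw [h.signVar_eq hA] at h6
    linarith
  -- the best replacement of zeros enlarges the blocks to intervals that cover everything
  · obtain ⟨A', hA', hf, hs⟩ := hA.exists_full hr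
    have h1 : SignLE σ (twist (blockSign A')) := by
      have := (blockSign_signLE hA hA' hs).twist
      rwa [← hx.eq_blockSign hA, twist_twist] at this
    have h2 : ∀ i, twist (blockSign A') i ≠ 0 := fun i => twist_ne_zero.2
      ((SignedBlocks.ne_zero_iff (Or.inl (hasBlocks_blockSign hA')) i).2 (hf i))
    have h3 := signVar_add_signVar_twist hn h2
    rw [twist_twist, SignedBlocks.signVar_eq hA' (Or.inl (hasBlocks_blockSign hA'))] at h3
    have := le_signVarBar h1
    linarith

theorem exists_blocks_of_signVec {n k r : ℕ} (hr : 0 < r) (hn : r + k = n) (σ : SignVec n k) :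
    ∃ A : Fin r → Finset (Fin n), IsBlocks A ∧ SignedBlocks A (twist σ.1) := by
  obtain ⟨A, hA, hx⟩ := exists_blocks (twist_eq_zero.not.2 σ.2.1)
  have h := signVarBar_eq (Nat.succ_pos _) hA hx
  rw [σ.2.2] at h
  obtain rfl : r = (changes (twist σ.1)).card + 1 := by push_cast at h; omega
  exact ⟨A, hA, hx⟩

/-- The sign vector, without the twist, of given blocks. -/
noncomputable def blockSignVec {n k r : ℕ} (hr : 0 < r) (hn : r + k = n)
    (A : Fin r → Finset (Fin n)) (hA : IsBlocks A) : SignVec n k :=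
  ⟨twist (blockSign A), fun h => by
    obtain ⟨i, hi⟩ := hA.1 ⟨0, hr⟩
    exact twist_ne_zero.2 ((SignedBlocks.ne_zero_iff (Or.inl (hasBlocks_blockSign hA)) i).2
      ⟨_, hi⟩) (congrFun h i), by
    rw [signVarBar_eq hr hA (by rw [twist_twist]; exact Or.inl (hasBlocks_blockSign hA))]
    push_cast [← hn]
    ring⟩

theorem signedBlocks_blockSignVec {n k r : ℕ} (hr : 0 < r) (hn : r + k = n)
    (A : Fin r → Finset (Fin n)) (hA : IsBlocks A) :
    SignedBlocks A (twist (blockSignVec hr hn A hA).1) := by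
  rw [blockSignVec, twist_twist]
  exact Or.inl (hasBlocks_blockSign hA)

theorem SignedBlocks.eq_or_eq_neg {n r : ℕ} {A : Fin r → Finset (Fin n)} (hA : IsBlocks A)
    {x y : Fin n → SignType} (hx : SignedBlocks A (twist x)) (hy : SignedBlocks A (twist y)) :
    x = y ∨ x = -y := by
  have key : ∀ z : Fin n → SignType, SignedBlocks A (twist z) →
      z = twist (blockSign A) ∨ z = -twist (blockSign A) := by
    rintro z (h | h)
    · exact Or.inl (by rw [← h.eq_blockSign hA, twist_twist])
    · refine Or.inr ?_
      rw [← h.eq_blockSign hA, twist_neg, twist_twist, neg_neg]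
  rcases key x hx with h | h <;> rcases key y hy with h' | h' <;> simp [h, h']

/-- Comparison modulo `±1` is containment of blocks. -/
theorem psign_le_iff {n k r : ℕ} {A B : Fin r → Finset (Fin n)} (hA : IsBlocks A)
    (hB : IsBlocks B) {σ τ : SignVec n k} (hσ : SignedBlocks A (twist σ.1))
    (hτ : SignedBlocks B (twist τ.1)) :
    PSign.LE' (Quotient.mk _ σ) (Quotient.mk _ τ) ↔ ∀ j, A j ⊆ B j := by
  constructor
  · rintro ⟨σ', τ', h1, h2, h⟩
    have h1 : σ'.1 = σ.1 ∨ σ'.1 = -σ.1 := Quotient.exact h1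
    have h2 : τ'.1 = τ.1 ∨ τ'.1 = -τ.1 := Quotient.exact h2
    have hσ' : SignedBlocks A (twist σ'.1) := by
      rcases h1 with h1 | h1 <;> rw [h1]
      · exact hσ
      · rw [twist_neg]; exact hσ.neg
    have hτ' : SignedBlocks B (twist τ'.1) := by
      rcases h2 with h2 | h2 <;> rw [h2]
      · exact hτ
      · rw [twist_neg]; exact hτ.neg
    exact hσ'.subset hA hB hτ' (δ := 1) (by decide) (fun i hi => by rw [one_mul, h.twist i hi])
  · intro h
    -- the representatives whose twists are positive on the first block are comparable
    have key : ∀ {A : Fin r → Finset (Fin n)} (hA : IsBlocks A) (σ : SignVec n k),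
        SignedBlocks A (twist σ.1) → ∃ σ' : SignVec n k,
          Quotient.mk (signSetoid n k) σ' = Quotient.mk _ σ ∧ σ'.1 = twist (blockSign A) := by
      intro A hA σ hσ
      rcases hσ with h | h
      · exact ⟨σ, rfl, by rw [← h.eq_blockSign hA, twist_twist]⟩
      · refine ⟨⟨-σ.1, fun h => σ.2.1 (by rw [← neg_neg σ.1, h]; funext i; simp),
          by rw [signVarBar_neg]; exact σ.2.2⟩, Quotient.sound (Or.inr rfl), ?_⟩
        rw [← h.eq_blockSign hA, twist_neg, twist_twist]
    obtain ⟨σ', h1, h1'⟩ := key hA σ hσ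
    obtain ⟨τ', h2, h2'⟩ := key hB τ hτ
    refine ⟨σ', τ', h1, h2, ?_⟩
    rw [h1', h2']
    exact (blockSign_signLE hA hB h).twist

/-! ### Matroids of blocks -/

/-- The complements of the transversals of the blocks. -/
def blockBases {n r : ℕ} (A : Fin r → Finset (Fin n)) : Set (Finset (Fin n)) :=
  {I | ∃ b : Fin r → Fin n, (∀ j, b j ∈ A j) ∧ I = (Finset.univ.image b)ᶜ}

theorem card_of_mem_blockBases {n r k : ℕ} (hn : r + k = n) {A : Fin r → Finset (Fin n)}
    (hA : IsBlocks A) {I : Finset (Fin n)} (hI : I ∈ blockBases A) : I.card = k := by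
  obtain ⟨b, hb, rfl⟩ := hI
  rw [Finset.card_compl, Finset.card_image_of_injective _ (hA.strictMono hb).injective]
  simp
  omega

theorem mem_blockBases_iff {n r k : ℕ} (hn : r + k = n) {A : Fin r → Finset (Fin n)}
    (hA : IsBlocks A) {I : Finset (Fin n)} :
    I ∈ blockBases A ↔ I.card = k ∧ ∀ j, ∃ i ∈ A j, i ∉ I := by
  refine ⟨fun h => ⟨card_of_mem_blockBases hn hA h, ?_⟩, fun ⟨h, h'⟩ => ?_⟩
  · obtain ⟨b, hb, rfl⟩ := h
    exact fun j => ⟨b j, hb j, by simp⟩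
  · choose b hb hb' using h'
    refine ⟨b, hb, ?_⟩
    rw [eq_comm, compl_eq_comm, eq_comm]
    refine Finset.eq_of_subset_of_card_le (fun i hi => ?_) ?_
    · obtain ⟨j, -, rfl⟩ := Finset.mem_image.1 hi
      exact Finset.mem_compl.2 (hb' j)
    · rw [Finset.card_compl, Finset.card_image_of_injective _ (hA.strictMono hb).injective]
      simp
      omega

theorem blockBases_nonempty {n r : ℕ} {A : Fin r → Finset (Fin n)} (hA : IsBlocks A) :
    (blockBases A).Nonempty := by
  choose b hb using hA.1
  exact ⟨_, b, hb, rfl⟩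

theorem blockBases_subset_iff {n r : ℕ} {A A' : Fin r → Finset (Fin n)} (hA : IsBlocks A)
    (hA' : IsBlocks A') : blockBases A ⊆ blockBases A' ↔ ∀ j, A j ⊆ A' j := by
  constructor
  · intro h j i hi
    obtain ⟨b, hb, rfl⟩ := hA.exists_choice hi
    obtain ⟨b', hb', he⟩ := h ⟨b, hb, rfl⟩
    have h1 : Set.range b = Set.range b' := by
      have := compl_injective he
      rw [← Finset.coe_inj] at this
      simpa using this
    rw [((hA.strictMono hb).range_inj (hA'.strictMono hb')).1 h1]
    exact hb' j
  · rintro h I ⟨b, hb, rfl⟩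
    exact ⟨b, fun j => h j (hb j), rfl⟩

/-- `M` is a matroid on all indices whose bases are the complements of the transversals of the
blocks `A`. -/
def IsBlockMatroid {n r : ℕ} (A : Fin r → Finset (Fin n)) (M : Matroid (Fin n)) : Prop :=
  M.E = Set.univ ∧ ∀ I : Finset (Fin n), M.IsBase (I : Set (Fin n)) ↔ I ∈ blockBases A

theorem IsBlockMatroid.setOf_isBase {n r : ℕ} {A : Fin r → Finset (Fin n)}
    {M : Matroid (Fin n)} (h : IsBlockMatroid A M) :
    {I : Finset (Fin n) | M.IsBase (I : Set (Fin n))} = blockBases A :=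
  Set.ext h.2

theorem IsBlockMatroid.weakLE_iff {n r : ℕ} {A A' : Fin r → Finset (Fin n)} (hA : IsBlocks A)
    (hA' : IsBlocks A') {M M' : Matroid (Fin n)} (h : IsBlockMatroid A M)
    (h' : IsBlockMatroid A' M') : WeakLE M M' ↔ ∀ j, A j ⊆ A' j := by
  rw [← blockBases_subset_iff hA hA', ← h.setOf_isBase, ← h'.setOf_isBase]
  refine ⟨fun H I hI => H _ hI, fun H B hB => ?_⟩
  have := @H B.toFinite.toFinset (by simpa using hB)
  simpa using this

theorem IsBlockMatroid.eq {n r : ℕ} {A : Fin r → Finset (Fin n)} (hA : IsBlocks A)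
    {M M' : Matroid (Fin n)} (h : IsBlockMatroid A M) (h' : IsBlockMatroid A M') : M = M' := by
  have h1 := (h.weakLE_iff hA hA h').2 fun j => subset_rfl
  have h2 := (h'.weakLE_iff hA hA h).2 fun j => subset_rfl
  exact Matroid.ext_isBase (h.1.trans h'.1.symm) fun B _ => ⟨h1 B, h2 B⟩

theorem IsBlockMatroid.eRank_eq {n r k : ℕ} (hn : r + k = n) {A : Fin r → Finset (Fin n)}
    (hA : IsBlocks A) {M : Matroid (Fin n)} (h : IsBlockMatroid A M) : M.eRank = (k : ℕ∞) := by
  obtain ⟨I, hI⟩ := blockBases_nonempty hA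
  rw [← ((h.2 I).2 hI).encard_eq_eRank, Set.encard_coe_eq_coe_finsetCard,
    card_of_mem_blockBases hn hA hI]

/-- Two transversals are exchanged into each other one block at a time, so their complements are
the bases of a matroid. -/
theorem exists_isBlockMatroid {n r : ℕ} {A : Fin r → Finset (Fin n)} (hA : IsBlocks A) :
    ∃ M, IsBlockMatroid A M := by
  choose b₀ hb₀ using hA.1
  let P : Set (Fin n) → Prop := fun B => ∃ b : Fin r → Fin n, (∀ j, b j ∈ A j) ∧ B = (Set.range b)ᶜ
  have hex : Matroid.ExchangeProperty P := by
    rintro _ _ ⟨b, hb, rfl⟩ ⟨c, hc, rfl⟩ e ⟨he, he'⟩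
    obtain ⟨j, rfl⟩ := not_not.1 he'
    have hne : b j ≠ c j := fun h => he ⟨j, h⟩
    refine ⟨b j, ⟨?_, by simp⟩, Function.update b j (c j), fun l => ?_, ?_⟩
    · rintro ⟨l, hl⟩
      obtain rfl := hA.eq_of_mem (hc l) (hl ▸ hb j)
      exact hne hl.symm
    · by_cases h : l = j
      · subst h; simpa using hc l
      · simpa [h] using hb l
    · ext i
      simp only [Set.mem_insert_iff, Set.mem_sdiff, Set.mem_compl_iff, Set.mem_range,
        Set.mem_singleton_iff, not_exists]
      constructor
      · rintro (rfl | ⟨h1, h2⟩) l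
        · by_cases h : l = j
          · subst h; simpa using hne.symm
          · rw [Function.update_of_ne h]
            exact fun h' => h ((hA.strictMono hb).injective h')
        · by_cases h : l = j
          · subst h; simpa using fun h => h2 h.symm
          · rw [Function.update_of_ne h]; exact h1 l
      · intro h
        by_cases hi : i = b j
        · exact Or.inl hi
        · refine Or.inr ⟨fun l hl => ?_, fun h' => h j (by simp [h'])⟩
          by_cases hlj : l = j
          · subst hlj; exact hi hl.symm
          · exact h l (by rw [Function.update_of_ne hlj, hl])
  refine ⟨Matroid.ofExistsFiniteIsBase Set.univ P ⟨_, ⟨b₀, hb₀, rfl⟩, Set.toFinite _⟩ hex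
    fun _ _ => Set.subset_univ _, rfl, fun I => ?_⟩
  rw [Matroid.ofExistsFiniteIsBase_isBase]
  refine exists_congr fun b => and_congr_right fun _ => ?_
  rw [← Finset.coe_inj]
  simp

/-- The uniform matroid of corank one: its bases are the sets that omit one element of `E`. -/
theorem exists_corank_one_matroid {n : ℕ} {E : Set (Fin n)} (hE : E.Nonempty) :
    ∃ N : Matroid (Fin n), N.E = E ∧ ∀ B, N.IsBase B ↔ B ⊆ E ∧ B.ncard + 1 = E.ncard := by
  let P : Set (Fin n) → Prop := fun B => B ⊆ E ∧ B.ncard + 1 = E.ncard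
  have hex : Matroid.ExchangeProperty P := by
    rintro X Y ⟨hX, hX'⟩ ⟨hY, hY'⟩ e he
    have hc : (Y \ X).ncard = (X \ Y).ncard := by
      have h1 := Set.ncard_sdiff_add_ncard X Y
      have h2 := Set.ncard_sdiff_add_ncard Y X
      rw [Set.union_comm] at h2
      omega
    have : (Y \ X).Nonempty := by
      rw [← Set.ncard_pos, hc, Set.ncard_pos]
      exact ⟨e, he⟩
    obtain ⟨y, hy⟩ := this
    refine ⟨y, hy, Set.insert_subset (hY hy.1) (Set.sdiff_subset.trans hX), ?_⟩
    rw [Set.ncard_insert_of_notMem (fun h => hy.2 h.1), Set.ncard_sdiff_singleton_of_mem he.1]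
    have : 0 < X.ncard := (Set.ncard_pos (Set.toFinite _)).2 ⟨e, he.1⟩
    omega
  obtain ⟨a, ha⟩ := hE
  refine ⟨Matroid.ofExistsFiniteIsBase E P ⟨E \ {a}, ⟨Set.sdiff_subset, ?_⟩, Set.toFinite _⟩ hex
    fun _ h => h.1, rfl, fun B => Iff.rfl⟩
  rw [Set.ncard_sdiff_singleton_of_mem ha]
  have : 0 < E.ncard := (Set.ncard_pos (Set.toFinite _)).2 ⟨a, ha⟩
  omega

theorem inter_ncard_add_one_iff {n : ℕ} (B E : Set (Fin n)) :
    (B ∩ E).ncard + 1 = E.ncard ↔ ∃ a, E \ B = {a} := by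
  rw [← Set.ncard_eq_one]
  have := Set.ncard_inter_add_ncard_sdiff_eq_ncard E B
  rw [Set.inter_comm] at this
  omega

/-- A basis of a direct sum of uniform matroids of corank one omits one element of each ground
set. -/
theorem disjointSigma_isBase_iff_transversal {n r : ℕ} {N : Fin r → Matroid (Fin n)}
    (hN : Pairwise (Function.onFun Disjoint fun j => (N j).E))
    (h : ∀ j B, (N j).IsBase B ↔ B ⊆ (N j).E ∧ B.ncard + 1 = (N j).E.ncard)
    (hE : (⋃ j, (N j).E) = Set.univ) (B : Set (Fin n)) :
    (Matroid.disjointSigma N hN).IsBase B ↔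
      ∃ b : Fin r → Fin n, (∀ j, b j ∈ (N j).E) ∧ B = (Set.range b)ᶜ := by
  rw [Matroid.disjointSigma_isBase_iff, hE]
  simp only [h, Set.inter_subset_right, true_and, Set.subset_univ, and_true,
    inter_ncard_add_one_iff]
  constructor
  · intro h
    choose b hb using h
    have hb' : ∀ j, b j ∈ (N j).E \ B := fun j => by rw [hb j]; rfl
    refine ⟨b, fun j => (hb' j).1, ?_⟩
    ext i
    rw [Set.mem_compl_iff, Set.mem_range]
    refine ⟨fun hi => ?_, fun hi => ?_⟩
    · rintro ⟨j, rfl⟩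
      exact (hb' j).2 hi
    · by_contra hc
      obtain ⟨j, hj⟩ := Set.mem_iUnion.1 (hE.symm ▸ Set.mem_univ i)
      have : i ∈ (N j).E \ B := ⟨hj, hc⟩
      rw [hb j] at this
      exact hi ⟨j, this.symm⟩
  · rintro ⟨b, hb, rfl⟩ j
    refine ⟨b j, ?_⟩
    ext i
    simp only [Set.mem_sdiff, Set.mem_compl_iff, not_not, Set.mem_range, Set.mem_singleton_iff]
    constructor
    · rintro ⟨h1, l, rfl⟩
      by_contra hc
      exact Set.disjoint_left.1 (hN (show l ≠ j from fun h => hc (h ▸ rfl))) (hb l) h1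
    · rintro rfl
      exact ⟨hb j, j, rfl⟩

theorem IsFull.ordConnected {n r : ℕ} {A : Fin r → Finset (Fin n)} (hA : IsBlocks A)
    (hf : IsFull A) (j : Fin r) : (A j : Set (Fin n)).OrdConnected := by
  refine ⟨fun a ha b hb c hc => ?_⟩
  obtain ⟨l, hl⟩ := hf c
  have h1 := hA.le_of_le ha hl hc.1
  have h2 := hA.le_of_le hl hb hc.2
  rwa [le_antisymm h1 h2]

theorem exists_isBlockMatroid_mem_bcfwMatroids {n k : ℕ} (hk : k ≤ n)
    {A : Fin (n - k) → Finset (Fin n)} (hA : IsBlocks A) (hf : IsFull A) :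
    ∃ M ∈ bcfwMatroids n k, IsBlockMatroid A M := by
  choose N hNE hN using fun j => exists_corank_one_matroid (E := (A j : Set (Fin n))) (hA.1 j)
  have hd : Pairwise (Function.onFun Disjoint fun j => (N j).E) := by
    intro i j hij
    rw [Function.onFun, hNE, hNE, Set.disjoint_left]
    exact fun a ha hb => hij (hA.eq_of_mem ha hb)
  have hE : (⋃ j, (N j).E) = Set.univ := by
    refine Set.eq_univ_of_forall fun i => ?_
    obtain ⟨j, hj⟩ := hf i
    exact Set.mem_iUnion.2 ⟨j, by rw [hNE]; exact hj⟩
  have hM : IsBlockMatroid A (Matroid.disjointSigma N hd) := by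
    refine ⟨by rw [Matroid.disjointSigma_ground_eq, hE], fun I => ?_⟩
    rw [disjointSigma_isBase_iff_transversal hd (fun j B => by rw [hNE]; exact hN j B) hE]
    refine exists_congr fun b => and_congr ?_ ?_
    · simp [hNE]
    · rw [← Finset.coe_inj]; simp
  refine ⟨_, ⟨hM.1, hM.eRank_eq (by omega) hA, N, hd, fun j => ⟨?_, ?_, fun B => ?_⟩, rfl⟩, hM⟩
  · rw [hNE]; exact hA.1 j
  · rw [hNE]; exact hf.ordConnected hA j
  · rw [hNE]; exact hN j B

/-- The ground sets of the summands are blocks when sorted by their least elements. -/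
theorem exists_isBlockMatroid_of_mem_bcfwMatroids {n k : ℕ} {M : Matroid (Fin n)}
    (hM : M ∈ bcfwMatroids n k) :
    ∃ A : Fin (n - k) → Finset (Fin n), IsBlocks A ∧ IsFull A ∧ IsBlockMatroid A M := by
  classical
  obtain ⟨hE, -, N, hd, hN, rfl⟩ := hM
  let F : Fin (n - k) → Finset (Fin n) := fun j => (Set.toFinite (N j).E).toFinset
  have hF : ∀ j i, i ∈ F j ↔ i ∈ (N j).E := fun j i => by simp [F]
  have hFn : ∀ j, (F j).Nonempty := fun j => by
    obtain ⟨i, hi⟩ := (hN j).1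
    exact ⟨i, (hF j i).2 hi⟩
  let m : Fin (n - k) → Fin n := fun j => (F j).min' (hFn j)
  have hm : ∀ j, m j ∈ (N j).E := fun j => (hF j _).1 (Finset.min'_mem _ _)
  have hinj : Function.Injective m := by
    intro i j hij
    by_contra hc
    exact Set.disjoint_left.1 (hd hc) (hm i) (hij ▸ hm j)
  let e := Tuple.sort m
  have hmono : StrictMono (m ∘ e) :=
    (Tuple.monotone_sort m).strictMono_of_injective (hinj.comp e.injective)
  -- an interval that starts to the left of another one, disjoint from it, ends to the left of it
  have hA : IsBlocks (F ∘ e) := by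
    refine ⟨fun j => hFn _, fun i j hij a ha b hb => ?_⟩
    by_contra hc
    have h1 : m (e i) < m (e j) := hmono hij
    have h2 : m (e j) ≤ b := Finset.min'_le _ _ hb
    have h3 := (hN (e i)).2.1.out (hm (e i)) ((hF _ _).1 ha) ⟨h1.le, h2.trans (not_lt.1 hc)⟩
    exact Set.disjoint_left.1 (hd (fun h => hij.ne (e.injective h))) h3 (hm (e j))
  rw [Matroid.disjointSigma_ground_eq] at hE
  refine ⟨F ∘ e, hA, fun i => ?_, by rw [Matroid.disjointSigma_ground_eq, hE], fun I => ?_⟩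
  · obtain ⟨j, hj⟩ := Set.mem_iUnion.1 (hE.symm ▸ Set.mem_univ i)
    exact ⟨e.symm j, by simpa [hF] using hj⟩
  · rw [disjointSigma_isBase_iff_transversal hd (fun j => (hN j).2.2) hE]
    constructor
    · rintro ⟨b, hb, hI⟩
      refine ⟨b ∘ e, fun j => (hF _ _).2 (hb _), ?_⟩
      rw [← Finset.coe_inj, hI, Finset.coe_compl, Finset.coe_image, Finset.coe_univ,
        Set.image_univ, e.surjective.range_comp b]
    · rintro ⟨b, hb, rfl⟩
      refine ⟨b ∘ e.symm, fun j => ?_, ?_⟩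
      · have := (hF _ _).1 (hb (e.symm j))
        simpa using this
      · rw [e.symm.surjective.range_comp b]
        simp

/-- A matroid all of whose bases are complements of transversals of given blocks is again the
matroid of blocks: by the exchange property its transversals form a product set. -/
theorem exists_isBlockMatroid_of_weakLE {n r : ℕ} {A₀ : Fin r → Finset (Fin n)}
    (hA₀ : IsBlocks A₀) {M M₀ : Matroid (Fin n)} (hM₀ : IsBlockMatroid A₀ M₀)
    (hE : M.E = Set.univ) (hle : WeakLE M M₀) :
    ∃ A : Fin r → Finset (Fin n), IsBlocks A ∧ IsBlockMatroid A M := by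
  classical
  -- the transversals that belong to the bases of `M`
  let T : Set (Fin r → Fin n) := {b | (∀ j, b j ∈ A₀ j) ∧ M.IsBase (Set.range b)ᶜ}
  have hbase : ∀ B, M.IsBase B → ∃ b : Fin r → Fin n, (∀ j, b j ∈ A₀ j) ∧ B = (Set.range b)ᶜ := by
    intro B hB
    have h1 := hle B hB
    have h2 := (hM₀.2 B.toFinite.toFinset).1 (by simpa using h1)
    obtain ⟨b, hb, he⟩ := h2
    refine ⟨b, hb, ?_⟩
    rw [← Finset.coe_inj] at he
    simpa using he
  -- if `c j` leaves the basis that belongs to `b`, some `b l` enters it, and the result is the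
  -- complement of a transversal of `A₀` only for `l = j`
  have hupd : ∀ b ∈ T, ∀ c ∈ T, ∀ j, Function.update b j (c j) ∈ T := by
    rintro b ⟨hb, hb'⟩ c ⟨hc, hc'⟩ j
    by_cases hne : c j = b j
    · rw [hne, Function.update_eq_self]; exact ⟨hb, hb'⟩
    have hmem : ∀ l, Function.update b j (c j) l ∈ A₀ l := fun l => by
      by_cases h : l = j
      · subst h; simpa using hc l
      · simpa [h] using hb l
    have h1 : c j ∈ (Set.range b)ᶜ \ (Set.range c)ᶜ := by
      refine ⟨?_, by simp⟩
      rintro ⟨l, hl⟩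
      obtain rfl := hA₀.eq_of_mem (hb l) (hl ▸ hc j)
      exact hne hl.symm
    obtain ⟨y, ⟨-, hy⟩, hB⟩ := M.isBase_exchange _ _ hb' hc' _ h1
    obtain ⟨l, rfl⟩ := not_not.1 hy
    obtain ⟨d, hd, hd'⟩ := hbase _ hB
    have hlj : l = j := by
      by_contra hlj
      have h2 : d l ∉ insert (b l) ((Set.range b)ᶜ \ {c j}) := by rw [hd']; simp
      simp only [Set.mem_insert_iff, Set.mem_sdiff, Set.mem_compl_iff, Set.mem_singleton_iff,
        not_or, not_and, not_not] at h2
      by_cases h3 : d l ∈ Set.range b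
      · obtain ⟨l', hl'⟩ := h3
        obtain rfl := hA₀.eq_of_mem (hb l') (hl' ▸ hd l)
        exact h2.1 hl'.symm
      · exact hlj (hA₀.eq_of_mem (hd l) ((h2.2 h3).symm ▸ hc j))
    subst hlj
    refine ⟨hmem, ?_⟩
    convert hB using 1
    ext i
    simp only [Set.mem_insert_iff, Set.mem_sdiff, Set.mem_compl_iff, Set.mem_range,
      Set.mem_singleton_iff, not_exists]
    constructor
    · intro h
      by_cases hi : i = b l
      · exact Or.inl hi
      · refine Or.inr ⟨fun l' hl => ?_, fun h' => h l (by simp [h'])⟩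
        by_cases hlj : l' = l
        · subst hlj; exact hi hl.symm
        · exact h l' (by rw [Function.update_of_ne hlj, hl])
    · rintro (rfl | ⟨h1, h2⟩) l'
      · by_cases h : l' = l
        · subst h; simpa using hne
        · rw [Function.update_of_ne h]
          exact fun h' => h ((hA₀.strictMono hb).injective h')
      · by_cases h : l' = l
        · subst h; simpa using fun h => h2 h.symm
        · rw [Function.update_of_ne h]; exact h1 l'
  obtain ⟨b₀, hb₀⟩ : T.Nonempty := by
    obtain ⟨B, hB⟩ := M.exists_isBase
    obtain ⟨b, hb, rfl⟩ := hbase B hB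
    exact ⟨b, hb, hB⟩
  let A : Fin r → Finset (Fin n) := fun j => Finset.univ.filter fun i => ∃ b ∈ T, b j = i
  have hAmem : ∀ j i, i ∈ A j ↔ ∃ b ∈ T, b j = i := fun j i => by simp [A]
  have hsub : ∀ j, A j ⊆ A₀ j := fun j i hi => by
    obtain ⟨b, hb, rfl⟩ := (hAmem j i).1 hi
    exact hb.1 j
  -- `b₀` is changed into `d` one block at a time
  have hprod : ∀ d : Fin r → Fin n, (∀ j, d j ∈ A j) → d ∈ T := by
    intro d hd
    have : ∀ s : Finset (Fin r), s.piecewise d b₀ ∈ T := by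
      intro s
      induction s using Finset.induction_on with
      | empty => simpa using hb₀
      | insert j s _ ih =>
        obtain ⟨c, hc, hcj⟩ := (hAmem j _).1 (hd j)
        rw [Finset.piecewise_insert, ← hcj]
        exact hupd _ ih c hc j
    simpa using this Finset.univ
  refine ⟨A, ⟨fun j => ⟨b₀ j, (hAmem _ _).2 ⟨b₀, hb₀, rfl⟩⟩,
    fun i j hij a ha b hb => hA₀.2 i j hij a (hsub i ha) b (hsub j hb)⟩, hE, fun I => ?_⟩
  constructor
  · intro hI
    obtain ⟨b, hb, he⟩ := hbase _ hI
    refine ⟨b, fun j => (hAmem _ _).2 ⟨b, ⟨hb, he ▸ hI⟩, rfl⟩, ?_⟩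
    rw [← Finset.coe_inj, he]
    simp
  · rintro ⟨b, hb, rfl⟩
    simpa using (hprod b hb).2

theorem exists_isBlockMatroid_of_mem_bcfwMatroidsBar {n k : ℕ} {M : Matroid (Fin n)}
    (hM : M ∈ bcfwMatroidsBar n k) :
    ∃ A : Fin (n - k) → Finset (Fin n), IsBlocks A ∧ IsBlockMatroid A M := by
  obtain ⟨hE, -, M₀, hM₀, hle⟩ := hM
  obtain ⟨A₀, hA₀, -, h⟩ := exists_isBlockMatroid_of_mem_bcfwMatroids hM₀
  exact exists_isBlockMatroid_of_weakLE hA₀ h hE hle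

theorem IsBlockMatroid.mem_bcfwMatroidsBar {n k : ℕ} (hk : k < n)
    {A : Fin (n - k) → Finset (Fin n)} (hA : IsBlocks A) {M : Matroid (Fin n)}
    (hM : IsBlockMatroid A M) : M ∈ bcfwMatroidsBar n k := by
  obtain ⟨A₀, hA₀, hf, hs⟩ := hA.exists_full (by omega)
  obtain ⟨M₀, hM₀, h⟩ := exists_isBlockMatroid_mem_bcfwMatroids hk.le hA₀ hf
  exact ⟨hM.1, hM.eRank_eq (by omega) hA, M₀, hM₀, (hM.weakLE_iff hA hA₀ h).2 hs⟩

/-! ### Plabic graphs of the recursion -/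

/-- A vertex of an enlarged graph is an old vertex, the new boundary vertex or the new internal
vertex. -/
theorem vertex_cases {n : ℕ} {ι : Type} (v : Fin (n + 1) ⊕ Option ι) :
    (∃ x : Fin n ⊕ ι, v = oldVertex x) ∨ v = Sum.inl (Fin.last n) ∨ v = Sum.inr none := by
  rcases v with i | (_ | c)
  · refine Fin.lastCases (Or.inr (Or.inl rfl)) (fun i => Or.inl ⟨Sum.inl i, rfl⟩) i
  · exact Or.inr (Or.inr rfl)
  · exact Or.inl ⟨Sum.inr c, rfl⟩

theorem oldVertex_ne_last {n : ℕ} {ι : Type} (x : Fin n ⊕ ι) :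
    oldVertex x ≠ Sum.inl (Fin.last n) := by
  rcases x with i | c
  · exact fun h => (Fin.castSucc_lt_last i).ne (Sum.inl.inj h)
  · exact fun h => by cases h

theorem oldVertex_ne_none {n : ℕ} {ι : Type} (x : Fin n ⊕ ι) :
    oldVertex x ≠ Sum.inr none := by
  rcases x with i | c <;> exact fun h => by cases h

section Lollipop

variable {n : ℕ} (G : BoundaryGraph n)

theorem addLollipop_adj_old (x y : Fin n ⊕ G.Internal) :
    G.addLollipop.graph.Adj (oldVertex x) (oldVertex y) ↔ G.graph.Adj x y := by
  constructor
  · rintro ⟨_, (⟨x', y', h, hx, hy⟩ | ⟨h, _⟩) | (⟨x', y', h, hx, hy⟩ | ⟨h, _⟩)⟩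
    · rwa [oldVertex_injective hx, oldVertex_injective hy]
    · exact absurd h (oldVertex_ne_last _)
    · rw [oldVertex_injective hx, oldVertex_injective hy]; exact h.symm
    · exact absurd h (oldVertex_ne_last _)
  · exact fun h => ⟨fun e => h.ne (oldVertex_injective e), Or.inl (Or.inl ⟨x, y, h, rfl, rfl⟩)⟩

theorem addLollipop_not_adj_last (x : Fin n ⊕ G.Internal) :
    ¬ G.addLollipop.graph.Adj (oldVertex x) (Sum.inl (Fin.last n)) := by
  rintro ⟨_, (⟨x', y', h, hx, hy⟩ | ⟨h, _⟩) | (⟨x', y', h, hx, hy⟩ | ⟨_, h⟩)⟩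
  · exact oldVertex_ne_last _ hy.symm
  · exact oldVertex_ne_last _ h
  · exact oldVertex_ne_last _ hx.symm
  · exact oldVertex_ne_none _ h

theorem addLollipop_not_adj_none (x : Fin n ⊕ G.Internal) :
    ¬ G.addLollipop.graph.Adj (oldVertex x) (Sum.inr none) := by
  rintro ⟨_, (⟨x', y', h, hx, hy⟩ | ⟨h, _⟩) | (⟨x', y', h, hx, hy⟩ | ⟨_, h⟩)⟩
  · exact oldVertex_ne_none _ hy.symm
  · exact oldVertex_ne_last _ h
  · exact oldVertex_ne_none _ hx.symm
  · exact oldVertex_ne_none _ h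

theorem addLollipop_adj_last_none :
    G.addLollipop.graph.Adj (Sum.inl (Fin.last n)) (Sum.inr none) :=
  ⟨Sum.inl_ne_inr, Or.inl (Or.inr ⟨rfl, rfl⟩)⟩

/-- The new boundary vertex is never a source, since its edge is the only edge of the black vertex
of the lollipop and hence directed away from the latter. -/
theorem bases_addLollipop (I : Finset (Fin (n + 1))) :
    I ∈ G.addLollipop.bases ↔ ∃ I₀ ∈ G.bases, I = I₀.map Fin.castSuccEmb := by
  constructor
  · rintro ⟨O, ⟨h1, h2, h3, h4⟩, hI⟩
    have hadj : ∀ x w, O (oldVertex x) w → ∃ y, w = oldVertex y := by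
      intro x w h
      rcases vertex_cases w with hw | rfl | rfl
      · exact hw
      · exact absurd (h1 _ _ h) (addLollipop_not_adj_last G x)
      · exact absurd (h1 _ _ h) (addLollipop_not_adj_none G x)
    have hadj' : ∀ x w, O w (oldVertex x) → ∃ y, w = oldVertex y := by
      intro x w h
      rcases vertex_cases w with hw | rfl | rfl
      · exact hw
      · exact absurd (h1 _ _ h).symm (addLollipop_not_adj_last G x)
      · exact absurd (h1 _ _ h).symm (addLollipop_not_adj_none G x)
    have hlast : Fin.last n ∉ I := by
      rw [hI]
      rintro ⟨w, hw⟩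
      obtain rfl : w = Sum.inr none := by
        rcases vertex_cases w with ⟨x, rfl⟩ | rfl | rfl
        · exact absurd (h1 _ _ hw).symm (addLollipop_not_adj_last G x)
        · exact absurd rfl (h1 _ _ hw).ne
        · rfl
      obtain ⟨v, hv, -⟩ := h3 none (Or.inl rfl)
      rcases vertex_cases v with ⟨x, rfl⟩ | rfl | rfl
      · exact absurd (h1 _ _ hv).symm (addLollipop_not_adj_none G x)
      · exact (h2 _ _ (h1 _ _ hw)).1 hw hv
      · exact absurd rfl (h1 _ _ hv).ne
    refine ⟨Finset.univ.filter fun i => i.castSucc ∈ I, ⟨fun x y => O (oldVertex x) (oldVertex y),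
      ⟨fun x y h => (addLollipop_adj_old G x y).1 (h1 _ _ h),
        fun x y h => h2 _ _ ((addLollipop_adj_old G x y).2 h), fun c hc => ?_, fun c hc => ?_⟩,
        fun i => ?_⟩, ?_⟩
    · obtain ⟨v, hv, hu⟩ := h3 (some c) (Or.inr ⟨c, hc, rfl⟩)
      obtain ⟨y, rfl⟩ := hadj (Sum.inr c) v hv
      exact ⟨y, hv, fun y' hy' => oldVertex_injective (hu _ hy')⟩
    · obtain ⟨v, hv, hu⟩ := h4 (some c) (by
        rintro (h | ⟨d, hd, h⟩)
        · cases h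
        · exact hc (Option.some_injective _ h ▸ hd))
      obtain ⟨y, rfl⟩ := hadj' (Sum.inr c) v hv
      exact ⟨y, hv, fun y' hy' => oldVertex_injective (hu _ hy')⟩
    · rw [Finset.mem_filter, hI]
      constructor
      · rintro ⟨-, v, hv⟩
        obtain ⟨y, rfl⟩ := hadj (Sum.inl i) v hv
        exact ⟨y, hv⟩
      · rintro ⟨y, hy⟩
        exact ⟨Finset.mem_univ _, _, hy⟩
    · ext i
      refine Fin.lastCases ?_ (fun i => ?_) i
      · simp [hlast]
      · simp
  · rintro ⟨I₀, ⟨O, ⟨h1, h2, h3, h4⟩, hI⟩, rfl⟩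
    let O' : Fin (n + 1) ⊕ Option G.Internal → Fin (n + 1) ⊕ Option G.Internal → Prop :=
      fun a b => (∃ x y, O x y ∧ a = oldVertex x ∧ b = oldVertex y) ∨
        (a = Sum.inr none ∧ b = Sum.inl (Fin.last n))
    have hold : ∀ x y, O' (oldVertex x) (oldVertex y) ↔ O x y := by
      intro x y
      constructor
      · rintro (⟨x', y', h, hx, hy⟩ | ⟨h, -⟩)
        · rwa [oldVertex_injective hx, oldVertex_injective hy]
        · exact absurd h (oldVertex_ne_none _)
      · exact fun h => Or.inl ⟨x, y, h, rfl, rfl⟩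
    have hln : ¬ O' (Sum.inl (Fin.last n)) (Sum.inr none) := by
      rintro (⟨x, y, -, h, -⟩ | ⟨h, -⟩)
      · exact oldVertex_ne_last _ h.symm
      · cases h
    have hnl : O' (Sum.inr none) (Sum.inl (Fin.last n)) := Or.inr ⟨rfl, rfl⟩
    refine ⟨O', ⟨?_, ?_, ?_, ?_⟩, fun i => ?_⟩
    · rintro a b (⟨x, y, h, rfl, rfl⟩ | ⟨rfl, rfl⟩)
      · exact (addLollipop_adj_old G x y).2 (h1 _ _ h)
      · exact (addLollipop_adj_last_none G).symm
    · intro a b h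
      rcases vertex_cases a with ⟨x, rfl⟩ | rfl | rfl <;>
        rcases vertex_cases b with ⟨y, rfl⟩ | rfl | rfl
      · rw [hold, hold]
        exact h2 _ _ ((addLollipop_adj_old G x y).1 h)
      · exact absurd h (addLollipop_not_adj_last G x)
      · exact absurd h (addLollipop_not_adj_none G x)
      · exact absurd h.symm (addLollipop_not_adj_last G y)
      · exact absurd rfl h.ne
      · exact iff_of_false hln (not_not.2 hnl)
      · exact absurd h.symm (addLollipop_not_adj_none G y)
      · exact iff_of_true hnl hln
      · exact absurd rfl h.ne
    · rintro _ (rfl | ⟨c, hc, rfl⟩)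
      · refine ⟨_, hnl, ?_⟩
        rintro v (⟨x, y, -, h, -⟩ | ⟨-, h⟩)
        · exact absurd h.symm (oldVertex_ne_none _)
        · exact h
      · obtain ⟨v, hv, hu⟩ := h3 c hc
        refine ⟨oldVertex v, (hold (Sum.inr c) v).2 hv, ?_⟩
        rintro w (⟨x, y, h, hx, rfl⟩ | ⟨h, -⟩)
        · obtain rfl : Sum.inr c = x := oldVertex_injective hx
          rw [hu _ h]
        · cases h
    · intro b hb
      rcases b with _ | c
      · exact absurd (Or.inl rfl) hb
      · obtain ⟨v, hv, hu⟩ := h4 c fun h => hb (Or.inr ⟨c, h, rfl⟩)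
        refine ⟨oldVertex v, (hold v (Sum.inr c)).2 hv, ?_⟩
        rintro w (⟨x, y, h, rfl, hy⟩ | ⟨-, h⟩)
        · obtain rfl : Sum.inr c = y := oldVertex_injective hy
          rw [hu _ h]
        · cases h
    · refine Fin.lastCases ?_ (fun i => ?_) i
      · refine iff_of_false (by simp) ?_
        rintro ⟨v, ⟨x, y, -, h, -⟩ | ⟨h, -⟩⟩
        · exact oldVertex_ne_last _ h.symm
        · cases h
      · simp only [Finset.mem_map, Fin.castSuccEmb_apply, Fin.castSucc_inj, exists_eq_right, hI]
        constructor
        · rintro ⟨v, hv⟩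
          exact ⟨_, (hold (Sum.inl i) v).2 hv⟩
        · rintro ⟨v, ⟨x, y, h, hx, -⟩ | ⟨h, -⟩⟩
          · obtain rfl : Sum.inl i = x := oldVertex_injective hx
            exact ⟨y, h⟩
          · cases h

end Lollipop

section Attach

variable {n : ℕ} (G : BoundaryGraph (n + 1))

/-- The vertices of `G` in the graph in which the edge at the last boundary vertex has been
subdivided, the new vertex taking the place of the last boundary vertex. -/
noncomputable def subdividedVertex {n : ℕ} {ι : Type} (x : Fin (n + 1) ⊕ ι) :
    Fin (n + 2) ⊕ Option ι :=
  open Classical in if x = Sum.inl (Fin.last n) then Sum.inr none else oldVertex x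

theorem subdividedVertex_last {n : ℕ} {ι : Type} :
    subdividedVertex (Sum.inl (Fin.last n) : Fin (n + 1) ⊕ ι) = Sum.inr none :=
  if_pos rfl

theorem subdividedVertex_of_ne {n : ℕ} {ι : Type} {x : Fin (n + 1) ⊕ ι}
    (hx : x ≠ Sum.inl (Fin.last n)) : subdividedVertex x = oldVertex x :=
  if_neg hx

theorem subdividedVertex_injective {n : ℕ} {ι : Type} :
    Function.Injective (subdividedVertex : Fin (n + 1) ⊕ ι → _) := by
  intro x y h
  by_cases hx : x = Sum.inl (Fin.last n) <;> by_cases hy : y = Sum.inl (Fin.last n)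
  · rw [hx, hy]
  · rw [hx, subdividedVertex_last, subdividedVertex_of_ne hy] at h
    exact absurd h.symm (oldVertex_ne_none _)
  · rw [hy, subdividedVertex_last, subdividedVertex_of_ne hx] at h
    exact absurd h (oldVertex_ne_none _)
  · rw [subdividedVertex_of_ne hx, subdividedVertex_of_ne hy] at h
    exact oldVertex_injective h

theorem subdividedVertex_ne_oldVertex_last {n : ℕ} {ι : Type} (x : Fin (n + 1) ⊕ ι) :
    subdividedVertex x ≠ oldVertex (Sum.inl (Fin.last n)) := by
  by_cases hx : x = Sum.inl (Fin.last n)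
  · rw [hx, subdividedVertex_last]; exact (oldVertex_ne_none _).symm
  · rw [subdividedVertex_of_ne hx]; exact fun h => hx (oldVertex_injective h)

theorem subdividedVertex_ne_last {n : ℕ} {ι : Type} (x : Fin (n + 1) ⊕ ι) :
    subdividedVertex x ≠ Sum.inl (Fin.last (n + 1)) := by
  by_cases hx : x = Sum.inl (Fin.last n)
  · rw [hx, subdividedVertex_last]; exact Sum.inr_ne_inl
  · rw [subdividedVertex_of_ne hx]; exact oldVertex_ne_last _

theorem subdivided_vertex_cases {n : ℕ} {ι : Type} (v : Fin (n + 2) ⊕ Option ι) :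
    (∃ x : Fin (n + 1) ⊕ ι, v = subdividedVertex x) ∨
      v = oldVertex (Sum.inl (Fin.last n)) ∨ v = Sum.inl (Fin.last (n + 1)) := by
  rcases vertex_cases v with ⟨x, rfl⟩ | rfl | rfl
  · by_cases hx : x = Sum.inl (Fin.last n)
    · exact Or.inr (Or.inl (by rw [hx]))
    · exact Or.inl ⟨x, (subdividedVertex_of_ne hx).symm⟩
  · exact Or.inr (Or.inr rfl)
  · exact Or.inl ⟨_, subdividedVertex_last.symm⟩

/-- Adjacency in `G.attachLast`. -/
def AttachAdj (a b : Fin (n + 2) ⊕ Option G.Internal) : Prop :=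
  (∃ x y, G.graph.Adj x y ∧ a = subdividedVertex x ∧ b = subdividedVertex y) ∨
    ((a = oldVertex (Sum.inl (Fin.last n)) ∨ a = Sum.inl (Fin.last (n + 1))) ∧
      b = Sum.inr none) ∨
    ((b = oldVertex (Sum.inl (Fin.last n)) ∨ b = Sum.inl (Fin.last (n + 1))) ∧
      a = Sum.inr none)

theorem attachLast_adj_iff (a b : Fin (n + 2) ⊕ Option G.Internal) :
    G.attachLast.graph.Adj a b ↔ AttachAdj G a b := by
  constructor
  · rintro ⟨_, h⟩
    rcases h with (⟨x, y, h, h1, h2, rfl, rfl⟩ | ⟨x, h, rfl, rfl⟩ | ⟨rfl, rfl⟩ | ⟨rfl, rfl⟩) |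
        (⟨x, y, h, h1, h2, rfl, rfl⟩ | ⟨x, h, rfl, rfl⟩ | ⟨rfl, rfl⟩ | ⟨rfl, rfl⟩)
    · exact Or.inl ⟨x, y, h, (subdividedVertex_of_ne h1).symm, (subdividedVertex_of_ne h2).symm⟩
    · exact Or.inl ⟨x, _, h, (subdividedVertex_of_ne h.ne).symm, subdividedVertex_last.symm⟩
    · exact Or.inr (Or.inl ⟨Or.inl rfl, rfl⟩)
    · exact Or.inr (Or.inl ⟨Or.inr rfl, rfl⟩)
    · exact Or.inl ⟨y, x, h.symm, (subdividedVertex_of_ne h2).symm,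
        (subdividedVertex_of_ne h1).symm⟩
    · exact Or.inl ⟨_, x, h.symm, subdividedVertex_last.symm, (subdividedVertex_of_ne h.ne).symm⟩
    · exact Or.inr (Or.inr ⟨Or.inl rfl, rfl⟩)
    · exact Or.inr (Or.inr ⟨Or.inr rfl, rfl⟩)
  · rintro (⟨x, y, h, rfl, rfl⟩ | ⟨rfl | rfl, rfl⟩ | ⟨rfl | rfl, rfl⟩)
    · refine ⟨fun e => h.ne (subdividedVertex_injective e), ?_⟩
      by_cases hx : x = Sum.inl (Fin.last n)
      · subst hx
        rw [subdividedVertex_last, subdividedVertex_of_ne h.symm.ne]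
        exact Or.inr (Or.inr (Or.inl ⟨y, h.symm, rfl, rfl⟩))
      · by_cases hy : y = Sum.inl (Fin.last n)
        · subst hy
          rw [subdividedVertex_last, subdividedVertex_of_ne hx]
          exact Or.inl (Or.inr (Or.inl ⟨x, h, rfl, rfl⟩))
        · rw [subdividedVertex_of_ne hx, subdividedVertex_of_ne hy]
          exact Or.inl (Or.inl ⟨x, y, h, hx, hy, rfl, rfl⟩)
    · exact ⟨oldVertex_ne_none _, Or.inl (Or.inr (Or.inr (Or.inl ⟨rfl, rfl⟩)))⟩
    · exact ⟨Sum.inl_ne_inr, Or.inl (Or.inr (Or.inr (Or.inr ⟨rfl, rfl⟩)))⟩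
    · exact ⟨(oldVertex_ne_none _).symm, Or.inr (Or.inr (Or.inr (Or.inl ⟨rfl, rfl⟩)))⟩
    · exact ⟨Sum.inr_ne_inl, Or.inr (Or.inr (Or.inr (Or.inr ⟨rfl, rfl⟩)))⟩

theorem attachAdj_subdividedVertex (x y : Fin (n + 1) ⊕ G.Internal) :
    AttachAdj G (subdividedVertex x) (subdividedVertex y) ↔ G.graph.Adj x y := by
  constructor
  · rintro (⟨x', y', h, hx, hy⟩ | ⟨h | h, -⟩ | ⟨h | h, -⟩)
    · rwa [subdividedVertex_injective hx, subdividedVertex_injective hy]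
    · exact absurd h (subdividedVertex_ne_oldVertex_last _)
    · exact absurd h (subdividedVertex_ne_last _)
    · exact absurd h (subdividedVertex_ne_oldVertex_last _)
    · exact absurd h (subdividedVertex_ne_last _)
  · exact fun h => Or.inl ⟨x, y, h, rfl, rfl⟩

theorem subdividedVertex_internal {n : ℕ} {ι : Type} (c : ι) :
    subdividedVertex (Sum.inr c : Fin (n + 1) ⊕ ι) = Sum.inr (some c) :=
  subdividedVertex_of_ne Sum.inr_ne_inl

theorem subdividedVertex_castSucc {n : ℕ} {ι : Type} {i : Fin (n + 1)} (hi : i ≠ Fin.last n) :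
    subdividedVertex (Sum.inl i : Fin (n + 1) ⊕ ι) = Sum.inl i.castSucc :=
  subdividedVertex_of_ne fun h => hi (Sum.inl.inj h)

/-- The perfect orientations of `G.attachLast`, with the condition at the new black vertex separated
from those at the old internal vertices. -/
def IsAttachOrientation
    (O : Fin (n + 2) ⊕ Option G.Internal → Fin (n + 2) ⊕ Option G.Internal → Prop) : Prop :=
  (∀ u v, O u v → AttachAdj G u v) ∧ (∀ u v, AttachAdj G u v → (O u v ↔ ¬ O v u)) ∧
    (∃! v, O (Sum.inr none) v) ∧ (∀ c ∈ G.black, ∃! v, O (Sum.inr (some c)) v) ∧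
    ∀ c ∉ G.black, ∃! v, O v (Sum.inr (some c))

theorem mem_bases_attachLast_iff (I : Finset (Fin (n + 2))) :
    I ∈ G.attachLast.bases ↔
      ∃ O, IsAttachOrientation G O ∧ ∀ i, i ∈ I ↔ ∃ v, O (Sum.inl i) v := by
  refine exists_congr fun O => and_congr_left fun _ => ⟨?_, ?_⟩
  · rintro ⟨h1, h2, h3, h4⟩
    refine ⟨fun u v h => (attachLast_adj_iff G u v).1 (h1 u v h),
      fun u v h => h2 u v ((attachLast_adj_iff G u v).2 h), h3 none (Or.inl rfl),
      fun c hc => h3 (some c) (Or.inr ⟨c, hc, rfl⟩), fun c hc => h4 (some c) ?_⟩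
    rintro (h | ⟨d, hd, h⟩)
    · cases h
    · exact hc (Option.some_injective _ h ▸ hd)
  · rintro ⟨h1, h2, h3, h4, h5⟩
    refine ⟨fun u v h => (attachLast_adj_iff G u v).2 (h1 u v h),
      fun u v h => h2 u v ((attachLast_adj_iff G u v).1 h), ?_, ?_⟩
    · rintro _ (rfl | ⟨c, hc, rfl⟩)
      · exact h3
      · exact h4 c hc
    · rintro (_ | c) hc
      · exact absurd (Or.inl rfl) hc
      · exact h5 c fun h => hc (Or.inr ⟨c, h, rfl⟩)

/-- The perfect orientations of `G.attachLast` that extend a given one of `G`; `p` and `q` say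
whether the previous and the new last boundary vertex are sources. -/
theorem exists_orientation_attachLast
    {O : Fin (n + 1) ⊕ G.Internal → Fin (n + 1) ⊕ G.Internal → Prop}
    (hO : G.IsPerfectOrientation O) {p q : Prop}
    (h : ((∃ v, O (Sum.inl (Fin.last n)) v) ∧ p ∧ q) ∨
      ((¬ ∃ v, O (Sum.inl (Fin.last n)) v) ∧ ((p ∧ ¬ q) ∨ (¬ p ∧ q)))) :
    ∃ O', IsAttachOrientation G O' ∧
      (∀ i : Fin (n + 1), i ≠ Fin.last n →
        ((∃ v, O' (Sum.inl i.castSucc) v) ↔ ∃ v, O (Sum.inl i) v)) ∧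
      ((∃ v, O' (Sum.inl (Fin.last n).castSucc) v) ↔ p) ∧
      ((∃ v, O' (Sum.inl (Fin.last (n + 1))) v) ↔ q) := by
  obtain ⟨h1, h2, h3, h4⟩ := hO
  -- the previous and the new last boundary vertex
  let L₀ : Fin (n + 2) ⊕ Option G.Internal := oldVertex (Sum.inl (Fin.last n))
  let L₁ : Fin (n + 2) ⊕ Option G.Internal := Sum.inl (Fin.last (n + 1))
  have h01 : L₀ ≠ L₁ := oldVertex_ne_last _
  have h0N : L₀ ≠ Sum.inr none := oldVertex_ne_none _
  have h1N : L₁ ≠ Sum.inr none := Sum.inl_ne_inr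
  -- the edges of `G` keep their directions
  let O' : Fin (n + 2) ⊕ Option G.Internal → Fin (n + 2) ⊕ Option G.Internal → Prop :=
    fun a b => (∃ x y, O x y ∧ a = subdividedVertex x ∧ b = subdividedVertex y) ∨
      (a = L₀ ∧ b = Sum.inr none ∧ p) ∨ (a = L₁ ∧ b = Sum.inr none ∧ q) ∨
      (a = Sum.inr none ∧ b = L₀ ∧ ¬ p) ∨ (a = Sum.inr none ∧ b = L₁ ∧ ¬ q)
  have hsub : ∀ x y, O' (subdividedVertex x) (subdividedVertex y) ↔ O x y := by
    intro x y
    constructor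
    · rintro (⟨x', y', h, hx, hy⟩ | ⟨h, -⟩ | ⟨h, -⟩ | ⟨-, h, -⟩ | ⟨-, h, -⟩)
      · rwa [subdividedVertex_injective hx, subdividedVertex_injective hy]
      · exact absurd h (subdividedVertex_ne_oldVertex_last _)
      · exact absurd h (subdividedVertex_ne_last _)
      · exact absurd h (subdividedVertex_ne_oldVertex_last _)
      · exact absurd h (subdividedVertex_ne_last _)
    · exact fun h => Or.inl ⟨x, y, h, rfl, rfl⟩
  have hL0 : ∀ w, O' L₀ w ↔ w = Sum.inr none ∧ p := by
    intro w
    constructor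
    · rintro (⟨x', y', h, hx, hy⟩ | ⟨-, h⟩ | ⟨h, -⟩ | ⟨h, -⟩ | ⟨h, -⟩)
      · exact absurd hx.symm (subdividedVertex_ne_oldVertex_last _)
      · exact h
      · exact absurd h h01
      · exact absurd h h0N
      · exact absurd h h0N
    · rintro ⟨rfl, h⟩
      exact Or.inr (Or.inl ⟨rfl, rfl, h⟩)
  have hL1 : ∀ w, O' L₁ w ↔ w = Sum.inr none ∧ q := by
    intro w
    constructor
    · rintro (⟨x', y', h, hx, hy⟩ | ⟨h, -⟩ | ⟨-, h⟩ | ⟨h, -⟩ | ⟨h, -⟩)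
      · exact absurd hx.symm (subdividedVertex_ne_last _)
      · exact absurd h.symm h01
      · exact h
      · exact absurd h h1N
      · exact absurd h h1N
    · rintro ⟨rfl, h⟩
      exact Or.inr (Or.inr (Or.inl ⟨rfl, rfl, h⟩))
  have hN0 : O' (Sum.inr none) L₀ ↔ ¬ p := by
    constructor
    · rintro (⟨x', y', h, hx, hy⟩ | ⟨h, -⟩ | ⟨h, -⟩ | ⟨-, -, h⟩ | ⟨-, h, -⟩)
      · exact absurd hy.symm (subdividedVertex_ne_oldVertex_last _)
      · exact absurd h.symm h0N
      · exact absurd h.symm h1N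
      · exact h
      · exact absurd h h01
    · exact fun h => Or.inr (Or.inr (Or.inr (Or.inl ⟨rfl, rfl, h⟩)))
  have hN1 : O' (Sum.inr none) L₁ ↔ ¬ q := by
    constructor
    · rintro (⟨x', y', h, hx, hy⟩ | ⟨h, -⟩ | ⟨h, -⟩ | ⟨-, h, -⟩ | ⟨-, -, h⟩)
      · exact absurd hy.symm (subdividedVertex_ne_last _)
      · exact absurd h.symm h0N
      · exact absurd h.symm h1N
      · exact absurd h.symm h01
      · exact h
    · exact fun h => Or.inr (Or.inr (Or.inr (Or.inr ⟨rfl, rfl, h⟩)))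
  have hNs : ∀ y, O' (Sum.inr none) (subdividedVertex y) ↔ O (Sum.inl (Fin.last n)) y := by
    intro y
    rw [← hsub, subdividedVertex_last]
  have hint : ∀ x : Fin (n + 1) ⊕ G.Internal, x ≠ Sum.inl (Fin.last n) →
      ∀ w, O' (subdividedVertex x) w → ∃ y, w = subdividedVertex y ∧ O x y := by
    rintro x hne w (⟨x', y', h, hx, hy⟩ | ⟨h, -⟩ | ⟨h, -⟩ | ⟨h, -⟩ | ⟨h, -⟩)
    · exact ⟨y', hy, by rwa [subdividedVertex_injective hx]⟩
    · exact absurd h (subdividedVertex_ne_oldVertex_last _)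
    · exact absurd h (subdividedVertex_ne_last _)
    · exact absurd (subdividedVertex_injective (h.trans subdividedVertex_last.symm)) hne
    · exact absurd (subdividedVertex_injective (h.trans subdividedVertex_last.symm)) hne
  have hint' : ∀ x : Fin (n + 1) ⊕ G.Internal, x ≠ Sum.inl (Fin.last n) →
      ∀ w, O' w (subdividedVertex x) → ∃ y, w = subdividedVertex y ∧ O y x := by
    rintro x hne w (⟨x', y', h, hx, hy⟩ | ⟨-, h, -⟩ | ⟨-, h, -⟩ | ⟨-, h, -⟩ | ⟨-, h, -⟩)
    · exact ⟨x', hx, by rwa [subdividedVertex_injective hy]⟩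
    · exact absurd (subdividedVertex_injective (h.trans subdividedVertex_last.symm)) hne
    · exact absurd (subdividedVertex_injective (h.trans subdividedVertex_last.symm)) hne
    · exact absurd h (subdividedVertex_ne_oldVertex_last _)
    · exact absurd h (subdividedVertex_ne_last _)
  refine ⟨O', ⟨?_, ?_, ?_, ?_, ?_⟩, ?_, ?_, ?_⟩
  · intro a b hab
    rcases hab with ⟨x, y, h, hx, hy⟩ | ⟨h, h', -⟩ | ⟨h, h', -⟩ | ⟨h, h', -⟩ | ⟨h, h', -⟩
    · exact Or.inl ⟨x, y, h1 _ _ h, hx, hy⟩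
    · exact Or.inr (Or.inl ⟨Or.inl h, h'⟩)
    · exact Or.inr (Or.inl ⟨Or.inr h, h'⟩)
    · exact Or.inr (Or.inr ⟨Or.inl h', h⟩)
    · exact Or.inr (Or.inr ⟨Or.inr h', h⟩)
  · intro a b hab
    rcases hab with ⟨x, y, h, rfl, rfl⟩ | ⟨rfl | rfl, rfl⟩ | ⟨rfl | rfl, rfl⟩
    · rw [hsub, hsub]; exact h2 _ _ h
    · rw [hL0, hN0]; simp
    · rw [hL1, hN1]; simp
    · rw [hL0, hN0]; simp
    · rw [hL1, hN1]; simp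
  -- the outgoing edge of the new black vertex is the edge it has in `G` or leads to the one of the
  -- last two boundary vertices that is not a source
  · rcases h with ⟨⟨v, hv⟩, hp, hq⟩ | ⟨hv, ⟨hp, hq⟩ | ⟨hp, hq⟩⟩
    · refine ⟨subdividedVertex v, (hNs v).2 hv, fun w hw => ?_⟩
      rcases subdivided_vertex_cases w with ⟨x, rfl⟩ | rfl | rfl
      · rw [(G.boundary (Fin.last n)).unique (h1 _ _ ((hNs x).1 hw)) (h1 _ _ hv)]
      · exact absurd hp (hN0.1 hw)
      · exact absurd hq (hN1.1 hw)
    · refine ⟨L₁, hN1.2 hq, fun w hw => ?_⟩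
      rcases subdivided_vertex_cases w with ⟨x, rfl⟩ | rfl | rfl
      · exact absurd ⟨x, (hNs x).1 hw⟩ hv
      · exact absurd hp (hN0.1 hw)
      · rfl
    · refine ⟨L₀, hN0.2 hp, fun w hw => ?_⟩
      rcases subdivided_vertex_cases w with ⟨x, rfl⟩ | rfl | rfl
      · exact absurd ⟨x, (hNs x).1 hw⟩ hv
      · rfl
      · exact absurd hq (hN1.1 hw)
  · intro c hc
    obtain ⟨v, hv, hu⟩ := h3 c hc
    rw [← subdividedVertex_internal]
    refine ⟨subdividedVertex v, (hsub _ v).2 hv, fun w hw => ?_⟩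
    obtain ⟨y, rfl, hy⟩ := hint _ Sum.inr_ne_inl w hw
    rw [hu _ hy]
  · intro c hc
    obtain ⟨v, hv, hu⟩ := h4 c hc
    rw [← subdividedVertex_internal]
    refine ⟨subdividedVertex v, (hsub v _).2 hv, fun w hw => ?_⟩
    obtain ⟨y, rfl, hy⟩ := hint' _ Sum.inr_ne_inl w hw
    rw [hu _ hy]
  · intro i hi
    rw [← subdividedVertex_castSucc hi]
    constructor
    · rintro ⟨w, hw⟩
      obtain ⟨y, -, hy⟩ := hint _ (fun h => hi (Sum.inl.inj h)) w hw
      exact ⟨y, hy⟩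
    · rintro ⟨v, hv⟩
      exact ⟨_, (hsub _ v).2 hv⟩
  · constructor
    · rintro ⟨w, hw⟩
      exact ((hL0 w).1 hw).2
    · exact fun hp => ⟨_, (hL0 _).2 ⟨rfl, hp⟩⟩
  · constructor
    · rintro ⟨w, hw⟩
      exact ((hL1 w).1 hw).2
    · exact fun hq => ⟨_, (hL1 _).2 ⟨rfl, hq⟩⟩

/-- The restriction of a perfect orientation of `G.attachLast` to `G`. The new black vertex has a
single outgoing edge. If this is the edge it has in `G`, both of the last boundary vertices are
sources; otherwise exactly one of them is. -/
theorem restrict_orientation_attachLast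
    {O' : Fin (n + 2) ⊕ Option G.Internal → Fin (n + 2) ⊕ Option G.Internal → Prop}
    (hO' : IsAttachOrientation G O') :
    ∃ O, G.IsPerfectOrientation O ∧
      (∀ i : Fin (n + 1), i ≠ Fin.last n →
        ((∃ v, O' (Sum.inl i.castSucc) v) ↔ ∃ v, O (Sum.inl i) v)) ∧
      (((∃ v, O (Sum.inl (Fin.last n)) v) ∧ (∃ v, O' (Sum.inl (Fin.last n).castSucc) v) ∧
          ∃ v, O' (Sum.inl (Fin.last (n + 1))) v) ∨
        ((¬ ∃ v, O (Sum.inl (Fin.last n)) v) ∧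
          (((∃ v, O' (Sum.inl (Fin.last n).castSucc) v) ∧
              ¬ ∃ v, O' (Sum.inl (Fin.last (n + 1))) v) ∨
            ((¬ ∃ v, O' (Sum.inl (Fin.last n).castSucc) v) ∧
              ∃ v, O' (Sum.inl (Fin.last (n + 1))) v)))) := by
  obtain ⟨h1, h2, h3, h4, h5⟩ := hO'
  have hint : ∀ x : Fin (n + 1) ⊕ G.Internal, x ≠ Sum.inl (Fin.last n) →
      ∀ w, AttachAdj G (subdividedVertex x) w ∨ AttachAdj G w (subdividedVertex x) →
        ∃ y, w = subdividedVertex y := by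
    intro x hne w h
    have hsymm : AttachAdj G (subdividedVertex x) w := by
      rcases h with h | h
      · exact h
      · exact (attachLast_adj_iff G _ _).1 ((attachLast_adj_iff G _ _).2 h).symm
    replace h := hsymm
    clear hsymm
    rcases h with ⟨x', y', h, hx, hy⟩ | ⟨h | h, -⟩ | ⟨h, h'⟩
    · exact ⟨y', hy⟩
    · exact absurd h (subdividedVertex_ne_oldVertex_last _)
    · exact absurd h (subdividedVertex_ne_last _)
    · exact absurd (subdividedVertex_injective (h'.trans subdividedVertex_last.symm)) hne
  refine ⟨fun x y => O' (subdividedVertex x) (subdividedVertex y), ⟨fun x y h =>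
    (attachAdj_subdividedVertex G x y).1 (h1 _ _ h), fun x y h =>
    h2 _ _ ((attachAdj_subdividedVertex G x y).2 h), fun c hc => ?_, fun c hc => ?_⟩, ?_, ?_⟩
  · obtain ⟨v, hv, hu⟩ := h4 c hc
    rw [← subdividedVertex_internal] at hv hu
    obtain ⟨y, rfl⟩ := hint _ Sum.inr_ne_inl v (Or.inl (h1 _ _ hv))
    exact ⟨y, hv, fun y' hy' => subdividedVertex_injective (hu _ hy')⟩
  · obtain ⟨v, hv, hu⟩ := h5 c hc
    rw [← subdividedVertex_internal] at hv hu
    obtain ⟨y, rfl⟩ := hint _ Sum.inr_ne_inl v (Or.inr (h1 _ _ hv))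
    exact ⟨y, hv, fun y' hy' => subdividedVertex_injective (hu _ hy')⟩
  · intro i hi
    rw [← subdividedVertex_castSucc hi]
    constructor
    · rintro ⟨w, hw⟩
      obtain ⟨y, rfl⟩ := hint _ (fun h => hi (Sum.inl.inj h)) w (Or.inl (h1 _ _ hw))
      exact ⟨y, hw⟩
    · rintro ⟨v, hv⟩
      exact ⟨_, hv⟩
  · have hbd : ∀ i : Fin (n + 2), (i = (Fin.last n).castSucc ∨ i = Fin.last (n + 1)) →
        ((∃ v, O' (Sum.inl i) v) ↔ ¬ O' (Sum.inr none) (Sum.inl i)) := by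
      intro i hi
      have hadj : AttachAdj G (Sum.inl i) (Sum.inr none) := by
        rcases hi with rfl | rfl
        · exact Or.inr (Or.inl ⟨Or.inl rfl, rfl⟩)
        · exact Or.inr (Or.inl ⟨Or.inr rfl, rfl⟩)
      rw [← h2 _ _ hadj]
      refine ⟨?_, fun h => ⟨_, h⟩⟩
      rintro ⟨v, hv⟩
      rcases h1 _ _ hv with ⟨x, y, -, h, -⟩ | ⟨-, rfl⟩ | ⟨-, h⟩
      · rcases hi with rfl | rfl
        · exact absurd h.symm (subdividedVertex_ne_oldVertex_last x)
        · exact absurd h.symm (subdividedVertex_ne_last x)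
      · exact hv
      · cases h
    rw [hbd _ (Or.inl rfl), hbd _ (Or.inr rfl)]
    obtain ⟨v, hv, hu⟩ := h3
    simp only [subdividedVertex_last, not_not]
    have e1 : (Sum.inl (Fin.last n).castSucc : Fin (n + 2) ⊕ Option G.Internal) ≠
        Sum.inl (Fin.last (n + 1)) := oldVertex_ne_last (Sum.inl (Fin.last n))
    rcases subdivided_vertex_cases v with ⟨x, rfl⟩ | rfl | rfl
    · refine Or.inl ⟨⟨x, hv⟩, fun h => ?_, fun h => ?_⟩
      · exact subdividedVertex_ne_oldVertex_last x (hu _ h).symm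
      · exact subdividedVertex_ne_last x (hu _ h).symm
    · refine Or.inr ⟨?_, Or.inr ⟨hv, fun h => e1 (hu _ h).symm⟩⟩
      rintro ⟨y, hy⟩
      exact subdividedVertex_ne_oldVertex_last y (hu _ hy)
    · refine Or.inr ⟨?_, Or.inl ⟨fun h => e1 (hu _ h), hv⟩⟩
      rintro ⟨y, hy⟩
      exact subdividedVertex_ne_last y (hu _ hy)

/-- If the previous last boundary vertex was a source, then it remains one and the new one is a
source, too; otherwise either of the two may become a source, but not both. -/
theorem bases_attachLast (I : Finset (Fin (n + 2))) :
    I ∈ G.attachLast.bases ↔ ∃ I₀ ∈ G.bases,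
      I = insert (Fin.last (n + 1)) (I₀.map Fin.castSuccEmb) ∨
      (Fin.last n ∉ I₀ ∧ I = insert (Fin.last n).castSucc (I₀.map Fin.castSuccEmb)) := by
  classical
  rw [mem_bases_attachLast_iff]
  constructor
  · rintro ⟨O', hO', hI⟩
    obtain ⟨O, hO, h1, h2⟩ := restrict_orientation_attachLast G hO'
    refine ⟨Finset.univ.filter fun i => ∃ v, O (Sum.inl i) v, ⟨O, hO, by simp⟩, ?_⟩
    have key : ∀ i : Fin (n + 1), i ≠ Fin.last n →
        (i.castSucc ∈ I ↔ ∃ v, O (Sum.inl i) v) := fun i hi => by rw [hI, h1 i hi]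
    rw [← hI, ← hI] at h2
    have hmap : ∀ (s : Finset (Fin (n + 1))) (i : Fin (n + 1)),
        i.castSucc ∈ s.map Fin.castSuccEmb ↔ i ∈ s := by intro s i; simp
    have hmap' : ∀ (s : Finset (Fin (n + 1))), Fin.last (n + 1) ∉ s.map Fin.castSuccEmb := by simp
    rcases h2 with ⟨h3, h4, h5⟩ | ⟨h3, ⟨h4, h5⟩ | ⟨h4, h5⟩⟩
    · left
      ext i
      refine Fin.lastCases ?_ (fun i => ?_) i
      · simp [h5]
      · rw [Finset.mem_insert, or_iff_right (Fin.castSucc_lt_last i).ne, hmap, Finset.mem_filter]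
        by_cases hi : i = Fin.last n
        · subst hi; simp [h3, h4]
        · simp [key i hi]
    · right
      refine ⟨by simpa using h3, ?_⟩
      ext i
      refine Fin.lastCases ?_ (fun i => ?_) i
      · rw [Finset.mem_insert, or_iff_right (Fin.castSucc_lt_last _).ne']
        simp [h5]
      · rw [Finset.mem_insert, hmap, Finset.mem_filter, Fin.castSucc_inj]
        by_cases hi : i = Fin.last n
        · subst hi; simp [h4]
        · simp [key i hi, hi]
    · left
      ext i
      refine Fin.lastCases ?_ (fun i => ?_) i
      · simp [h5]
      · rw [Finset.mem_insert, or_iff_right (Fin.castSucc_lt_last i).ne, hmap, Finset.mem_filter]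
        by_cases hi : i = Fin.last n
        · subst hi; simp [h3, h4]
        · simp [key i hi]
  · rintro ⟨I₀, ⟨O, hO, hI⟩, h⟩
    have key : ∀ p q : Prop, ((Fin.last n ∈ I₀ ∧ p ∧ q) ∨
        (Fin.last n ∉ I₀ ∧ ((p ∧ ¬ q) ∨ (¬ p ∧ q)))) →
        (∀ i : Fin (n + 1), i ≠ Fin.last n → (i.castSucc ∈ I ↔ i ∈ I₀)) →
        ((Fin.last n).castSucc ∈ I ↔ p) → (Fin.last (n + 1) ∈ I ↔ q) →
        ∃ O', IsAttachOrientation G O' ∧ ∀ i, i ∈ I ↔ ∃ v, O' (Sum.inl i) v := by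
      intro p q hpq h1 h2 h3
      rw [hI] at hpq
      obtain ⟨O', hO', h1', h2', h3'⟩ := exists_orientation_attachLast G hO hpq
      refine ⟨O', hO', fun i => ?_⟩
      refine Fin.lastCases ?_ (fun i => ?_) i
      · rw [h3, h3']
      · by_cases hi : i = Fin.last n
        · rw [hi, h2, h2']
        · rw [h1 i hi, h1' i hi, hI]
    rcases h with rfl | ⟨h, rfl⟩
    · by_cases hl : Fin.last n ∈ I₀
      · exact key True True (by simp [hl]) (by simp) (by simp [hl]) (by simp)
      · exact key False True (by simp [hl]) (by simp) (by simp [hl]) (by simp)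
    · refine key True False (by simp [h]) (fun i hi => ?_) (by simp) ?_
      · rw [Finset.mem_insert, Fin.castSucc_inj, or_iff_right hi]
        simp
      · rw [Finset.mem_insert, or_iff_right (Fin.castSucc_lt_last _).ne']
        simp

end Attach

/-! ### The cells of the recursion -/

theorem bases_startGraph : startGraph.bases = {∅} := by
  ext I
  constructor
  · rintro ⟨O, ⟨h1, h2, h3, -⟩, hI⟩
    rw [Set.mem_singleton_iff, Finset.eq_empty_iff_forall_notMem]
    intro i hi
    obtain ⟨v, hv⟩ := (hI i).1 hi
    have hv' : v = Sum.inr () := by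
      rcases v with j | j
      · exact absurd (congrArg Sum.inl (Subsingleton.elim i j)) (h1 _ _ hv).ne
      · rfl
    obtain ⟨w, hw, -⟩ := h3 () trivial
    have hw' : w = Sum.inl i := by
      rcases w with j | j
      · exact congrArg Sum.inl (Subsingleton.elim j i)
      · exact absurd rfl (h1 _ _ hw).ne
    rw [hv'] at hv
    rw [hw'] at hw
    exact (h2 _ _ (h1 _ _ hv)).1 hv hw
  · rintro rfl
    refine ⟨fun a b => a = Sum.inr () ∧ b = Sum.inl 0, ⟨?_, ?_, ?_, ?_⟩, ?_⟩
    · rintro _ _ ⟨rfl, rfl⟩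
      exact Sum.inr_ne_inl
    · rintro (i | i) (j | j) h
      · exact absurd (congrArg Sum.inl (Subsingleton.elim i j)) h.ne
      · refine iff_of_false (fun h => Sum.inl_ne_inr h.1) (not_not.2 ⟨rfl, ?_⟩)
        exact congrArg Sum.inl (Subsingleton.elim i 0)
      · refine iff_of_true ⟨rfl, ?_⟩ (fun h => Sum.inl_ne_inr h.1)
        exact congrArg Sum.inl (Subsingleton.elim j 0)
      · exact absurd rfl h.ne
    · exact fun b _ => ⟨Sum.inl 0, ⟨rfl, rfl⟩, fun v hv => hv.2⟩
    · exact fun b hb => absurd trivial hb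
    · intro i
      refine iff_of_false (Finset.notMem_empty i) ?_
      rintro ⟨v, h, -⟩
      exact Sum.inl_ne_inr h

theorem mem_map_castSuccEmb {n : ℕ} {s : Finset (Fin n)} {i : Fin n} :
    i.castSucc ∈ s.map Fin.castSuccEmb ↔ i ∈ s := by simp

theorem last_notMem_map_castSuccEmb {n : ℕ} {s : Finset (Fin n)} :
    Fin.last n ∉ s.map Fin.castSuccEmb := by simp

/-- The blocks `A` with a further block added, which consists of a new last index. -/
def snocBlocks {n r : ℕ} (A : Fin r → Finset (Fin n)) : Fin (r + 1) → Finset (Fin (n + 1)) :=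
  Fin.snoc (α := fun _ => Finset (Fin (n + 1))) (fun j => (A j).map Fin.castSuccEmb) {Fin.last n}

/-- The blocks `A` with a new last index added to the last block. -/
def extendBlocks {n r : ℕ} (A : Fin (r + 1) → Finset (Fin n)) :
    Fin (r + 1) → Finset (Fin (n + 1)) := fun j =>
  if j = Fin.last r then insert (Fin.last n) ((A j).map Fin.castSuccEmb)
  else (A j).map Fin.castSuccEmb

theorem mem_snocBlocks_castSucc {n r : ℕ} {A : Fin r → Finset (Fin n)} {i : Fin (n + 1)}
    {j : Fin r} : i ∈ snocBlocks A j.castSucc ↔ ∃ i' ∈ A j, i'.castSucc = i := by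
  simp [snocBlocks]

theorem mem_snocBlocks_last {n r : ℕ} {A : Fin r → Finset (Fin n)} {i : Fin (n + 1)} :
    i ∈ snocBlocks A (Fin.last r) ↔ i = Fin.last n := by
  simp [snocBlocks]

theorem mem_extendBlocks {n r : ℕ} {A : Fin (r + 1) → Finset (Fin n)} {i : Fin (n + 1)}
    {j : Fin (r + 1)} : i ∈ extendBlocks A j ↔
      (∃ i' ∈ A j, i'.castSucc = i) ∨ (j = Fin.last r ∧ i = Fin.last n) := by
  unfold extendBlocks
  split_ifs with h
  · simp [h, or_comm]
  · simp [h]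

theorem isBlocks_snocBlocks {n r : ℕ} {A : Fin r → Finset (Fin n)} (hA : IsBlocks A) :
    IsBlocks (snocBlocks A) := by
  refine ⟨fun j => ?_, fun i j => ?_⟩
  · refine Fin.lastCases ?_ (fun j => ?_) j
    · exact ⟨_, mem_snocBlocks_last.2 rfl⟩
    · obtain ⟨i, hi⟩ := hA.1 j
      exact ⟨_, mem_snocBlocks_castSucc.2 ⟨i, hi, rfl⟩⟩
  · refine Fin.lastCases ?_ (fun i => ?_) i
    · exact fun h => absurd (Fin.le_last j) (not_le.2 h)
    · refine Fin.lastCases ?_ (fun j => ?_) j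
      · intro _ a ha b hb
        obtain ⟨a', -, rfl⟩ := mem_snocBlocks_castSucc.1 ha
        rw [mem_snocBlocks_last.1 hb]
        exact Fin.castSucc_lt_last a'
      · intro h a ha b hb
        obtain ⟨a', ha', rfl⟩ := mem_snocBlocks_castSucc.1 ha
        obtain ⟨b', hb', rfl⟩ := mem_snocBlocks_castSucc.1 hb
        exact hA.2 i j h a' ha' b' hb'

theorem IsFull.snocBlocks {n r : ℕ} {A : Fin r → Finset (Fin n)} (hf : IsFull A) :
    IsFull (snocBlocks A) := by
  intro i
  refine Fin.lastCases ?_ (fun i => ?_) i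
  · exact ⟨_, mem_snocBlocks_last.2 rfl⟩
  · obtain ⟨j, hj⟩ := hf i
    exact ⟨j.castSucc, mem_snocBlocks_castSucc.2 ⟨i, hj, rfl⟩⟩

theorem isBlocks_extendBlocks {n r : ℕ} {A : Fin (r + 1) → Finset (Fin n)} (hA : IsBlocks A) :
    IsBlocks (extendBlocks A) := by
  refine ⟨fun j => ?_, fun i j h a ha b hb => ?_⟩
  · obtain ⟨i, hi⟩ := hA.1 j
    exact ⟨_, mem_extendBlocks.2 (Or.inl ⟨i, hi, rfl⟩)⟩
  · rcases mem_extendBlocks.1 ha with ⟨a', ha', rfl⟩ | ⟨rfl, -⟩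
    · rcases mem_extendBlocks.1 hb with ⟨b', hb', rfl⟩ | ⟨-, rfl⟩
      · exact hA.2 i j h a' ha' b' hb'
      · exact Fin.castSucc_lt_last a'
    · exact absurd (Fin.le_last j) (not_le.2 h)

theorem IsFull.extendBlocks {n r : ℕ} {A : Fin (r + 1) → Finset (Fin n)} (hf : IsFull A) :
    IsFull (extendBlocks A) := by
  intro i
  refine Fin.lastCases ?_ (fun i => ?_) i
  · exact ⟨_, mem_extendBlocks.2 (Or.inr ⟨rfl, rfl⟩)⟩
  · obtain ⟨j, hj⟩ := hf i
    exact ⟨j, mem_extendBlocks.2 (Or.inl ⟨i, hj, rfl⟩)⟩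

theorem mem_blockBases_snocBlocks {n r : ℕ} {A : Fin r → Finset (Fin n)}
    {I : Finset (Fin (n + 1))} :
    I ∈ blockBases (snocBlocks A) ↔ ∃ I₀ ∈ blockBases A, I = I₀.map Fin.castSuccEmb := by
  constructor
  · rintro ⟨b, hb, rfl⟩
    have h1 := mem_snocBlocks_last.1 (hb (Fin.last r))
    choose c hc hc' using fun j : Fin r => mem_snocBlocks_castSucc.1 (hb j.castSucc)
    refine ⟨_, ⟨c, hc, rfl⟩, ?_⟩
    ext i
    refine Fin.lastCases ?_ (fun i => ?_) i
    · refine iff_of_false ?_ last_notMem_map_castSuccEmb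
      rw [Finset.mem_compl, not_not]
      exact Finset.mem_image.2 ⟨Fin.last r, Finset.mem_univ _, h1⟩
    · rw [mem_map_castSuccEmb, Finset.mem_compl, Finset.mem_compl, not_iff_not]
      simp only [Finset.mem_image, Finset.mem_univ, true_and, Fin.exists_fin_succ', h1, ← hc',
        Fin.castSucc_inj, or_iff_left (Fin.castSucc_lt_last i).ne']
  · rintro ⟨_, ⟨c, hc, rfl⟩, rfl⟩
    refine ⟨Fin.snoc (α := fun _ => Fin (n + 1)) (fun j => (c j).castSucc) (Fin.last n),
      fun j => ?_, ?_⟩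
    · refine Fin.lastCases ?_ (fun j => ?_) j
      · simpa using mem_snocBlocks_last.2 rfl
      · simpa using mem_snocBlocks_castSucc.2 ⟨c j, hc j, rfl⟩
    · ext i
      refine Fin.lastCases ?_ (fun i => ?_) i
      · refine iff_of_false last_notMem_map_castSuccEmb ?_
        rw [Finset.mem_compl, not_not]
        exact Finset.mem_image.2 ⟨Fin.last r, Finset.mem_univ _, by simp⟩
      · rw [mem_map_castSuccEmb, Finset.mem_compl, Finset.mem_compl, not_iff_not]
        simp only [Finset.mem_image, Finset.mem_univ, true_and, Fin.exists_fin_succ',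
          Fin.snoc_castSucc, Fin.snoc_last,
          Fin.castSucc_inj, or_iff_left (Fin.castSucc_lt_last i).ne']

/-- The transversals of the extended blocks obey the recursion of `bases_attachLast`: their
element in the last block is either old or the new index, and in the latter case it replaces the
previous last index. -/
theorem mem_blockBases_extendBlocks {n r : ℕ} {A : Fin (r + 1) → Finset (Fin (n + 1))}
    (hA : IsBlocks A) (hf : Fin.last n ∈ A (Fin.last r)) {I : Finset (Fin (n + 2))} :
    I ∈ blockBases (extendBlocks A) ↔ ∃ I₀ ∈ blockBases A,
      I = insert (Fin.last (n + 1)) (I₀.map Fin.castSuccEmb) ∨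
      (Fin.last n ∉ I₀ ∧ I = insert (Fin.last n).castSucc (I₀.map Fin.castSuccEmb)) := by
  have hlast : ∀ {s : Finset (Fin (n + 1))},
      Fin.last (n + 1) ∉ insert (Fin.last n).castSucc (s.map Fin.castSuccEmb) := by
    intro s h
    rcases Finset.mem_insert.1 h with h | h
    · exact (Fin.castSucc_lt_last _).ne' h
    · exact last_notMem_map_castSuccEmb h
  -- the transversals of the extended blocks that contain the new index
  have key : ∀ (b : Fin (r + 1) → Fin (n + 2)) (c : Fin (r + 1) → Fin (n + 1)),
      c (Fin.last r) = Fin.last n → b (Fin.last r) = Fin.last (n + 1) →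
      (∀ j, j ≠ Fin.last r → b j = (c j).castSucc) → (∀ j, c j ∈ A j) →
      (Finset.univ.image b)ᶜ =
        insert (Fin.last n).castSucc ((Finset.univ.image c)ᶜ.map Fin.castSuccEmb) := by
    intro b c hc hb hbc hcA
    ext i
    refine Fin.lastCases ?_ (fun i => ?_) i
    · refine iff_of_false ?_ hlast
      rw [Finset.mem_compl, not_not]
      exact Finset.mem_image.2 ⟨Fin.last r, Finset.mem_univ _, hb⟩
    · rw [Finset.mem_insert, mem_map_castSuccEmb, Finset.mem_compl, Finset.mem_compl,
        Fin.castSucc_inj]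
      simp only [Finset.mem_image, Finset.mem_univ, true_and]
      constructor
      · intro h
        by_cases hi : i = Fin.last n
        · exact Or.inl hi
        · refine Or.inr ?_
          rintro ⟨j, rfl⟩
          exact h ⟨j, hbc j fun hj => hi (hj ▸ hc)⟩
      · rintro h ⟨j, hj⟩
        by_cases hjl : j = Fin.last r
        · rw [hjl, hb] at hj
          exact (Fin.castSucc_lt_last i).ne' hj
        · rw [hbc j hjl, Fin.castSucc_inj] at hj
          rcases h with rfl | h
          · exact hjl (hA.eq_of_mem (hj ▸ hcA j) hf)
          · exact h ⟨j, hj⟩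
  constructor
  · rintro ⟨b, hb, rfl⟩
    by_cases h1 : b (Fin.last r) = Fin.last (n + 1)
    · have h2 : ∀ j, ∃ i ∈ A j, j ≠ Fin.last r → b j = i.castSucc := by
        intro j
        by_cases hj : j = Fin.last r
        · subst hj
          exact ⟨_, hf, fun h => absurd rfl h⟩
        · rcases mem_extendBlocks.1 (hb j) with ⟨i, hi, h⟩ | ⟨h, -⟩
          · exact ⟨i, hi, fun _ => h.symm⟩
          · exact absurd h hj
      choose c₀ hc₀ hc₀' using h2
      have hc : ∀ j, Function.update c₀ (Fin.last r) (Fin.last n) j ∈ A j := by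
        intro j
        by_cases hj : j = Fin.last r
        · subst hj; simpa using hf
        · simpa [hj] using hc₀ j
      refine ⟨_, ⟨_, hc, rfl⟩, Or.inr ⟨?_, key b _ (by simp) h1 (fun j hj => ?_) hc⟩⟩
      · rw [Finset.mem_compl, not_not]
        exact Finset.mem_image.2 ⟨Fin.last r, Finset.mem_univ _, by simp⟩
      · rw [Function.update_of_ne hj, hc₀' j hj]
    · have h2 : ∀ j, ∃ i ∈ A j, i.castSucc = b j := by
        intro j
        rcases mem_extendBlocks.1 (hb j) with h | ⟨rfl, h⟩
        · exact h
        · exact absurd h h1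
      choose c hc hc' using h2
      refine ⟨_, ⟨c, hc, rfl⟩, Or.inl ?_⟩
      ext i
      refine Fin.lastCases ?_ (fun i => ?_) i
      · simp [← hc']
      · rw [Finset.mem_insert, mem_map_castSuccEmb, or_iff_right (Fin.castSucc_lt_last i).ne]
        simp [← hc']
  · rintro ⟨_, ⟨c, hc, rfl⟩, rfl | ⟨h, rfl⟩⟩
    · refine ⟨fun j => (c j).castSucc, fun j => mem_extendBlocks.2 (Or.inl ⟨_, hc j, rfl⟩), ?_⟩
      ext i
      refine Fin.lastCases ?_ (fun i => ?_) i
      · simp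
      · rw [Finset.mem_insert, mem_map_castSuccEmb, or_iff_right (Fin.castSucc_lt_last i).ne]
        simp
    · rw [Finset.mem_compl, not_not] at h
      obtain ⟨l, -, hl⟩ := Finset.mem_image.1 h
      obtain rfl : l = Fin.last r := hA.eq_of_mem (hl ▸ hc l) hf
      refine ⟨Function.update (fun j => (c j).castSucc) (Fin.last r) (Fin.last (n + 1)),
        fun j => ?_, (key _ c hl (by simp) (fun j hj => by simp [hj]) hc).symm⟩
      by_cases hj : j = Fin.last r
      · subst hj
        simpa using mem_extendBlocks.2 (Or.inr ⟨rfl, rfl⟩)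
      · simpa [hj] using mem_extendBlocks.2 (Or.inl ⟨c j, hc j, rfl⟩)

theorem IsFull.last_mem {n r : ℕ} {A : Fin (r + 1) → Finset (Fin (n + 1))} (hA : IsBlocks A)
    (hf : IsFull A) : Fin.last n ∈ A (Fin.last r) := by
  obtain ⟨j, hj⟩ := hf (Fin.last n)
  obtain ⟨i, hi⟩ := hA.1 (Fin.last r)
  rwa [← le_antisymm (Fin.le_last j) (hA.le_of_le hi hj (Fin.le_last i))]

theorem bases_addLollipop_eq {n r : ℕ} {G : BoundaryGraph n} {A : Fin r → Finset (Fin n)}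
    (h : G.bases = blockBases A) : G.addLollipop.bases = blockBases (snocBlocks A) := by
  ext I
  rw [bases_addLollipop, mem_blockBases_snocBlocks, h]

theorem bases_attachLast_eq {n r : ℕ} {G : BoundaryGraph (n + 1)}
    {A : Fin (r + 1) → Finset (Fin (n + 1))} (hA : IsBlocks A) (hf : IsFull A)
    (h : G.bases = blockBases A) : G.attachLast.bases = blockBases (extendBlocks A) := by
  ext I
  rw [bases_attachLast, mem_blockBases_extendBlocks hA (hf.last_mem hA), h]

theorem bases_startGraph_eq {A : Fin 1 → Finset (Fin 1)} (hf : IsFull A) :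
    startGraph.bases = blockBases A := by
  rw [bases_startGraph]
  ext I
  rw [Set.mem_singleton_iff]
  constructor
  · rintro rfl
    obtain ⟨j, hj⟩ := hf 0
    refine ⟨fun _ => 0, fun j' => Subsingleton.elim j j' ▸ hj, ?_⟩
    decide
  · rintro ⟨b, -, rfl⟩
    ext i
    rw [Subsingleton.elim i (b 0)]
    simp

theorem exists_blocks_of_isBCFW {n k : ℕ} {G : BoundaryGraph n} (hG : IsBCFW n k G) :
    ∃ r, r + 1 + k = n ∧ ∃ A : Fin (r + 1) → Finset (Fin n), IsBlocks A ∧ IsFull A ∧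
      G.bases = blockBases A := by
  induction hG with
  | start =>
    have hf : IsFull fun _ : Fin 1 => (Finset.univ : Finset (Fin 1)) :=
      fun i => ⟨0, Finset.mem_univ _⟩
    refine ⟨0, rfl, fun _ => Finset.univ, ⟨fun j => ⟨0, Finset.mem_univ _⟩,
      fun i j h => ?_⟩, hf, bases_startGraph_eq hf⟩
    exact absurd (Subsingleton.elim (α := Fin 1) i j) h.ne
  | addLollipop _ ih =>
    obtain ⟨r, hr, A, hA, hf, h⟩ := ih
    exact ⟨r + 1, by omega, snocBlocks A, isBlocks_snocBlocks hA, hf.snocBlocks,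
      bases_addLollipop_eq h⟩
  | attachLast _ ih =>
    obtain ⟨r, hr, A, hA, hf, h⟩ := ih
    exact ⟨r, by omega, extendBlocks A, isBlocks_extendBlocks hA, hf.extendBlocks,
      bases_attachLast_eq hA hf h⟩

/-- Every partition into intervals arises in the recursion. The last index is removed: if it is a
block of its own, the last step was a lollipop, and otherwise an attached edge. -/
theorem exists_isBCFW_of_blocks (n : ℕ) : ∀ (r k : ℕ), r + 1 + k = n + 1 →
    ∀ A : Fin (r + 1) → Finset (Fin (n + 1)), IsBlocks A → IsFull A →
      ∃ G, IsBCFW (n + 1) k G ∧ G.bases = blockBases A := by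
  induction n with
  | zero =>
    intro r k hr A hA hf
    obtain rfl : r = 0 := by omega
    obtain rfl : k = 0 := by omega
    exact ⟨_, IsBCFW.start, bases_startGraph_eq hf⟩
  | succ n ih =>
    intro r k hr A hA hf
    have hl := hf.last_mem hA
    by_cases h1 : A (Fin.last r) = {Fin.last (n + 1)}
    · obtain ⟨r, rfl⟩ : ∃ r', r = r' + 1 := by
        cases r with
        | zero =>
          obtain ⟨j, hj⟩ := hf 0
          rw [Subsingleton.elim (α := Fin 1) j (Fin.last 0), h1, Finset.mem_singleton] at hj
          exact absurd hj (Fin.last_pos' (n := n + 1)).ne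
        | succ r => exact ⟨r, rfl⟩
      let A₀ : Fin (r + 1) → Finset (Fin (n + 1)) := fun j =>
        Finset.univ.filter fun i => i.castSucc ∈ A j.castSucc
      have hm : ∀ j i, i ∈ A₀ j ↔ i.castSucc ∈ A j.castSucc := fun j i => by simp [A₀]
      have hnl : ∀ j : Fin (r + 1), Fin.last (n + 1) ∉ A j.castSucc := fun j hj =>
        (Fin.castSucc_lt_last j).ne (hA.eq_of_mem hj hl)
      have hf₀ : IsFull A₀ := by
        intro i
        obtain ⟨j, hj⟩ := hf i.castSucc
        revert hj
        refine Fin.lastCases ?_ (fun j => ?_) j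
        · intro hj
          rw [h1, Finset.mem_singleton] at hj
          exact absurd hj (Fin.castSucc_lt_last i).ne
        · exact fun hj => ⟨j, (hm j i).2 hj⟩
      have hA₀ : IsBlocks A₀ := by
        refine ⟨fun j => ?_, fun i j h a ha b hb => ?_⟩
        · obtain ⟨i, hi⟩ := hA.1 j.castSucc
          revert hi
          refine Fin.lastCases ?_ (fun i => ?_) i
          · exact fun hi => absurd hi (hnl j)
          · exact fun hi => ⟨i, (hm j i).2 hi⟩
        · exact hA.2 _ _ (show i.castSucc < j.castSucc from h) _ ((hm _ _).1 ha) _ ((hm _ _).1 hb)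
      have he : A = snocBlocks A₀ := by
        funext j
        refine Fin.lastCases ?_ (fun j => ?_) j
        · ext i
          rw [mem_snocBlocks_last, h1, Finset.mem_singleton]
        · ext i
          rw [mem_snocBlocks_castSucc]
          refine Fin.lastCases ?_ (fun i => ?_) i
          · exact iff_of_false (hnl j) fun ⟨i', _, h⟩ => (Fin.castSucc_lt_last i').ne h
          · simp [hm]
      obtain ⟨G, hG, hb⟩ := ih r k (by omega) A₀ hA₀ hf₀
      exact ⟨_, hG.addLollipop, by rw [bases_addLollipop_eq hb, he]⟩
    · let A₀ : Fin (r + 1) → Finset (Fin (n + 1)) := fun j =>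
        Finset.univ.filter fun i => i.castSucc ∈ A j
      have hm : ∀ j i, i ∈ A₀ j ↔ i.castSucc ∈ A j := fun j i => by simp [A₀]
      have hf₀ : IsFull A₀ := by
        intro i
        obtain ⟨j, hj⟩ := hf i.castSucc
        exact ⟨j, (hm j i).2 hj⟩
      have hA₀ : IsBlocks A₀ := by
        refine ⟨fun j => ?_, fun i j h a ha b hb => ?_⟩
        · have : ∃ i ∈ A j, i ≠ Fin.last (n + 1) := by
            by_cases hj : j = Fin.last r
            · subst hj
              by_contra hc
              push Not at hc
              exact h1 (Finset.eq_singleton_iff_unique_mem.2 ⟨hl, hc⟩)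
            · obtain ⟨i, hi⟩ := hA.1 j
              refine ⟨i, hi, ?_⟩
              rintro rfl
              exact hj (hA.eq_of_mem hi hl)
          obtain ⟨i, hi, hne⟩ := this
          obtain ⟨i, rfl⟩ := Fin.exists_castSucc_eq.2 hne
          exact ⟨i, (hm j i).2 hi⟩
        · exact hA.2 _ _ h _ ((hm _ _).1 ha) _ ((hm _ _).1 hb)
      have he : A = extendBlocks A₀ := by
        funext j
        ext i
        rw [mem_extendBlocks]
        refine Fin.lastCases ?_ (fun i => ?_) i
        · constructor
          · exact fun h => Or.inr ⟨hA.eq_of_mem h hl, rfl⟩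
          · rintro (⟨i', _, h⟩ | ⟨rfl, -⟩)
            · exact absurd h (Fin.castSucc_lt_last i').ne
            · exact hl
        · rw [or_iff_left fun h => (Fin.castSucc_lt_last i).ne h.2]
          simp [hm]
      obtain ⟨k, rfl⟩ : ∃ k', k = k' + 1 := by
        cases k with
        | zero =>
          -- for `k = 0` there would be more blocks than remaining indices
          choose b hb using hA₀.1
          have := Fintype.card_le_of_injective b (hA₀.strictMono hb).injective
          simp at this
          omega
        | succ k => exact ⟨k, rfl⟩
      obtain ⟨G, hG, hb⟩ := ih r k (by omega) A₀ hA₀ hf₀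
      exact ⟨_, hG.attachLast, by rw [bases_attachLast_eq hA₀ hf₀ hb, he]⟩

/-- The BCFW cells are the cells of the partitions of the indices into intervals. -/
theorem bcfwCells_eq {n k r : ℕ} (hn : r + 1 + k = n) :
    bcfwCells k n = (fun A : Fin (r + 1) → Finset (Fin n) => posCell k n (blockBases A)) ''
      {A | IsBlocks A ∧ IsFull A} := by
  ext C
  constructor
  · rintro ⟨G, hG, rfl⟩
    obtain ⟨r', hr', A, hA, hf, h⟩ := exists_blocks_of_isBCFW hG
    obtain rfl : r' = r := by omega
    exact ⟨A, ⟨hA, hf⟩, by rw [h]⟩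
  · rintro ⟨A, ⟨hA, hf⟩, rfl⟩
    obtain ⟨n, rfl⟩ : ∃ m, n = m + 1 := ⟨n - 1, by omega⟩
    obtain ⟨G, hG, h⟩ := exists_isBCFW_of_blocks n r k hn A hA hf
    exact ⟨G, hG, by rw [h]⟩

/-! ### Maximal minors -/

/-- The maximal minor in the column set `I`, with the value `0` if `I` does not have the right
number of elements. -/
noncomputable def minor {k n : ℕ} (A : Matrix (Fin k) (Fin n) ℝ) (I : Finset (Fin n)) : ℝ :=
  if h : I.card = k then maxMinor A I h else 0

theorem minor_eq {k n : ℕ} (A : Matrix (Fin k) (Fin n) ℝ) {I : Finset (Fin n)} (h : I.card = k) :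
    minor A I = maxMinor A I h := dif_pos h

theorem orderEmbOfFin_erase {n k : ℕ} {T : Finset (Fin n)} (hT : T.card = k + 1) (j : Fin (k + 1))
    (h : (T.erase (T.orderEmbOfFin hT j)).card = k) :
    ((T.erase (T.orderEmbOfFin hT j)).orderEmbOfFin h : Fin k → Fin n) =
      T.orderEmbOfFin hT ∘ j.succAbove := by
  symm
  refine Finset.orderEmbOfFin_unique h (fun x => ?_)
    ((T.orderEmbOfFin hT).strictMono.comp (Fin.strictMono_succAbove j))
  rw [Finset.mem_erase]
  refine ⟨fun he => ?_, Finset.orderEmbOfFin_mem _ _ _⟩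
  exact Fin.succAbove_ne j x ((T.orderEmbOfFin hT).injective he)

theorem card_filter_lt_orderEmbOfFin {n k : ℕ} {T : Finset (Fin n)} (hT : T.card = k)
    (j : Fin k) : (T.filter (· < T.orderEmbOfFin hT j)).card = j := by
  have : T.filter (· < T.orderEmbOfFin hT j) =
      (Finset.Iio j).map (T.orderEmbOfFin hT).toEmbedding := by
    ext i
    simp only [Finset.mem_filter, Finset.mem_map, Finset.mem_Iio, RelEmbedding.coe_toEmbedding]
    constructor
    · rintro ⟨hi, hlt⟩
      have : i ∈ Set.range (T.orderEmbOfFin hT) := by rw [Finset.range_orderEmbOfFin]; exact hi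
      obtain ⟨l, rfl⟩ := this
      exact ⟨l, (T.orderEmbOfFin hT).lt_iff_lt.1 hlt, rfl⟩
    · rintro ⟨l, hl, rfl⟩
      exact ⟨Finset.orderEmbOfFin_mem _ _ _, (T.orderEmbOfFin hT).lt_iff_lt.2 hl⟩
  rw [this, Finset.card_map, Fin.card_Iio]

/-- The alternating relation between the maximal minors of `A` and a vector in the row span: the
expansion of a determinant with dependent rows. -/
theorem sum_mul_minor_erase {k n : ℕ} (A : Matrix (Fin k) (Fin n) ℝ)
    {v : EuclideanSpace ℝ (Fin n)} (hv : v ∈ rowSpan A) {T : Finset (Fin n)}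
    (hT : T.card = k + 1) :
    ∑ i ∈ T, (-1) ^ (T.filter (· < i)).card * v i * minor A (T.erase i) = 0 := by
  rw [rowSpan] at hv
  induction hv using Submodule.span_induction with
  | mem x hx =>
    obtain ⟨l, rfl⟩ := hx
    have hsum : ∀ F : Fin n → ℝ, ∑ i ∈ T, F i = ∑ j, F (T.orderEmbOfFin hT j) := by
      intro F
      conv_lhs => rw [← Finset.map_orderEmbOfFin_univ T hT]
      rw [Finset.sum_map]
      rfl
    rw [hsum]
    let M : Matrix (Fin (k + 1)) (Fin (k + 1)) ℝ :=
      Matrix.of (Fin.cons (fun j => A l (T.orderEmbOfFin hT j))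
        (fun l' j => A l' (T.orderEmbOfFin hT j)))
    have hM : M.det = 0 :=
      Matrix.det_zero_of_row_eq (i := 0) (j := l.succ) (Fin.succ_ne_zero l).symm (by
        funext j; simp [M])
    rw [Matrix.det_succ_row_zero] at hM
    rw [← hM]
    refine Finset.sum_congr rfl fun j _ => ?_
    have hc : (T.erase (T.orderEmbOfFin hT j)).card = k := by
      rw [Finset.card_erase_of_mem (Finset.orderEmbOfFin_mem _ _ _), hT]; rfl
    rw [card_filter_lt_orderEmbOfFin, minor_eq A hc, maxMinor, orderEmbOfFin_erase hT j hc]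
    rfl
  | zero => simp
  | add x y _ _ hx hy =>
    have h := congrArg₂ (· + ·) hx hy
    simp only [← Finset.sum_add_distrib, add_zero] at h
    rw [← h]
    refine Finset.sum_congr rfl fun i _ => ?_
    rw [PiLp.add_apply]; ring
  | smul a x _ hx =>
    rw [← mul_zero a, ← hx, Finset.mul_sum]
    refine Finset.sum_congr rfl fun i _ => ?_
    rw [PiLp.smul_apply, smul_eq_mul]; ring

/-- The signed maximal minors in the `k`-element subsets of `T`, as a vector orthogonal to the
rows. -/
noncomputable def circuitVec {k n : ℕ} (A : Matrix (Fin k) (Fin n) ℝ) (T : Finset (Fin n)) :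
    EuclideanSpace ℝ (Fin n) :=
  WithLp.toLp 2 fun i => if i ∈ T then (-1) ^ (T.filter (· < i)).card * minor A (T.erase i) else 0

theorem circuitVec_apply_of_mem {k n : ℕ} (A : Matrix (Fin k) (Fin n) ℝ) {T : Finset (Fin n)}
    {i : Fin n} (hi : i ∈ T) :
    circuitVec A T i = (-1) ^ (T.filter (· < i)).card * minor A (T.erase i) := by
  simp [circuitVec, hi]

theorem circuitVec_apply_of_notMem {k n : ℕ} (A : Matrix (Fin k) (Fin n) ℝ) {T : Finset (Fin n)}
    {i : Fin n} (hi : i ∉ T) : circuitVec A T i = 0 := by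
  simp [circuitVec, hi]

theorem circuitVec_mem_orthogonal {k n : ℕ} (A : Matrix (Fin k) (Fin n) ℝ) {T : Finset (Fin n)}
    (hT : T.card = k + 1) : circuitVec A T ∈ (rowSpan A)ᗮ := by
  rw [Submodule.mem_orthogonal]
  intro v hv
  rw [PiLp.inner_apply, ← sum_mul_minor_erase A hv hT,
    ← Finset.sum_subset (Finset.subset_univ T)]
  · refine Finset.sum_congr rfl fun i hi => ?_
    rw [circuitVec_apply_of_mem A hi]
    simp only [RCLike.inner_apply, conj_trivial]
    ring
  · intro i _ hi
    rw [circuitVec_apply_of_notMem A hi, inner_zero_right]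

/-- The Cauchy-Binet formula. The determinant is expanded over all functions `Fin k → Fin n`;
those that are not injective contribute nothing, and the others are the enumerations of the
`k`-element subsets. -/
theorem cauchy_binet {k n : ℕ} (A B : Matrix (Fin k) (Fin n) ℝ) :
    (A * B.transpose).det =
      ∑ I : {I : Finset (Fin n) // I.card = k}, maxMinor A I.1 I.2 * maxMinor B I.1 I.2 := by
  classical
  have h1 : (A * B.transpose).det =
      ∑ f : Fin k → Fin n, (∏ i, A i (f i)) * (Matrix.of fun i l => B l (f i)).det := by
    have : (A * B.transpose) = fun i => ∑ m, A i m • fun l => B l m := by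
      funext i l
      simp [Matrix.mul_apply, Finset.sum_apply]
    rw [this]
    change Matrix.detRowAlternating (fun i => ∑ m, A i m • fun l => B l m) = _
    rw [← AlternatingMap.coe_multilinearMap, MultilinearMap.map_sum]
    refine Finset.sum_congr rfl fun f _ => ?_
    rw [MultilinearMap.map_smul_univ, smul_eq_mul]
    rfl
  have h2 : ∀ I : {I : Finset (Fin n) // I.card = k}, maxMinor A I.1 I.2 * maxMinor B I.1 I.2 =
      ∑ s : Equiv.Perm (Fin k), (∏ i, A i (I.1.orderEmbOfFin I.2 (s i))) *
        (Matrix.of fun i l => B l (I.1.orderEmbOfFin I.2 (s i))).det := by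
    intro I
    have h3 : ∀ s : Equiv.Perm (Fin k),
        (Matrix.of fun i l => B l (I.1.orderEmbOfFin I.2 (s i))).det =
          ((Equiv.Perm.sign s : ℤ) : ℝ) * maxMinor B I.1 I.2 := by
      intro s
      rw [maxMinor, ← Matrix.det_transpose (B.submatrix _ _), ← Matrix.det_permute]
      rfl
    simp only [h3]
    rw [maxMinor, ← Matrix.det_transpose, Matrix.det_apply', Finset.sum_mul]
    refine Finset.sum_congr rfl fun s _ => ?_
    simp only [Matrix.transpose_apply, Matrix.submatrix_apply, id]
    ring
  rw [h1]
  simp only [h2]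
  rw [← Finset.sum_product' Finset.univ Finset.univ
    (fun (I : {I : Finset (Fin n) // I.card = k}) (s : Equiv.Perm (Fin k)) =>
      (∏ i, A i (I.1.orderEmbOfFin I.2 (s i))) *
        (Matrix.of fun i l => B l (I.1.orderEmbOfFin I.2 (s i))).det)]
  symm
  refine Finset.sum_of_injOn
    (fun p : {I : Finset (Fin n) // I.card = k} × Equiv.Perm (Fin k) =>
      fun i => p.1.1.orderEmbOfFin p.1.2 (p.2 i)) ?_
      (fun _ _ => Finset.mem_coe.2 (Finset.mem_univ _)) ?_ (fun _ _ => rfl)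
  · rintro ⟨⟨I, hI⟩, s⟩ - ⟨⟨J, hJ⟩, t⟩ - h
    have hr : ∀ (I : Finset (Fin n)) (hI : I.card = k) (s : Equiv.Perm (Fin k)),
        Set.range (fun i => I.orderEmbOfFin hI (s i)) = I := by
      intro I hI s
      rw [← Finset.range_orderEmbOfFin I hI]
      exact s.surjective.range_comp (I.orderEmbOfFin hI)
    obtain rfl : I = J := by
      rw [← Finset.coe_inj, ← hr I hI s, ← hr J hJ t]
      exact congrArg Set.range h
    simp only [Prod.mk.injEq, true_and]
    ext i
    have := congrFun h i
    simp only [EmbeddingLike.apply_eq_iff_eq] at this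
    rw [this]
  · intro f _ hf
    by_cases hinj : Function.Injective f
    · exfalso
      apply hf
      have hc : (Finset.univ.image f).card = k := by
        rw [Finset.card_image_of_injective _ hinj]; simp
      have hmem : ∀ i, f i ∈ Set.range ((Finset.univ.image f).orderEmbOfFin hc) := by
        intro i
        rw [Finset.range_orderEmbOfFin]
        simp
      choose s hs using hmem
      have hsinj : Function.Injective s := fun i j h => hinj (by rw [← hs, ← hs, h])
      refine ⟨⟨⟨_, hc⟩, Equiv.ofBijective s (Finite.injective_iff_bijective.1 hsinj)⟩,
        Finset.mem_coe.2 (Finset.mem_univ _), ?_⟩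
      funext i
      exact hs i
    · rw [Function.not_injective_iff] at hinj
      obtain ⟨i, j, h, hne⟩ := hinj
      rw [Matrix.det_zero_of_row_eq hne (by funext l; simp [h]), mul_zero]

theorem mem_rowSpan_iff {k n : ℕ} {A : Matrix (Fin k) (Fin n) ℝ} {v : EuclideanSpace ℝ (Fin n)} :
    v ∈ rowSpan A ↔ ∃ c : Fin k → ℝ, v = WithLp.toLp 2 (Matrix.vecMul c A) := by
  rw [rowSpan, Submodule.mem_span_range_iff_exists_fun]
  refine exists_congr fun c => ?_
  rw [eq_comm]
  have : ∑ i, c i • WithLp.toLp 2 (A i) = WithLp.toLp 2 (Matrix.vecMul c A) := by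
    ext j
    simp [Matrix.vecMul, dotProduct]
  rw [this]

theorem mem_orthogonal_rowSpan_iff {k n : ℕ} {A : Matrix (Fin k) (Fin n) ℝ}
    {w : EuclideanSpace ℝ (Fin n)} : w ∈ (rowSpan A)ᗮ ↔ A.mulVec (fun i => w i) = 0 := by
  have key : ∀ u : Fin n → ℝ, inner ℝ (WithLp.toLp 2 u) w = dotProduct u fun i => w i := by
    intro u
    rw [PiLp.inner_apply]
    refine Finset.sum_congr rfl fun i _ => ?_
    simp only [RCLike.inner_apply, conj_trivial]
    ring
  rw [Submodule.mem_orthogonal]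
  constructor
  · intro h
    funext i
    rw [Matrix.mulVec, ← key]
    exact h _ (Submodule.subset_span ⟨i, rfl⟩)
  · intro h v hv
    obtain ⟨c, rfl⟩ := mem_rowSpan_iff.1 hv
    rw [key, ← Matrix.dotProduct_mulVec, h, dotProduct_zero]

/-- Linearly independent rows have a nonzero maximal minor, since by the Cauchy-Binet formula their
Gram determinant is the sum of the squares of the maximal minors. -/
theorem exists_maxMinor_ne_zero {k n : ℕ} {A : Matrix (Fin k) (Fin n) ℝ}
    (hA : Module.finrank ℝ (rowSpan A) = k) :
    ∃ (I : Finset (Fin n)) (hI : I.card = k), maxMinor A I hI ≠ 0 := by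
  have hli : LinearIndependent ℝ fun i => (WithLp.toLp 2 (A i) : EuclideanSpace ℝ (Fin n)) := by
    rw [linearIndependent_iff_card_eq_finrank_span, Set.finrank]
    rw [rowSpan] at hA
    rw [hA, Fintype.card_fin]
  by_contra hc
  push Not at hc
  have hdet : (A * A.transpose).det = 0 := by
    rw [cauchy_binet]
    exact Finset.sum_eq_zero fun I _ => by rw [hc, zero_mul]
  obtain ⟨c, hc0, hc⟩ := Matrix.exists_vecMul_eq_zero_iff.2 hdet
  have h1 : dotProduct (Matrix.vecMul c A) (Matrix.vecMul c A) = 0 := by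
    rw [← Matrix.mulVec_transpose A c, Matrix.dotProduct_mulVec, Matrix.mulVec_transpose,
      Matrix.vecMul_vecMul, hc, zero_dotProduct]
  rw [dotProduct_self_eq_zero] at h1
  apply hc0
  funext i
  refine Fintype.linearIndependent_iff.1 hli c ?_ i
  ext j
  have := congrFun h1 j
  simpa [Matrix.vecMul, dotProduct] using this

/-! ### Sign variation and total positivity -/

theorem signOf_neg {n : ℕ} (w : EuclideanSpace ℝ (Fin n)) : signOf (-w) = -signOf w := by
  funext i
  simp [signOf, Left.sign_neg]

theorem signOf_eq_zero {n : ℕ} {w : EuclideanSpace ℝ (Fin n)} : signOf w = 0 ↔ w = 0 := by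
  constructor
  · intro h
    ext i
    exact sign_eq_zero_iff.1 (congrFun h i)
  · rintro rfl
    funext i
    simp [signOf]

/-- The sign vector of `w` after every second coordinate has been negated. -/
noncomputable def twistSign {n : ℕ} (w : EuclideanSpace ℝ (Fin n)) : Fin n → SignType :=
  twist (signOf w)

theorem twistSign_neg {n : ℕ} (w : EuclideanSpace ℝ (Fin n)) : twistSign (-w) = -twistSign w := by
  rw [twistSign, signOf_neg, twist_neg, twistSign]

theorem twistSign_ne_zero {n : ℕ} {w : EuclideanSpace ℝ (Fin n)} {i : Fin n} :
    twistSign w i ≠ 0 ↔ w i ≠ 0 := by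
  rw [twistSign, twist_ne_zero, signOf, sign_ne_zero]

theorem twistSign_eq_zero_iff {n : ℕ} {w : EuclideanSpace ℝ (Fin n)} :
    twistSign w = 0 ↔ w = 0 := by
  rw [twistSign, twist_eq_zero, signOf_eq_zero]

theorem signOf_eq_of_hasBlocks {n r : ℕ} {B : Fin r → Finset (Fin n)}
    {w : EuclideanSpace ℝ (Fin n)} (h : HasBlocks B (twistSign w)) {i : Fin n} {j : Fin r}
    (hi : i ∈ B j) : SignType.sign (w i) = (-1) ^ ((i : ℕ) + j) := by
  have h1 := h.1 j i hi
  have h2 : signOf w i = twist (twistSign w) i := by rw [twistSign, twist_twist]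
  rw [pow_add, ← h1]
  exact h2

theorem sign_prod_eq {ι : Type*} (S : Finset ι) (p : ι → Prop) [DecidablePred p] (x : ι → ℝ)
    (h1 : ∀ m ∈ S, p m → x m < 0) (h2 : ∀ m ∈ S, ¬ p m → 0 < x m) :
    SignType.sign (∏ m ∈ S, x m) = (-1) ^ (S.filter p).card := by
  have : SignType.sign (∏ m ∈ S, x m) = ∏ m ∈ S, SignType.sign (x m) := map_prod signHom x S
  rw [this, ← Finset.prod_filter_mul_prod_filter_not S p,
    Finset.prod_congr rfl (g := fun _ => (-1 : SignType)),
    Finset.prod_congr (s₁ := S.filter fun m => ¬ p m) rfl (g := fun _ => (1 : SignType)),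
    Finset.prod_const, Finset.prod_const_one, mul_one]
  · intro m hm
    rw [Finset.mem_filter] at hm
    exact sign_pos (h2 m hm.1 hm.2)
  · intro m hm
    rw [Finset.mem_filter] at hm
    exact sign_neg (h1 m hm.1 hm.2)

theorem sign_eq_sign_iff_mul_pos {a b : ℝ} (ha : a ≠ 0) (h : SignType.sign b = SignType.sign a) :
    0 < a / b := by
  rcases ha.lt_or_gt with ha | ha
  · rw [sign_neg ha, sign_eq_neg_one_iff] at h
    exact div_pos_of_neg_of_neg ha h
  · rw [sign_pos ha, sign_eq_one_iff] at h
    exact div_pos ha h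

/-- A polynomial that has the signs of `w` at the points `0, …, n - 1`. It has one root for each
index that is not the least element of a block: a zero of `w` is itself a root, and all other
roots lie half-way between two consecutive indices. -/
theorem exists_polynomial_sign_eq {n r : ℕ} (hr : 0 < r) {B : Fin r → Finset (Fin n)}
    (hB : IsBlocks B) {w : EuclideanSpace ℝ (Fin n)} (h : HasBlocks B (twistSign w)) :
    ∃ P : Polynomial ℝ, P.natDegree + r ≤ n ∧
      ∀ i : Fin n, SignType.sign (P.eval ((i : ℕ) : ℝ)) = SignType.sign (w i) := by
  classical
  let m₀ : Fin n := (B ⟨0, hr⟩).min' (hB.1 _)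
  let T : Finset (Fin n) := insert m₀ (blockMins hB)
  have hTsub : ∀ i ∈ T, ∃ j, i ∈ B j := by
    intro i hi
    rcases Finset.mem_insert.1 hi with rfl | hi
    · exact ⟨_, Finset.min'_mem _ _⟩
    · obtain ⟨j, -, rfl⟩ := Finset.mem_image.1 hi
      exact ⟨j, Finset.min'_mem _ _⟩
  have hm₀ : m₀ ∉ blockMins hB := by
    intro hm
    obtain ⟨j, hj, he⟩ := Finset.mem_image.1 hm
    have : j = ⟨0, hr⟩ := hB.min'_strictMono.injective he
    rw [this] at hj
    simp at hj
  have hTcard : T.card = r := by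
    rw [Finset.card_insert_of_notMem hm₀, card_blockMins]; omega
  have hle : ∀ (i : Fin n) (j : Fin r), i ∈ B j → (T.filter (· ≤ i)).card = j + 1 := by
    intro i j hi
    have hmi : m₀ ≤ i := by
      rcases (show (⟨0, hr⟩ : Fin r) ≤ j from Nat.zero_le _).lt_or_eq with hj | hj
      · exact (hB.2 _ _ hj _ (Finset.min'_mem _ _) _ hi).le
      · exact Finset.min'_le _ _ (hj ▸ hi)
    rw [Finset.filter_insert, if_pos hmi, Finset.card_insert_of_notMem, ← cutIndex_blockMins hB hi]
    · rfl
    · exact fun hm => hm₀ (Finset.mem_filter.1 hm).1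
  -- the set `T` consists of the least elements of the blocks, and `ρ m` is the root for `m ∉ T`
  let ρ : Fin n → ℝ := fun m => if w m = 0 then (m : ℕ) else (m : ℕ) - 1 / 2
  let P : Polynomial ℝ := ∏ m ∈ Tᶜ, (Polynomial.C (ρ m) - Polynomial.X)
  have heval : ∀ t : ℝ, P.eval t = ∏ m ∈ Tᶜ, (ρ m - t) := by
    intro t
    simp [P, Polynomial.eval_prod]
  refine ⟨P, ?_, fun i => ?_⟩
  · have : P.natDegree ≤ Tᶜ.card := by
      refine (Polynomial.natDegree_prod_le _ _).trans ?_
      rw [Finset.card_eq_sum_ones]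
      refine Finset.sum_le_sum fun m _ => ?_
      refine (Polynomial.natDegree_sub_le _ _).trans ?_
      simp
    rw [Finset.card_compl, hTcard, Fintype.card_fin] at this
    have hrn : r ≤ n := by
      rw [← hTcard]; simpa using Finset.card_le_univ T
    omega
  · rw [heval]
    by_cases hi : ∃ j, i ∈ B j
    · obtain ⟨j, hj⟩ := hi
      have hwi : w i ≠ 0 := by
        rw [← twistSign_ne_zero, h.1 j i hj]
        exact neg_one_pow_ne_zero_signType _
      rw [sign_prod_eq _ (· ≤ i), signOf_eq_of_hasBlocks h hj]
      -- of the `i + 1` indices up to `i`, exactly `j + 1` are least elements of blocks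
      · have hcount : (Tᶜ.filter (· ≤ i)).card + (j + 1) = i + 1 := by
          have h1 : (Finset.univ.filter fun m : Fin n => m ≤ i).card = i + 1 := by
            rw [← Fin.card_Iic]
            congr 1
            ext; simp
          rw [← hle i j hj, ← h1, add_comm, ← Finset.card_union_of_disjoint]
          · congr 1
            ext m
            simp only [Finset.mem_union, Finset.mem_filter, Finset.mem_compl, Finset.mem_univ,
              true_and]
            tauto
          · rw [Finset.disjoint_left]
            intro m h1 h2
            exact (Finset.mem_compl.1 (Finset.mem_filter.1 h2).1) (Finset.mem_filter.1 h1).1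
        have he : (i : ℕ) + j = (Tᶜ.filter (· ≤ i)).card + 2 * j := by omega
        rw [he, pow_add, pow_mul]
        simp
      · intro m _ hm
        have hm' : ((m : ℕ) : ℝ) ≤ (i : ℕ) := Nat.cast_le.2 hm
        by_cases h0 : w m = 0
        · have hne : (m : ℕ) ≠ i := fun he => hwi (Fin.ext he ▸ h0)
          have : (m : ℕ) < i := lt_of_le_of_ne hm hne
          have : ((m : ℕ) : ℝ) < (i : ℕ) := Nat.cast_lt.2 this
          simp only [ρ, h0, if_true]
          linarith
        · simp only [ρ, h0, if_false]
          linarith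
      · intro m _ hm
        have hm' : ((i : ℕ) : ℝ) + 1 ≤ (m : ℕ) := by
          have : (i : ℕ) + 1 ≤ m := not_le.1 hm
          exact_mod_cast this
        simp only [ρ]
        split_ifs <;> linarith
    · have hi' : ∀ j, i ∉ B j := not_exists.1 hi
      have hwi : w i = 0 := by
        by_contra hc
        exact twistSign_ne_zero.2 hc (h.2 i hi')
      rw [hwi, Finset.prod_eq_zero (i := i)]
      · rw [Finset.mem_compl]
        exact fun hT => hi (hTsub i hT)
      · simp [ρ, hwi]

theorem det_mul_transpose_pos {k n : ℕ} {A U : Matrix (Fin k) (Fin n) ℝ}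
    (hA : Module.finrank ℝ (rowSpan A) = k)
    (hA0 : ∀ (I : Finset (Fin n)) (hI : I.card = k), 0 ≤ maxMinor A I hI)
    (hU : PositiveMinors U) : 0 < (A * U.transpose).det := by
  rw [cauchy_binet]
  obtain ⟨I, hI, hne⟩ := exists_maxMinor_ne_zero hA
  refine Finset.sum_pos' (fun J _ => mul_nonneg (hA0 _ _) (hU _ _).le)
    ⟨⟨I, hI⟩, Finset.mem_univ _, mul_pos ((hA0 I hI).lt_of_ne hne.symm) (hU I hI)⟩

/-- A vector orthogonal to a totally nonnegative subspace has few blocks. Otherwise it would be,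
up to positive factors, the vector of values of a polynomial of degree less than `k`, and hence
lie in a totally positive subspace of dimension `k`; but no such subspace contains a nonzero vector
orthogonal to a totally nonnegative one, by the Cauchy-Binet formula. -/
theorem card_blocks_add_le {k n r : ℕ} (hr : 0 < r) {V : Gr k n} (hV : V ∈ tnnGr k n)
    {w : EuclideanSpace ℝ (Fin n)} (hw : w ∈ V.subᗮ) {B : Fin r → Finset (Fin n)}
    (hB : IsBlocks B) (h : SignedBlocks B (twistSign w)) : r + k ≤ n := by
  wlog hx : HasBlocks B (twistSign w) generalizing w with H
  · have h' : HasBlocks B (twistSign (-w)) := by rw [twistSign_neg]; exact h.resolve_left hx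
    exact H (neg_mem hw) (Or.inl h') h'
  by_contra hc
  obtain ⟨P, hdeg, hP⟩ := exists_polynomial_sign_eq hr hB hx
  obtain ⟨A, hAV, hA0⟩ := hV
  have hdegk : P.natDegree < k := by omega
  -- positive factors that turn the values of `P` into the entries of `w`
  let d : Fin n → ℝ := fun i => if w i = 0 then 1 else w i / P.eval ((i : ℕ) : ℝ)
  have hd : ∀ i, 0 < d i := by
    intro i
    simp only [d]
    split_ifs with h0
    · exact one_pos
    · exact sign_eq_sign_iff_mul_pos h0 (hP i)
  have hdP : ∀ i, d i * P.eval ((i : ℕ) : ℝ) = w i := by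
    intro i
    have h0' : w i = 0 ↔ P.eval ((i : ℕ) : ℝ) = 0 := by
      rw [← sign_eq_zero_iff, ← hP, sign_eq_zero_iff]
    simp only [d]
    split_ifs with h0
    · rw [h0'.1 h0, h0, mul_zero]
    · rw [div_mul_cancel₀]
      exact fun h1 => h0 (h0'.2 h1)
  -- the rescaled vectors of values of the monomials of degree less than `k`; their maximal minors
  -- are Vandermonde determinants up to positive factors
  let U : Matrix (Fin k) (Fin n) ℝ := Matrix.of fun l i => d i * ((i : ℕ) : ℝ) ^ (l : ℕ)
  have hU : PositiveMinors U := by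
    intro I hI
    have : U.submatrix id (I.orderEmbOfFin hI) = Matrix.of fun l j =>
        (fun j => d (I.orderEmbOfFin hI j)) j *
          (Matrix.vandermonde fun j =>
            (((I.orderEmbOfFin hI j : Fin n) : ℕ) : ℝ)).transpose l j := by
      ext l j
      simp [U, Matrix.vandermonde]
    rw [maxMinor, this, Matrix.det_mul_row, Matrix.det_transpose, Matrix.det_vandermonde]
    refine mul_pos (Finset.prod_pos fun j _ => hd _) (Finset.prod_pos fun i _ =>
      Finset.prod_pos fun j hj => ?_)
    rw [Finset.mem_Ioi] at hj
    have := (I.orderEmbOfFin hI).strictMono hj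
    rw [sub_pos, Nat.cast_lt]
    exact this
  have hpos := det_mul_transpose_pos (by rw [hAV]; exact V.2) hA0 hU
  refine hpos.ne' (Matrix.exists_mulVec_eq_zero_iff.1 ⟨fun l => P.coeff l, ?_, ?_⟩)
  · intro h0
    have hP0 : P = 0 := by
      ext l
      by_cases hl : l < k
      · exact congrFun h0 ⟨l, hl⟩
      · rw [Polynomial.coeff_eq_zero_of_natDegree_lt (by omega), Polynomial.coeff_zero]
    obtain ⟨i, hi⟩ := hB.1 ⟨0, hr⟩
    have hwi : w i ≠ 0 := by
      rw [← twistSign_ne_zero, hx.1 _ i hi]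
      exact neg_one_pow_ne_zero_signType _
    apply hwi
    rw [← hdP, hP0]
    simp
  · have hUw : U.transpose.mulVec (fun l => P.coeff l) = fun i => w i := by
      funext i
      rw [← hdP i, Polynomial.eval_eq_sum_range' hdegk, ← Fin.sum_univ_eq_sum_range
        (fun l : ℕ => P.coeff l * ((i : ℕ) : ℝ) ^ l) k, Finset.mul_sum, Matrix.mulVec, dotProduct]
      refine Finset.sum_congr rfl fun l _ => ?_
      simp only [U, Matrix.transpose_apply, Matrix.of_apply]
      ring
    rw [← Matrix.mulVec_mulVec, hUw]
    exact mem_orthogonal_rowSpan_iff.1 (hAV ▸ hw)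

/-- The subset of the `m` least elements of `S`. -/
theorem exists_initial_subset {n : ℕ} (S : Finset (Fin n)) (m : ℕ) (hm : m ≤ S.card) :
    ∃ T ⊆ S, T.card = m ∧ ∀ a ∈ T, ∀ b ∈ S, b < a → b ∈ T := by
  induction S using Finset.induction_on_max with
  | empty => exact ⟨∅, subset_rfl, by simp at hm; simp [hm], by simp⟩
  | insert a S ha ih =>
    have hna : a ∉ S := fun h => lt_irrefl _ (ha a h)
    rw [Finset.card_insert_of_notMem hna] at hm
    rcases hm.lt_or_eq with h | h
    · obtain ⟨T, hT, hc, hl⟩ := ih (by omega)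
      refine ⟨T, hT.trans (Finset.subset_insert _ _), hc, fun c hcT b hb hbc => ?_⟩
      rcases Finset.mem_insert.1 hb with rfl | hb
      · exact absurd (ha c (hT hcT)) (not_lt.2 hbc.le)
      · exact hl c hcT b hb hbc
    · exact ⟨insert a S, subset_rfl, by rw [Finset.card_insert_of_notMem hna, h],
        fun _ _ _ hb _ => hb⟩

/-- A nonzero vector of a totally positive subspace has many blocks: otherwise it would have
weakly alternating signs on too many columns, contradicting the relation between these entries and
the maximal minors. -/
theorem le_card_blocks_add {k n r : ℕ} (hr : 0 < r) {W : Gr (k + 1) n} (hW : W ∈ tpGr (k + 1) n)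
    {w : EuclideanSpace ℝ (Fin n)} (hw : w ∈ W.sub) {B : Fin r → Finset (Fin n)}
    (hB : IsBlocks B) (h : SignedBlocks B (twistSign w)) : n ≤ r + k := by
  wlog hx : HasBlocks B (twistSign w) generalizing w with H
  · have h' : HasBlocks B (twistSign (-w)) := by rw [twistSign_neg]; exact h.resolve_left hx
    exact H (neg_mem hw) (Or.inl h') h'
  by_contra hc
  obtain ⟨A, hAW, hA⟩ := hW
  rw [← hAW] at hw
  -- on the first `k + 2` indices that are not the least element of a block other than the first
  -- one, the nonzero entries of `w` have exactly the signs that occur in the relation between `w`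
  -- and the minors
  have hS : k + 2 ≤ (blockMins hB)ᶜ.card := by
    rw [Finset.card_compl, card_blockMins, Fintype.card_fin]; omega
  obtain ⟨T, hTS, hT, hlow⟩ := exists_initial_subset _ _ hS
  have hminor : ∀ i ∈ T, 0 < minor A (T.erase i) := fun i hi => by
    rw [minor_eq A (by rw [Finset.card_erase_of_mem hi, hT]; rfl)]
    exact hA _ _
  have hterm : ∀ i ∈ T, w i ≠ 0 → 0 < (-1) ^ (T.filter (· < i)).card * w i := by
    intro i hi hwi
    obtain ⟨j, hj⟩ : ∃ j, i ∈ B j := by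
      by_contra hcj
      exact twistSign_ne_zero.2 hwi (hx.2 i (not_exists.1 hcj))
    have hcount : (T.filter (· < i)).card + j = i := by
      have h1 : (Finset.univ.filter fun m : Fin n => m < i).card = i := by
        rw [← Fin.card_Iio i]
        congr 1
        ext; simp
      have h2 := cutIndex_blockMins hB hj
      rw [← h2, cutIndex, ← h1, ← Finset.card_union_of_disjoint]
      · congr 1
        ext m
        simp only [Finset.mem_union, Finset.mem_filter, Finset.mem_univ, true_and]
        constructor
        · rintro (⟨-, h⟩ | ⟨hm, h⟩)
          · exact h
          · exact lt_of_le_of_ne h fun he => Finset.mem_compl.1 (hTS hi) (he ▸ hm)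
        · intro hm
          by_cases hmB : m ∈ blockMins hB
          · exact Or.inr ⟨hmB, hm.le⟩
          · exact Or.inl ⟨hlow i hi m (Finset.mem_compl.2 hmB) hm, hm⟩
      · rw [Finset.disjoint_left]
        intro m h1 h2
        exact Finset.mem_compl.1 (hTS (Finset.mem_filter.1 h1).1) (Finset.mem_filter.1 h2).1
    have hs := signOf_eq_of_hasBlocks hx hj
    have he : (i : ℕ) + j = (T.filter (· < i)).card + 2 * j := by omega
    rw [he, pow_add, pow_mul] at hs
    rcases neg_one_pow_eq_or ℝ (T.filter (· < i)).card with h1 | h1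
    · have h2 : Even (T.filter (· < i)).card := by
        by_contra h2
        rw [Nat.not_even_iff_odd] at h2
        rw [h2.neg_one_pow] at h1
        norm_num at h1
      rw [h2.neg_one_pow] at hs ⊢
      simp only [one_mul, even_two, Even.neg_pow, one_pow, sign_eq_one_iff] at hs ⊢
      exact hs
    · have h2 : Odd (T.filter (· < i)).card := by
        by_contra h2
        rw [Nat.not_odd_iff_even] at h2
        rw [h2.neg_one_pow] at h1
        norm_num at h1
      rw [h2.neg_one_pow] at hs ⊢
      simp only [even_two, Even.neg_pow, one_pow, mul_one, sign_eq_neg_one_iff] at hs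
      linarith
  have hsum := sum_mul_minor_erase A hw hT
  have hzero : ∀ i ∈ T, w i = 0 := by
    intro i hi
    have h0 := (Finset.sum_eq_zero_iff_of_nonneg (fun i hi => ?_)).1 hsum i hi
    · by_contra hwi
      exact (mul_pos (hterm i hi hwi) (hminor i hi)).ne' h0
    · by_cases hwi : w i = 0
      · simp [hwi]
      · exact (mul_pos (hterm i hi hwi) (hminor i hi)).le
  -- the columns in `T` have full rank
  have hw0 : w = 0 := by
    obtain ⟨a, ha⟩ : T.Nonempty := Finset.card_pos.1 (by omega)
    have hI : (T.erase a).card = k + 1 := by rw [Finset.card_erase_of_mem ha, hT]; rfl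
    ext m
    by_cases hm : m ∈ T.erase a
    · exact hzero m (Finset.mem_of_mem_erase hm)
    · have h1 := sum_mul_minor_erase A hw
        (by rw [Finset.card_insert_of_notMem hm, hI] : (insert m (T.erase a)).card = k + 1 + 1)
      rw [Finset.sum_insert hm, Finset.erase_insert hm, Finset.sum_eq_zero, add_zero] at h1
      · have h2 : minor A (T.erase a) ≠ 0 := (hminor a ha).ne'
        have h3 : ((-1 : ℝ)) ^ ((insert m (T.erase a)).filter (· < m)).card ≠ 0 :=
          pow_ne_zero _ (by norm_num)
        simpa [h2, h3] using h1
      · intro i hi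
        rw [hzero i (Finset.mem_of_mem_erase hi)]
        ring
  obtain ⟨i, hi⟩ := hB.1 ⟨0, hr⟩
  have hwi : w i ≠ 0 := by
    rw [← twistSign_ne_zero, hx.1 _ i hi]
    exact neg_one_pow_ne_zero_signType _
  exact hwi (by simp [hw0])

/-! ### The lines cut out on a totally positive subspace -/

theorem twistSign_apply {n : ℕ} (w : EuclideanSpace ℝ (Fin n)) (i : Fin n) :
    twistSign w i = (-1) ^ (i : ℕ) * SignType.sign (w i) := rfl

theorem SignedBlocks.exists_strictMono {n r m : ℕ} {A : Fin r → Finset (Fin n)}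
    (hA : IsBlocks A) {x : Fin n → SignType} (hx : SignedBlocks A x) {b : Fin m → Fin n}
    (hb : StrictMono b) {δ : SignType} (hδ : δ ≠ 0) (h : ∀ l, x (b l) = δ * (-1) ^ (l : ℕ)) :
    ∃ f : Fin m → Fin r, StrictMono f ∧ ∀ l, b l ∈ A (f l) := by
  obtain ⟨ε, hε, hx⟩ := hx.exists_mul
  refine exists_strictMono_of_alternating hA hx hb (δ := ε * δ) ?_ fun l => ?_
  · refine mul_ne_zero ?_ hδ
    rintro rfl
    simp at hε
  · rw [h, mul_assoc]

/-- A nonzero vector of `Vᗮ ⊓ W` has exactly `n - k` blocks. -/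
theorem exists_signedBlocks_of_mem {k n r : ℕ} (hn : r + k = n) {V : Gr k n}
    (hV : V ∈ tnnGr k n) {W : Gr (k + 1) n} (hW : W ∈ tpGr (k + 1) n)
    {w : EuclideanSpace ℝ (Fin n)} (hw : w ∈ V.subᗮ ⊓ W.sub) (h0 : w ≠ 0) :
    ∃ A : Fin r → Finset (Fin n), IsBlocks A ∧ SignedBlocks A (twistSign w) := by
  obtain ⟨r', A, hA, hx⟩ := exists_signedBlocks (twistSign w)
  have hr : 0 < r' := by
    rcases r'.eq_zero_or_pos with rfl | h
    · refine absurd (twistSign_eq_zero_iff.1 (funext fun i => ?_)) h0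
      by_contra hi
      exact ((hx.ne_zero_iff i).1 hi).choose.elim0
    · exact h
  have h1 := card_blocks_add_le hr hV hw.1 hA hx
  have h2 := le_card_blocks_add hr hW hw.2 hA hx
  obtain rfl : r' = r := by omega
  exact ⟨A, hA, hx⟩

theorem eventually_sign_add {n : ℕ} (y x : EuclideanSpace ℝ (Fin n)) :
    ∀ᶠ t in 𝓝[>] (0 : ℝ), ∀ i, y i ≠ 0 →
      SignType.sign ((y + t • x) i) = SignType.sign (y i) := by
  refine nhdsWithin_le_nhds (Filter.eventually_all.2 fun i => ?_)
  have hc : Filter.Tendsto (fun t : ℝ => (y + t • x) i) (𝓝 0) (𝓝 (y i)) := by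
    have : Continuous fun t : ℝ => (y + t • x) i := by
      simp only [PiLp.add_apply, PiLp.smul_apply]
      fun_prop
    simpa using this.tendsto 0
  by_cases hy : y i = 0
  · exact Filter.Eventually.of_forall fun t h => absurd hy h
  · have h2 := (continuousAt_sign_of_ne_zero hy).tendsto.comp hc
    rw [nhds_discrete SignType, Filter.tendsto_pure] at h2
    exact h2.mono fun t ht _ => ht

/-- If `Vᗮ ⊓ W` had dimension at least two, a small perturbation of one vector of this space by
another one would have more than `n - k` blocks. -/
theorem eq_zero_of_apply_eq_zero {k n r : ℕ} (hn : r + k = n) {V : Gr k n}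
    (hV : V ∈ tnnGr k n) {W : Gr (k + 1) n} (hW : W ∈ tpGr (k + 1) n) {p : Fin n}
    {x : EuclideanSpace ℝ (Fin n)} (hx : x ∈ V.subᗮ ⊓ W.sub) (hxp : x p ≠ 0)
    (hp : ∀ z ∈ V.subᗮ ⊓ W.sub, ∀ i < p, z i = 0)
    {y : EuclideanSpace ℝ (Fin n)} (hy : y ∈ V.subᗮ ⊓ W.sub) (hyp : y p = 0) : y = 0 := by
  by_contra hy0
  obtain ⟨B, hB, hyB⟩ := exists_signedBlocks_of_mem hn hV hW hy hy0
  choose b hb using hB.1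
  obtain ⟨δ, hδ, hyδ⟩ := hyB.exists_mul
  have hyb : ∀ j, twistSign y (b j) = δ * (-1) ^ (j : ℕ) := fun j => by
    rw [← hyδ.1 j (b j) (hb j), ← mul_assoc, hδ, one_mul]
  have hδ0 : δ ≠ 0 := by rintro rfl; simp at hδ
  have hyb0 : ∀ j, y (b j) ≠ 0 := fun j => by
    rw [← twistSign_ne_zero, hyb]
    exact mul_ne_zero hδ0 (neg_one_pow_ne_zero_signType _)
  have hpb : ∀ j, p < b j := fun j => by
    refine lt_of_not_ge fun h => hyb0 j ?_
    rcases h.lt_or_eq with h | h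
    · exact hp y hy _ h
    · rw [h, hyp]
  -- after replacing `x` by `-x`, its sign at `p` continues the alternating signs of `y` to the left
  obtain ⟨x', hx', hxp'⟩ : ∃ x' ∈ V.subᗮ ⊓ W.sub, twistSign x' p = -δ := by
    have h1 : twistSign x p ≠ 0 := twistSign_ne_zero.2 hxp
    have : twistSign x p = -δ ∨ -twistSign x p = -δ := by
      have : ∀ a d : SignType, a ≠ 0 → d ≠ 0 → a = -d ∨ -a = -d := by decide
      exact this _ _ h1 hδ0
    rcases this with h | h
    · exact ⟨x, hx, h⟩
    · exact ⟨-x, neg_mem hx, by rw [twistSign_neg]; exact h⟩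
  -- `y + t • x'` has alternating signs at `p` and at one index of each block of `y`
  obtain ⟨t, ht, ht0⟩ := ((eventually_sign_add y x').and self_mem_nhdsWithin).exists
  have hz : y + t • x' ∈ V.subᗮ ⊓ W.sub := add_mem hy (Submodule.smul_mem _ _ hx')
  have hzp : twistSign (y + t • x') p = -δ := by
    rw [← hxp', twistSign_apply, twistSign_apply, PiLp.add_apply, hyp, zero_add, PiLp.smul_apply,
      smul_eq_mul, sign_mul, sign_pos ht0, one_mul]
  have hz0 : y + t • x' ≠ 0 := by
    intro h
    rw [h, twistSign_apply] at hzp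
    simp at hzp
    exact hδ0 (by simpa using hzp.symm)
  obtain ⟨C, hC, hzC⟩ := exists_signedBlocks_of_mem hn hV hW hz hz0
  have hcb : StrictMono (Fin.cons p b : Fin (r + 1) → Fin n) := by
    intro i j hij
    induction j using Fin.cases with
    | zero => exact absurd hij (Fin.not_lt_zero i)
    | succ j =>
      induction i using Fin.cases with
      | zero => simpa using hpb j
      | succ i => simpa using hB.strictMono hb (Fin.succ_lt_succ_iff.1 hij)
  obtain ⟨f, hf, -⟩ := hzC.exists_strictMono hC hcb (δ := -δ) (by simpa using hδ0) fun l => by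
    induction l using Fin.cases with
    | zero => simpa using hzp
    | succ l =>
      rw [Fin.cons_succ, twistSign_apply, ht _ (hyb0 l), ← twistSign_apply, hyb, Fin.val_succ,
        pow_succ]
      simp
  have := Fintype.card_le_of_injective f hf.injective
  simp at this

theorem le_of_gr {k n : ℕ} (V : Gr k n) : k ≤ n := by
  have h := Submodule.finrank_le V.sub
  rwa [V.2, finrank_euclideanSpace_fin] at h

theorem finrank_orthogonal {k n : ℕ} (V : Gr k n) : Module.finrank ℝ V.subᗮ = n - k := by
  have h := Submodule.finrank_add_finrank_orthogonal V.sub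
  rw [V.2, finrank_euclideanSpace_fin] at h
  omega

/-- Dimensions show that the intersection is not zero. Let `p` be the least index at which some
vector of the intersection does not vanish; then all its vectors are determined by their entries
at `p`. -/
theorem finrank_orthogonal_inf {k n : ℕ} {V : Gr k n} (hV : V ∈ tnnGr k n) {W : Gr (k + 1) n}
    (hW : W ∈ tpGr (k + 1) n) : Module.finrank ℝ ↥(V.subᗮ ⊓ W.sub) = 1 := by
  classical
  have hkn := le_of_gr W
  have hpos : 0 < Module.finrank ℝ ↥(V.subᗮ ⊓ W.sub) := by
    have h1 := Submodule.finrank_sup_add_finrank_inf_eq V.subᗮ W.sub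
    have h2 := Submodule.finrank_le (V.subᗮ ⊔ W.sub)
    rw [finrank_orthogonal, W.2] at h1
    rw [finrank_euclideanSpace_fin] at h2
    omega
  refine le_antisymm ?_ hpos
  have hex : ∃ p : Fin n, ∃ x ∈ V.subᗮ ⊓ W.sub, x p ≠ 0 := by
    by_contra hc
    push Not at hc
    refine hpos.ne' (Submodule.finrank_eq_zero.2 ((Submodule.eq_bot_iff _).2 fun x hx => ?_))
    ext i
    exact hc i x hx
  obtain ⟨p, ⟨x, hx, hxp⟩, hp⟩ := WellFounded.has_min wellFounded_lt
    {p : Fin n | ∃ x ∈ V.subᗮ ⊓ W.sub, x p ≠ 0} hex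
  have hp' : ∀ z ∈ V.subᗮ ⊓ W.sub, ∀ i < p, z i = 0 := fun z hz i hi => by
    by_contra h
    exact hp i ⟨z, hz, h⟩ hi
  refine finrank_le_one ⟨x, hx⟩ fun y => ⟨y.1 p / x p, Subtype.ext ?_⟩
  have h := eq_zero_of_apply_eq_zero (r := n - k) (by omega) hV hW hx hxp hp'
    (sub_mem y.2 (Submodule.smul_mem _ (y.1 p / x p) hx)) (by
      rw [PiLp.sub_apply, PiLp.smul_apply, smul_eq_mul, div_mul_cancel₀ _ hxp, sub_self])
  exact (sub_eq_zero.1 h).symm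

/-! ### The cells as spaces of block frames -/

/-- Vectors supported on the blocks, `(-1) ^ i * u j i` having the sign `(-1) ^ j` for all `i` in
the block number `j`. -/
def BlockFrame {n r : ℕ} (A : Fin r → Finset (Fin n)) (u : Fin r → EuclideanSpace ℝ (Fin n)) :
    Prop :=
  ∀ j, (∀ i ∉ A j, u j i = 0) ∧ ∀ i ∈ A j, 0 < (-1 : ℝ) ^ ((i : ℕ) + j) * u j i

theorem BlockFrame.ne_zero {n r : ℕ} {A : Fin r → Finset (Fin n)}
    {u : Fin r → EuclideanSpace ℝ (Fin n)} (hu : BlockFrame A u) {j : Fin r} {i : Fin n}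
    (hi : i ∈ A j) : u j i ≠ 0 := fun h => by
  have := (hu j).2 i hi
  simp [h] at this

theorem BlockFrame.sum_apply {n r : ℕ} {A : Fin r → Finset (Fin n)} (hA : IsBlocks A)
    {u : Fin r → EuclideanSpace ℝ (Fin n)} (hu : BlockFrame A u) (c : Fin r → ℝ) {j : Fin r}
    {i : Fin n} (hi : i ∈ A j) : (∑ l, c l • u l) i = c j * u j i := by
  rw [WithLp.ofLp_sum, Finset.sum_apply, Finset.sum_eq_single j]
  · simp
  · intro l _ hl
    have : i ∉ A l := fun h => hl (hA.eq_of_mem h hi)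
    simp [(hu l).1 i this]
  · simp

theorem BlockFrame.sum_apply_eq_zero {n r : ℕ} {A : Fin r → Finset (Fin n)}
    {u : Fin r → EuclideanSpace ℝ (Fin n)} (hu : BlockFrame A u) (c : Fin r → ℝ)
    {i : Fin n} (hi : ∀ j, i ∉ A j) : (∑ l, c l • u l) i = 0 := by
  rw [WithLp.ofLp_sum, Finset.sum_apply]
  exact Finset.sum_eq_zero fun l _ => by simp [(hu l).1 i (hi l)]

theorem BlockFrame.linearIndependent {n r : ℕ} {A : Fin r → Finset (Fin n)} (hA : IsBlocks A)
    {u : Fin r → EuclideanSpace ℝ (Fin n)} (hu : BlockFrame A u) : LinearIndependent ℝ u := by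
  rw [Fintype.linearIndependent_iff]
  intro c hc j
  obtain ⟨i, hi⟩ := hA.1 j
  have := hu.sum_apply hA c hi
  rw [hc] at this
  simpa [hu.ne_zero hi] using this.symm

theorem BlockFrame.finrank_span {n r : ℕ} {A : Fin r → Finset (Fin n)} (hA : IsBlocks A)
    {u : Fin r → EuclideanSpace ℝ (Fin n)} (hu : BlockFrame A u) :
    Module.finrank ℝ (Submodule.span ℝ (Set.range u)) = r := by
  rw [finrank_span_eq_card (hu.linearIndependent hA), Fintype.card_fin]

theorem BlockFrame.span_eq {n r k : ℕ} (hn : r + k = n) {A : Fin r → Finset (Fin n)}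
    (hA : IsBlocks A) {u : Fin r → EuclideanSpace ℝ (Fin n)} (hu : BlockFrame A u) {V : Gr k n}
    (h : ∀ j, u j ∈ V.subᗮ) : V.subᗮ = Submodule.span ℝ (Set.range u) := by
  symm
  refine Submodule.eq_of_le_of_finrank_eq (Submodule.span_le.2 ?_) ?_
  · rintro _ ⟨j, rfl⟩
    exact h j
  · rw [hu.finrank_span hA, finrank_orthogonal]
    omega

/-- The subspaces whose orthogonal complement is spanned by vectors of alternating sign supported
on the blocks. -/
def openCell {r : ℕ} (k n : ℕ) (A : Fin r → Finset (Fin n)) : Set (Gr k n) :=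
  {V | ∃ u, BlockFrame A u ∧ V.subᗮ = Submodule.span ℝ (Set.range u)}

/-- The column set of the circuit through the block number `j`, for a transversal `b` of the
blocks. -/
def circuitSet {n r : ℕ} (b : Fin r → Fin n) (j : Fin r) : Finset (Fin n) :=
  ((Finset.univ.erase j).image b)ᶜ

theorem card_circuitSet {n r k : ℕ} (hn : r + k = n) {b : Fin r → Fin n}
    (hb : Function.Injective b) (j : Fin r) : (circuitSet b j).card = k + 1 := by
  rw [circuitSet, Finset.card_compl, Finset.card_image_of_injective _ hb,
    Finset.card_erase_of_mem (Finset.mem_univ j)]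
  simp
  have := j.2
  omega

theorem mem_circuitSet {n r : ℕ} {A : Fin r → Finset (Fin n)} (hA : IsBlocks A)
    {b : Fin r → Fin n} (hb : ∀ j, b j ∈ A j) {j : Fin r} {i : Fin n} (hi : i ∈ A j) :
    i ∈ circuitSet b j := by
  rw [circuitSet, Finset.mem_compl, Finset.mem_image]
  rintro ⟨l, hl, rfl⟩
  exact Finset.ne_of_mem_erase hl (hA.eq_of_mem (hb l) hi)

theorem circuitSet_erase {n r : ℕ} {b : Fin r → Fin n} (j : Fin r) (i : Fin n) :
    (circuitSet b j).erase i = (Finset.univ.image (Function.update b j i))ᶜ := by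
  ext m
  simp only [circuitSet, Finset.mem_erase, Finset.mem_compl, Finset.mem_image, Finset.mem_univ,
    true_and, and_true, not_exists, not_and]
  constructor
  · rintro ⟨h1, h2⟩ l hl
    by_cases hlj : l = j
    · subst hlj
      exact h1 (by simpa using hl.symm)
    · exact h2 l hlj (by simpa [hlj] using hl)
  · intro h
    refine ⟨fun hm => h j (by simp [hm]), fun l hlj hl => h l (by simpa [hlj] using hl)⟩

/-- To the left of an index in the block number `j`, the circuit omits one index from each of the
`j` previous blocks. -/
theorem card_filter_circuitSet {n r : ℕ} {A : Fin r → Finset (Fin n)} (hA : IsBlocks A)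
    {b : Fin r → Fin n} (hb : ∀ j, b j ∈ A j) {j : Fin r} {i : Fin n} (hi : i ∈ A j) :
    ((circuitSet b j).filter (· < i)).card + j = i := by
  have h1 : ((Finset.Iio j).image b).card = j := by
    rw [Finset.card_image_of_injective _ (hA.strictMono hb).injective, Fin.card_Iio]
  conv_lhs => rw [← h1]
  conv_rhs => rw [← Fin.card_Iio i]
  rw [← Finset.card_union_of_disjoint]
  · congr 1
    ext m
    simp only [circuitSet, Finset.mem_union, Finset.mem_filter, Finset.mem_compl, Finset.mem_image,
      Finset.mem_erase, Finset.mem_univ, and_true, Finset.mem_Iio]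
    constructor
    · rintro (⟨-, h⟩ | ⟨l, hl, rfl⟩)
      · exact h
      · exact hA.2 _ _ hl _ (hb l) _ hi
    · intro hm
      by_cases h : ∃ l, l ≠ j ∧ b l = m
      · obtain ⟨l, hl, rfl⟩ := h
        exact Or.inr ⟨l, lt_of_le_of_ne (hA.le_of_le (hb l) hi hm.le) hl, rfl⟩
      · exact Or.inl ⟨h, hm⟩
  · rw [Finset.disjoint_left]
    intro m h1 h2
    obtain ⟨l, hl, rfl⟩ := Finset.mem_image.1 h2
    refine Finset.mem_compl.1 (Finset.mem_filter.1 h1).1 (Finset.mem_image_of_mem _ ?_)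
    exact Finset.mem_erase.2 ⟨(Finset.mem_Iio.1 hl).ne, Finset.mem_univ _⟩

/-- Up to the signs of a frame, the entries of a circuit vector in its block are the minors of the
bases that differ from the given one by an exchange in this block. -/
theorem circuitVec_circuitSet {k n r : ℕ} (P : Matrix (Fin k) (Fin n) ℝ)
    {A : Fin r → Finset (Fin n)} (hA : IsBlocks A) {b : Fin r → Fin n} (hb : ∀ j, b j ∈ A j)
    {j : Fin r} {i : Fin n} (hi : i ∈ A j) :
    (-1 : ℝ) ^ ((i : ℕ) + j) * circuitVec P (circuitSet b j) i =
      minor P (Finset.univ.image (Function.update b j i))ᶜ := by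
  rw [circuitVec_apply_of_mem P (mem_circuitSet hA hb hi), circuitSet_erase, ← mul_assoc, ← pow_add]
  have h := card_filter_circuitSet hA hb hi
  have : (i : ℕ) + j + ((circuitSet b j).filter (· < i)).card = 2 * i := by omega
  rw [this, pow_mul]
  simp

theorem update_mem {n r : ℕ} {A : Fin r → Finset (Fin n)} {b : Fin r → Fin n}
    (hb : ∀ j, b j ∈ A j) {j : Fin r} {i : Fin n} (hi : i ∈ A j) (l : Fin r) :
    Function.update b j i l ∈ A l := by
  by_cases h : l = j
  · subst h; simpa using hi
  · simpa [h] using hb l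

/-- For a point of the cell, the circuit vectors of any transversal form a frame. -/
theorem posCell_blockBases_subset {k n r : ℕ} (hn : r + k = n) {A : Fin r → Finset (Fin n)}
    (hA : IsBlocks A) : posCell k n (blockBases A) ⊆ openCell k n A := by
  rintro V ⟨P, hPV, hP⟩
  choose b hb using hA.1
  have hcard := card_circuitSet hn (hA.strictMono hb).injective
  have hu : BlockFrame A fun j => circuitVec P (circuitSet b j) := by
    refine fun j => ⟨fun i hi => ?_, fun i hi => ?_⟩
    · by_cases hiT : i ∈ circuitSet b j
      · have hc : ((circuitSet b j).erase i).card = k := by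
          rw [Finset.card_erase_of_mem hiT, hcard]; rfl
        rw [circuitVec_apply_of_mem P hiT, minor_eq P hc, (hP _ hc).2, mul_zero]
        intro h
        obtain ⟨i', hi', h⟩ := ((mem_blockBases_iff hn hA).1 h).2 j
        refine h (Finset.mem_erase.2 ⟨fun he => hi (he ▸ hi'), mem_circuitSet hA hb hi'⟩)
      · exact circuitVec_apply_of_notMem P hiT
    · have hI : (Finset.univ.image (Function.update b j i))ᶜ ∈ blockBases A :=
        ⟨_, update_mem hb hi, rfl⟩
      rw [circuitVec_circuitSet P hA hb hi, minor_eq P (card_of_mem_blockBases hn hA hI)]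
      exact (hP _ _).1 hI
  refine ⟨_, hu, hu.span_eq hn hA fun j => ?_⟩
  rw [← hPV]
  exact circuitVec_mem_orthogonal P (hcard j)

theorem exists_rowSpan_eq {k n : ℕ} (V : Gr k n) :
    ∃ P : Matrix (Fin k) (Fin n) ℝ, rowSpan P = V.sub := by
  let e := Module.finBasisOfFinrankEq ℝ V.sub V.2
  refine ⟨fun i => (e i : EuclideanSpace ℝ (Fin n)), ?_⟩
  have : (Set.range fun i => WithLp.toLp 2 ((e i : EuclideanSpace ℝ (Fin n)) : Fin n → ℝ)) =
      V.sub.subtype '' Set.range e := by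
    rw [← Set.range_comp]; rfl
  unfold rowSpan
  rw [this, Submodule.span_image, e.span_eq, Submodule.map_subtype_top]

/-- A linear relation between the columns in `I` is a vector orthogonal to the rows. -/
theorem exists_vec_of_maxMinor_eq_zero {k n : ℕ} {P : Matrix (Fin k) (Fin n) ℝ}
    {I : Finset (Fin n)} {hI : I.card = k} (h : maxMinor P I hI = 0) :
    ∃ w ∈ (rowSpan P)ᗮ, w ≠ 0 ∧ ∀ i ∉ I, w i = 0 := by
  obtain ⟨v, hv0, hv⟩ := Matrix.exists_mulVec_eq_zero_iff.2 h
  let w : EuclideanSpace ℝ (Fin n) :=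
    WithLp.toLp 2 fun i => ∑ l, if I.orderEmbOfFin hI l = i then v l else 0
  refine ⟨w, mem_orthogonal_rowSpan_iff.2 ?_, fun h0 => hv0 ?_, fun i hi => ?_⟩
  · rw [← hv]
    funext a
    simp only [w, Matrix.mulVec, dotProduct, Matrix.submatrix_apply, id, Finset.mul_sum]
    rw [Finset.sum_comm]
    simp
  · funext l
    have : w (I.orderEmbOfFin hI l) = 0 := by rw [h0]; rfl
    simpa [w] using this
  · have hne : ∀ l, I.orderEmbOfFin hI l ≠ i := by
      rintro l rfl
      exact hi (Finset.orderEmbOfFin_mem _ _ _)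
    simp [w, hne]

theorem maxMinor_eq_zero_of_vec {k n : ℕ} {P : Matrix (Fin k) (Fin n) ℝ}
    {I : Finset (Fin n)} (hI : I.card = k) {w : EuclideanSpace ℝ (Fin n)}
    (hw : w ∈ (rowSpan P)ᗮ) (h0 : w ≠ 0) (h : ∀ i ∉ I, w i = 0) : maxMinor P I hI = 0 := by
  have hsum : ∀ F : Fin n → ℝ, ∑ i ∈ I, F i = ∑ j, F (I.orderEmbOfFin hI j) := by
    intro F
    conv_lhs => rw [← Finset.map_orderEmbOfFin_univ I hI]
    rw [Finset.sum_map]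
    rfl
  refine Matrix.exists_mulVec_eq_zero_iff.1 ⟨fun l => w (I.orderEmbOfFin hI l), fun hc => h0 ?_, ?_⟩
  · ext i
    by_cases hi : i ∈ I
    · have : i ∈ Set.range (I.orderEmbOfFin hI) := by rw [Finset.range_orderEmbOfFin]; exact hi
      obtain ⟨l, rfl⟩ := this
      exact congrFun hc l
    · exact h i hi
  · funext a
    rw [← congrFun (mem_orthogonal_rowSpan_iff.1 hw) a]
    simp only [Matrix.mulVec, dotProduct, Matrix.submatrix_apply, id]
    rw [← hsum fun i => P a i * w i]
    exact Finset.sum_subset (Finset.subset_univ I) fun i _ hi => by rw [h i hi, mul_zero]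

/-- Negating the first row changes the signs of all maximal minors. -/
theorem exists_rowSpan_eq_neg {k n : ℕ} (hk : 0 < k) (P : Matrix (Fin k) (Fin n) ℝ) :
    ∃ P' : Matrix (Fin k) (Fin n) ℝ, rowSpan P' = rowSpan P ∧
      ∀ (I : Finset (Fin n)) (hI : I.card = k), maxMinor P' I hI = -maxMinor P I hI := by
  let d : Fin k → ℝ := Function.update 1 ⟨0, hk⟩ (-1)
  have hd : ∀ l, d l * d l = 1 := fun l => by
    by_cases hl : l = ⟨0, hk⟩ <;> simp [d, hl]
  refine ⟨Matrix.diagonal d * P, ?_, fun I hI => ?_⟩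
  · refine le_antisymm (Submodule.span_le.2 ?_) (Submodule.span_le.2 ?_)
    · rintro _ ⟨l, rfl⟩
      have : WithLp.toLp 2 ((Matrix.diagonal d * P) l) = d l • WithLp.toLp 2 (P l) := by
        ext i; simp [Matrix.diagonal_mul]
      simp only [this]
      exact Submodule.smul_mem _ _ (Submodule.subset_span ⟨l, rfl⟩)
    · rintro _ ⟨l, rfl⟩
      have : WithLp.toLp 2 (P l) = d l • WithLp.toLp 2 ((Matrix.diagonal d * P) l) := by
        ext i; simp [Matrix.diagonal_mul, ← mul_assoc, hd]
      simp only [this]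
      exact Submodule.smul_mem _ _ (Submodule.subset_span ⟨l, rfl⟩)
  · have : (Matrix.diagonal d * P).submatrix id (I.orderEmbOfFin hI) =
        Matrix.diagonal d * P.submatrix id (I.orderEmbOfFin hI) := by
      ext a b; simp [Matrix.diagonal_mul]
    rw [maxMinor, this, Matrix.det_mul, Matrix.det_diagonal, maxMinor, Finset.prod_update_of_mem
      (Finset.mem_univ _)]
    simp

/-- Two bases of a cell that differ by one exchange inside a block have minors of the same sign. -/
theorem minor_mul_minor_update_pos {k n r : ℕ} (hn : r + k = n) {A : Fin r → Finset (Fin n)}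
    (hA : IsBlocks A) {P : Matrix (Fin k) (Fin n) ℝ} {u : Fin r → EuclideanSpace ℝ (Fin n)}
    (hu : BlockFrame A u) (hP : (rowSpan P)ᗮ = Submodule.span ℝ (Set.range u))
    (h0 : ∀ b : Fin r → Fin n, (∀ j, b j ∈ A j) → minor P (Finset.univ.image b)ᶜ ≠ 0)
    {b : Fin r → Fin n} (hb : ∀ j, b j ∈ A j) {j : Fin r} {i : Fin n} (hi : i ∈ A j) :
    0 < minor P (Finset.univ.image b)ᶜ * minor P (Finset.univ.image (Function.update b j i))ᶜ := by
  have hmem := circuitVec_mem_orthogonal P (card_circuitSet hn (hA.strictMono hb).injective j)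
  rw [hP, Submodule.mem_span_range_iff_exists_fun] at hmem
  obtain ⟨c, hc⟩ := hmem
  have key : ∀ i' ∈ A j, minor P (Finset.univ.image (Function.update b j i'))ᶜ =
      c j * ((-1) ^ ((i' : ℕ) + j) * u j i') := by
    intro i' hi'
    rw [← circuitVec_circuitSet P hA hb hi', ← hc, hu.sum_apply hA c hi']
    ring
  refine lt_of_le_of_ne ?_ (mul_ne_zero (h0 b hb) (h0 _ (update_mem hb hi))).symm
  have h1 := key _ (hb j)
  rw [Function.update_eq_self] at h1
  rw [h1, key i hi]
  calc (0 : ℝ) ≤ c j ^ 2 *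
          (((-1) ^ ((b j : ℕ) + j) * u j (b j)) * ((-1) ^ ((i : ℕ) + j) * u j i)) :=
        mul_nonneg (sq_nonneg _) (mul_pos ((hu j).2 _ (hb j)) ((hu j).2 _ hi)).le
    _ = _ := by ring

/-- A maximal minor vanishes if and only if some nonzero vector orthogonal to the rows is supported
on its columns. For a subspace orthogonal to a frame, the nonvanishing minors are therefore those of
the bases. They all have the same sign, since an exchange in one block preserves it, and this sign
can be made positive. -/
theorem openCell_subset_posCell {k n r : ℕ} (hn : r + k = n) {A : Fin r → Finset (Fin n)}
    (hA : IsBlocks A) : openCell k n A ⊆ posCell k n (blockBases A) := by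
  classical
  rintro V ⟨u, hu, hV⟩
  obtain ⟨P, hPV⟩ := exists_rowSpan_eq V
  have hP : (rowSpan P)ᗮ = Submodule.span ℝ (Set.range u) := by rw [hPV, hV]
  have hne : ∀ j, u j ≠ 0 := fun j h => by
    obtain ⟨i, hi⟩ := hA.1 j
    exact hu.ne_zero hi (by simp [h])
  have hzero : ∀ (I : Finset (Fin n)) (hI : I.card = k), I ∉ blockBases A →
      maxMinor P I hI = 0 := by
    intro I hI hIA
    rw [mem_blockBases_iff hn hA] at hIA
    push Not at hIA
    obtain ⟨j, hj⟩ := hIA hI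
    refine maxMinor_eq_zero_of_vec hI (hP ▸ Submodule.subset_span ⟨j, rfl⟩) (hne j) fun i hi => ?_
    exact (hu j).1 i fun h => hi (hj i h)
  have hnonzero : ∀ (I : Finset (Fin n)) (hI : I.card = k), I ∈ blockBases A →
      maxMinor P I hI ≠ 0 := by
    intro I hI hIA h
    obtain ⟨w, hw, hw0, hwI⟩ := exists_vec_of_maxMinor_eq_zero h
    rw [hP, Submodule.mem_span_range_iff_exists_fun] at hw
    obtain ⟨c, rfl⟩ := hw
    refine hw0 (Finset.sum_eq_zero fun j _ => ?_)
    obtain ⟨i, hi, hiI⟩ := ((mem_blockBases_iff hn hA).1 hIA).2 j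
    have := hwI i hiI
    rw [hu.sum_apply hA c hi] at this
    rw [(mul_eq_zero.1 this).resolve_right (hu.ne_zero hi), zero_smul]
  have h0 : ∀ b : Fin r → Fin n, (∀ j, b j ∈ A j) → minor P (Finset.univ.image b)ᶜ ≠ 0 := by
    intro b hb
    have hI : (Finset.univ.image b)ᶜ ∈ blockBases A := ⟨b, hb, rfl⟩
    rw [minor_eq P (card_of_mem_blockBases hn hA hI)]
    exact hnonzero _ _ hI
  have hsame : ∀ b b' : Fin r → Fin n, (∀ j, b j ∈ A j) → (∀ j, b' j ∈ A j) →
      0 < minor P (Finset.univ.image b)ᶜ * minor P (Finset.univ.image b')ᶜ := by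
    intro b b' hb hb'
    -- the transversal `b` is turned into `b'` by one exchange after the other
    have key : ∀ s : Finset (Fin r),
        0 < minor P (Finset.univ.image b)ᶜ * minor P (Finset.univ.image (s.piecewise b' b))ᶜ := by
      intro s
      induction s using Finset.induction_on with
      | empty =>
        rw [Finset.piecewise_empty]
        exact mul_self_pos.2 (h0 b hb)
      | insert j s hj ih =>
        have hs : ∀ l, s.piecewise b' b l ∈ A l := fun l => by
          by_cases hl : l ∈ s
          · rw [Finset.piecewise_eq_of_mem _ _ _ hl]; exact hb' l
          · rw [Finset.piecewise_eq_of_notMem _ _ _ hl]; exact hb l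
        rw [Finset.piecewise_insert]
        have h1 := minor_mul_minor_update_pos hn hA hu hP h0 hs (hb' j)
        have h2 := mul_self_pos.2 (h0 _ hs)
        refine (mul_pos_iff_of_pos_right h2).1 ((mul_pos ih h1).trans_eq ?_)
        ring
    have := key Finset.univ
    rwa [Finset.piecewise_univ] at this
  obtain ⟨I₀, b₀, hb₀, -⟩ := blockBases_nonempty hA
  rcases (h0 b₀ hb₀).lt_or_gt with hneg | hpos
  -- for `k = 0` the only minor is the empty determinant `1`
  · have hk : 0 < k := by
      rcases k.eq_zero_or_pos with rfl | h
      · have hI : (Finset.univ.image b₀)ᶜ ∈ blockBases A := ⟨b₀, hb₀, rfl⟩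
        rw [minor_eq P (card_of_mem_blockBases hn hA hI), maxMinor, Matrix.det_fin_zero] at hneg
        norm_num at hneg
      · exact h
    obtain ⟨P', hPP', hP'⟩ := exists_rowSpan_eq_neg hk P
    refine ⟨P', hPP'.trans hPV, fun I hI => ⟨fun hIA => ?_, fun hIA => ?_⟩⟩
    · obtain ⟨b, hb, rfl⟩ := hIA
      rw [hP', neg_pos, ← minor_eq P hI]
      exact neg_of_mul_pos_right (hsame b₀ b hb₀ hb) hneg.le
    · rw [hP', hzero I hI hIA, neg_zero]
  · refine ⟨P, hPV, fun I hI => ⟨fun hIA => ?_, fun hIA => hzero I hI hIA⟩⟩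
    obtain ⟨b, hb, rfl⟩ := hIA
    rw [← minor_eq P hI]
    exact (mul_pos_iff_of_pos_left hpos).1 (hsame b₀ b hb₀ hb)

theorem posCell_blockBases {k n r : ℕ} (hn : r + k = n) {A : Fin r → Finset (Fin n)}
    (hA : IsBlocks A) : posCell k n (blockBases A) = openCell k n A :=
  (posCell_blockBases_subset hn hA).antisymm (openCell_subset_posCell hn hA)

/-! ### A point of the subcomplex is determined by its line -/

theorem sign_neg_one_pow_mul (m : ℕ) (a : ℝ) :
    SignType.sign ((-1) ^ m * a) = (-1) ^ m * SignType.sign a := by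
  have h : SignType.sign ((-1 : ℝ) ^ m) = SignType.sign (-1 : ℝ) ^ m := map_pow signHom _ _
  rw [sign_mul, h, Left.sign_neg, sign_one]

/-- The signs of a combination of the vectors of a frame. -/
theorem BlockFrame.twistSign_sum {n r : ℕ} {A : Fin r → Finset (Fin n)} (hA : IsBlocks A)
    {u : Fin r → EuclideanSpace ℝ (Fin n)} (hu : BlockFrame A u) (c : Fin r → ℝ) {j : Fin r}
    {i : Fin n} (hi : i ∈ A j) :
    twistSign (∑ l, c l • u l) i = SignType.sign (c j) * (-1) ^ (j : ℕ) := by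
  have h1 : SignType.sign ((-1 : ℝ) ^ ((i : ℕ) + j) * u j i) = 1 := sign_pos ((hu j).2 i hi)
  rw [sign_neg_one_pow_mul] at h1
  have h2 : SignType.sign (u j i) = (-1) ^ ((i : ℕ) + j) := by
    refine (?_ : ∀ a b : SignType, a * b = 1 → b = a) _ _ h1
    decide
  rw [twistSign_apply, hu.sum_apply hA c hi, sign_mul, h2, pow_add]
  have : ∀ a b e : SignType, a ≠ 0 → a * (e * (a * b)) = e * b := by decide
  exact this _ _ _ (neg_one_pow_ne_zero_signType _)

theorem BlockFrame.twistSign_sum_eq_zero {n r : ℕ} {A : Fin r → Finset (Fin n)}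
    {u : Fin r → EuclideanSpace ℝ (Fin n)} (hu : BlockFrame A u) (c : Fin r → ℝ)
    {i : Fin n} (hi : ∀ j, i ∉ A j) : twistSign (∑ l, c l • u l) i = 0 := by
  rw [twistSign_apply, hu.sum_apply_eq_zero c hi]
  simp

/-- If a combination of the vectors of a frame with `r` blocks has itself `r` blocks, then these
are the blocks of the frame: each block of the combination meets a block of the frame, and
consecutive ones meet different blocks because of the alternating signs. -/
theorem BlockFrame.signedBlocks_of_mem_span {n r : ℕ} {A B : Fin r → Finset (Fin n)}
    (hA : IsBlocks A) (hB : IsBlocks B) {u : Fin r → EuclideanSpace ℝ (Fin n)}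
    (hu : BlockFrame A u) {w : EuclideanSpace ℝ (Fin n)}
    (hw : w ∈ Submodule.span ℝ (Set.range u)) (hwB : SignedBlocks B (twistSign w)) :
    SignedBlocks A (twistSign w) := by
  obtain ⟨c, rfl⟩ := (Submodule.mem_span_range_iff_exists_fun ℝ).1 hw
  choose b hb using hB.1
  obtain ⟨δ, hδ, hδB⟩ := hwB.exists_mul
  have hwb : ∀ j, twistSign (∑ l, c l • u l) (b j) = δ * (-1) ^ (j : ℕ) := fun j => by
    rw [← hδB.1 j (b j) (hb j), ← mul_assoc, hδ, one_mul]
  have hδ0 : δ ≠ 0 := by rintro rfl; simp at hδ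
  have hf : ∀ m, ∃ j, b m ∈ A j := fun m => by
    by_contra hc
    have := hwb m
    rw [hu.twistSign_sum_eq_zero c (not_exists.1 hc)] at this
    exact mul_ne_zero hδ0 (neg_one_pow_ne_zero_signType _) this.symm
  choose f hf using hf
  have hsign : ∀ m, SignType.sign (c (f m)) * (-1) ^ (f m : ℕ) = δ * (-1) ^ (m : ℕ) := fun m => by
    rw [← hwb, hu.twistSign_sum hA c (hf m)]
  have hmono : Monotone f := fun m m' h =>
    hA.le_of_le (hf m) (hf m') ((hB.strictMono hb).monotone h)
  have hne : ∀ m m', m < m' → f m ≠ f m' := by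
    intro m m' h he
    let m₁ : Fin r := ⟨m + 1, lt_of_le_of_lt (Nat.succ_le_of_lt h) m'.2⟩
    have h1 : f m = f m₁ := le_antisymm (hmono (Nat.le_succ _)) (by
      rw [he]; exact hmono (Nat.succ_le_of_lt h))
    have h2 := hsign m₁
    rw [← h1, hsign m] at h2
    have h3 : (-1 : SignType) ^ ((m : ℕ) + 1) = -(-1) ^ (m : ℕ) := by rw [pow_succ]; simp
    simp only [m₁, h3] at h2
    have h4 := neg_one_pow_ne_zero_signType (m : ℕ)
    have : ∀ a d : SignType, a ≠ 0 → d ≠ 0 → d * a ≠ d * -a := by decide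
    exact this _ _ h4 hδ0 h2
  have hid : ∀ m, f m = m := strictMono_fin_eq_id (hmono.strictMono_of_injective fun m m' h => by
    rcases lt_trichotomy m m' with hlt | he | hlt
    · exact absurd h (hne m m' hlt)
    · exact he
    · exact absurd h.symm (hne m' m hlt))
  have hc : ∀ m, SignType.sign (c m) = δ := fun m => by
    have h := hsign m
    rw [hid] at h
    have : ∀ a d e : SignType, e ≠ 0 → a * e = d * e → a = d := by decide
    exact this _ _ _ (neg_one_pow_ne_zero_signType _) h
  have hval : ∀ j, ∀ i ∈ A j, twistSign (∑ l, c l • u l) i = δ * (-1) ^ (j : ℕ) := fun j i hi => by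
    rw [hu.twistSign_sum hA c hi, hc]
  have hcases : ∀ d : SignType, d ≠ 0 → d = 1 ∨ d = -1 := by decide
  rcases hcases δ hδ0 with rfl | rfl
  · refine Or.inl ⟨fun j i hi => by rw [hval j i hi, one_mul], fun i hi => ?_⟩
    exact hu.twistSign_sum_eq_zero c hi
  · refine Or.inr ⟨fun j i hi => by rw [Pi.neg_apply, hval j i hi]; simp, fun i hi => ?_⟩
    rw [Pi.neg_apply, hu.twistSign_sum_eq_zero c hi]
    rfl

/-- The line that a point of an open cell cuts out on `W` has the blocks of the cell. -/
theorem signedBlocks_of_mem_openCell {k n r : ℕ} (hn : r + k = n) {A : Fin r → Finset (Fin n)}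
    (hA : IsBlocks A) {V : Gr k n} (hV : V ∈ openCell k n A) (hV' : V ∈ tnnGr k n)
    {W : Gr (k + 1) n} (hW : W ∈ tpGr (k + 1) n) {w : EuclideanSpace ℝ (Fin n)}
    (hw : w ∈ V.subᗮ ⊓ W.sub) (h0 : w ≠ 0) : SignedBlocks A (twistSign w) := by
  obtain ⟨B, hB, hwB⟩ := exists_signedBlocks_of_mem hn hV' hW hw h0
  obtain ⟨u, hu, hVu⟩ := hV
  exact hu.signedBlocks_of_mem_span hA hB (hVu ▸ hw.1) hwB

/-- The blocks of an open cell are determined by any of its points. -/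
theorem eq_of_mem_openCell {k n r : ℕ} {A B : Fin r → Finset (Fin n)} (hA : IsBlocks A)
    (hB : IsBlocks B) {V : Gr k n} (hVA : V ∈ openCell k n A) (hVB : V ∈ openCell k n B) :
    A = B := by
  obtain ⟨u, hu, hVu⟩ := hVA
  obtain ⟨v, hv, hVv⟩ := hVB
  -- the sum of the vectors of a frame has the blocks of the frame
  have hw : SignedBlocks A (twistSign (∑ l, (1 : ℝ) • u l)) := by
    refine Or.inl ⟨fun j i hi => ?_, fun i hi => hu.twistSign_sum_eq_zero _ hi⟩
    rw [hu.twistSign_sum hA (fun _ => 1) hi, sign_one, one_mul]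
  refine hw.eq hA hB (hv.signedBlocks_of_mem_span hB hA ?_ hw)
  rw [← hVv, hVu]
  exact Submodule.sum_mem _ fun l _ => Submodule.smul_mem _ _ (Submodule.subset_span ⟨l, rfl⟩)

/-- The part of a vector that lies in the block number `j`. -/
noncomputable def blockPart {n r : ℕ} (A : Fin r → Finset (Fin n))
    (w : EuclideanSpace ℝ (Fin n)) (j : Fin r) : EuclideanSpace ℝ (Fin n) :=
  WithLp.toLp 2 fun i => if i ∈ A j then w i else 0

theorem blockFrame_blockPart {n r : ℕ} {A : Fin r → Finset (Fin n)}
    {w : EuclideanSpace ℝ (Fin n)} (h : HasBlocks A (twistSign w)) :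
    BlockFrame A (blockPart A w) := by
  refine fun j => ⟨fun i hi => by simp [blockPart, hi], fun i hi => ?_⟩
  have h1 : blockPart A w j i = w i := by simp [blockPart, hi]
  rw [h1, ← sign_eq_one_iff, sign_neg_one_pow_mul, signOf_eq_of_hasBlocks h hi, ← pow_add,
    Even.neg_one_pow ⟨_, rfl⟩]

theorem sum_blockPart {n r : ℕ} {A : Fin r → Finset (Fin n)} (hA : IsBlocks A)
    {w : EuclideanSpace ℝ (Fin n)} (h : HasBlocks A (twistSign w)) :
    ∑ j, (1 : ℝ) • blockPart A w j = w := by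
  have hu := blockFrame_blockPart h
  ext i
  by_cases hi : ∃ j, i ∈ A j
  · obtain ⟨j, hj⟩ := hi
    rw [hu.sum_apply hA (fun _ => 1) hj, one_mul]
    simp [blockPart, hj]
  · rw [hu.sum_apply_eq_zero (fun _ => 1) (not_exists.1 hi)]
    by_contra hc
    exact twistSign_ne_zero.2 (Ne.symm hc) (h.2 i (not_exists.1 hi))

/-- The subspace orthogonal to a frame. -/
noncomputable def framePerp {k n r : ℕ} (hn : r + k = n) {A : Fin r → Finset (Fin n)}
    (hA : IsBlocks A) {u : Fin r → EuclideanSpace ℝ (Fin n)} (hu : BlockFrame A u) : Gr k n :=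
  ⟨(Submodule.span ℝ (Set.range u))ᗮ, by
    have h := Submodule.finrank_add_finrank_orthogonal (Submodule.span ℝ (Set.range u))
    rw [hu.finrank_span hA, finrank_euclideanSpace_fin] at h
    omega⟩

theorem orthogonal_framePerp {k n r : ℕ} (hn : r + k = n) {A : Fin r → Finset (Fin n)}
    (hA : IsBlocks A) {u : Fin r → EuclideanSpace ℝ (Fin n)} (hu : BlockFrame A u) :
    (framePerp hn hA hu).subᗮ = Submodule.span ℝ (Set.range u) :=
  Submodule.orthogonal_orthogonal _

theorem framePerp_mem_openCell {k n r : ℕ} (hn : r + k = n) {A : Fin r → Finset (Fin n)}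
    (hA : IsBlocks A) {u : Fin r → EuclideanSpace ℝ (Fin n)} (hu : BlockFrame A u) :
    framePerp hn hA hu ∈ openCell k n A :=
  ⟨u, hu, orthogonal_framePerp hn hA hu⟩

/-- The frame with all entries in the blocks equal to `±1`. -/
noncomputable def signFrame {n r : ℕ} (A : Fin r → Finset (Fin n)) (j : Fin r) :
    EuclideanSpace ℝ (Fin n) :=
  WithLp.toLp 2 fun i => if i ∈ A j then (-1 : ℝ) ^ ((i : ℕ) + j) else 0

theorem neg_one_pow_mul_signFrame {n r : ℕ} {A : Fin r → Finset (Fin n)} {j : Fin r} {i : Fin n}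
    (hi : i ∈ A j) : (-1 : ℝ) ^ ((i : ℕ) + j) * signFrame A j i = 1 := by
  simp only [signFrame, hi, if_true, ← pow_add]
  exact Even.neg_one_pow ⟨_, rfl⟩

theorem blockFrame_signFrame {n r : ℕ} (A : Fin r → Finset (Fin n)) :
    BlockFrame A (signFrame A) := by
  refine fun j => ⟨fun i hi => by simp [signFrame, hi], fun i hi => ?_⟩
  rw [neg_one_pow_mul_signFrame hi]
  exact one_pos

theorem openCell_nonempty {k n r : ℕ} (hn : r + k = n) {A : Fin r → Finset (Fin n)}
    (hA : IsBlocks A) : (openCell k n A).Nonempty :=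
  ⟨_, framePerp_mem_openCell hn hA (blockFrame_signFrame A)⟩

/-- The parts of `w` in its blocks form a frame, and `w` is their sum. -/
theorem exists_mem_openCell {k n r : ℕ} (hn : r + k = n) {A : Fin r → Finset (Fin n)}
    (hA : IsBlocks A) {w : EuclideanSpace ℝ (Fin n)} (h : SignedBlocks A (twistSign w)) :
    ∃ V ∈ openCell k n A, w ∈ V.subᗮ := by
  wlog hx : HasBlocks A (twistSign w) generalizing w with H
  · have h' : HasBlocks A (twistSign (-w)) := by rw [twistSign_neg]; exact h.resolve_left hx
    obtain ⟨V, hV, hw⟩ := H (Or.inl h') h'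
    exact ⟨V, hV, by simpa using hw⟩
  · refine ⟨_, framePerp_mem_openCell hn hA (blockFrame_blockPart hx), ?_⟩
    rw [orthogonal_framePerp]
    have := sum_blockPart hA hx
    rw [← this]
    exact Submodule.sum_mem _ fun l _ => Submodule.smul_mem _ _ (Submodule.subset_span (by
      rw [this]; exact ⟨l, rfl⟩))

theorem eq_of_orthogonal_eq {k n : ℕ} {V V' : Gr k n} (h : V.subᗮ = V'.subᗮ) : V = V' := by
  refine Subtype.ext ?_
  rw [← Submodule.orthogonal_orthogonal V.1, ← Submodule.orthogonal_orthogonal V'.1]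
  exact congrArg _ h

/-- A point `V` of an open cell is determined by any vector of `Vᗮ` that has the blocks of the cell:
the parts of this vector in the blocks span `Vᗮ`. -/
theorem eq_of_mem_orthogonal {k n r : ℕ} (hn : r + k = n) {A : Fin r → Finset (Fin n)}
    (hA : IsBlocks A) {V V' : Gr k n} (hV : V ∈ openCell k n A) (hV' : V' ∈ openCell k n A)
    {w : EuclideanSpace ℝ (Fin n)} (hwV : w ∈ V.subᗮ) (hwV' : w ∈ V'.subᗮ)
    (h : SignedBlocks A (twistSign w)) : V = V' := by
  wlog hx : HasBlocks A (twistSign w) generalizing w with H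
  · have h' : HasBlocks A (twistSign (-w)) := by rw [twistSign_neg]; exact h.resolve_left hx
    exact H (neg_mem hwV) (neg_mem hwV') (Or.inl h') h'
  have key : ∀ V ∈ openCell k n A, w ∈ V.subᗮ →
      V.subᗮ = Submodule.span ℝ (Set.range (blockPart A w)) := by
    rintro V ⟨u, hu, hVu⟩ hw
    refine (blockFrame_blockPart hx).span_eq hn hA fun j => ?_
    rw [hVu] at hw
    obtain ⟨c, hc⟩ := (Submodule.mem_span_range_iff_exists_fun ℝ).1 hw
    have : blockPart A w j = c j • u j := by
      ext i
      by_cases hi : i ∈ A j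
      · have h1 : blockPart A w j i = w i := by simp [blockPart, hi]
        rw [h1, ← hc, hu.sum_apply hA c hi, PiLp.smul_apply, smul_eq_mul]
      · simp [blockPart, hi, (hu j).1 i hi]
    rw [this, hVu]
    exact Submodule.smul_mem _ _ (Submodule.subset_span ⟨j, rfl⟩)
  exact eq_of_orthogonal_eq ((key V hV hwV).trans (key V' hV' hwV').symm)

theorem posCell_subset_tnnGr (k n : ℕ) (M : Set (Finset (Fin n))) : posCell k n M ⊆ tnnGr k n := by
  rintro V ⟨P, hPV, hP⟩
  refine ⟨P, hPV, fun I hI => ?_⟩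
  by_cases h : I ∈ M
  · exact ((hP I hI).1 h).le
  · exact ((hP I hI).2 h).ge

theorem openCell_subset_tnnGr {k n r : ℕ} (hn : r + k = n) {A : Fin r → Finset (Fin n)}
    (hA : IsBlocks A) : openCell k n A ⊆ tnnGr k n :=
  (openCell_subset_posCell hn hA).trans (posCell_subset_tnnGr k n _)

/-- The union of all open cells. -/
def blockComplex (r k n : ℕ) : Set (Gr k n) :=
  {V | ∃ A : Fin r → Finset (Fin n), IsBlocks A ∧ V ∈ openCell k n A}

theorem blockComplex_subset_tnnGr {k n r : ℕ} (hn : r + k = n) :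
    blockComplex r k n ⊆ tnnGr k n := by
  rintro V ⟨A, hA, hV⟩
  exact openCell_subset_tnnGr hn hA hV

theorem eq_of_finrank_eq_one {n : ℕ} {S T : Submodule ℝ (EuclideanSpace ℝ (Fin n))}
    (hS : Module.finrank ℝ S = 1) (hT : Module.finrank ℝ T = 1) {w : EuclideanSpace ℝ (Fin n)}
    (hwS : w ∈ S) (hwT : w ∈ T) (h0 : w ≠ 0) : S = T := by
  have key : ∀ S : Submodule ℝ (EuclideanSpace ℝ (Fin n)), Module.finrank ℝ S = 1 → w ∈ S →
      Submodule.span ℝ {w} = S := fun S hS hw =>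
    Submodule.eq_of_le_of_finrank_eq ((Submodule.span_singleton_le_iff_mem _ _).2 hw)
      (by rw [finrank_span_singleton h0, hS])
  exact (key S hS hwS).symm.trans (key T hT hwT)

theorem exists_ne_zero_of_finrank_eq_one {n : ℕ} {S : Submodule ℝ (EuclideanSpace ℝ (Fin n))}
    (hS : Module.finrank ℝ S = 1) : ∃ w ∈ S, w ≠ 0 := by
  refine Submodule.exists_mem_ne_zero_of_ne_bot fun hb => ?_
  rw [hb, finrank_bot] at hS
  exact zero_ne_one hS

/-- A point of the complex is determined by the line that it cuts out on `W`: the signs of the line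
determine the blocks, and a vector on the line then determines the point. -/
theorem eq_of_mem_blockComplex {k n r : ℕ} (hn : r + k = n) {W : Gr (k + 1) n}
    (hW : W ∈ tpGr (k + 1) n) {V V' : Gr k n} (hV : V ∈ blockComplex r k n)
    (hV' : V' ∈ blockComplex r k n) (h : V.subᗮ ⊓ W.sub = V'.subᗮ ⊓ W.sub) : V = V' := by
  have hVt := blockComplex_subset_tnnGr hn hV
  have hVt' := blockComplex_subset_tnnGr hn hV'
  obtain ⟨A, hA, hV⟩ := hV
  obtain ⟨A', hA', hV'⟩ := hV'
  obtain ⟨w, hw, h0⟩ := exists_ne_zero_of_finrank_eq_one (finrank_orthogonal_inf hVt hW)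
  have h1 := signedBlocks_of_mem_openCell hn hA hV hVt hW hw h0
  have h2 := signedBlocks_of_mem_openCell hn hA' hV' hVt' hW (h ▸ hw) h0
  obtain rfl := h1.eq hA hA' h2
  exact eq_of_mem_orthogonal hn hA hV hV' hw.1 (h ▸ hw : w ∈ V'.subᗮ ⊓ W.sub).1 h1

/-- Every line that a totally nonnegative subspace cuts out on `W` is also cut out by a point of
the complex. -/
theorem exists_mem_blockComplex {k n r : ℕ} (hn : r + k = n) {W : Gr (k + 1) n}
    (hW : W ∈ tpGr (k + 1) n) {V : Gr k n} (hV : V ∈ tnnGr k n) :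
    ∃ V' ∈ blockComplex r k n, V'.subᗮ ⊓ W.sub = V.subᗮ ⊓ W.sub := by
  obtain ⟨w, hw, h0⟩ := exists_ne_zero_of_finrank_eq_one (finrank_orthogonal_inf hV hW)
  obtain ⟨A, hA, hwA⟩ := exists_signedBlocks_of_mem hn hV hW hw h0
  obtain ⟨V', hV', hw'⟩ := exists_mem_openCell hn hA hwA
  refine ⟨V', ⟨A, hA, hV'⟩, ?_⟩
  exact eq_of_finrank_eq_one (finrank_orthogonal_inf (openCell_subset_tnnGr hn hA hV') hW)
    (finrank_orthogonal_inf hV hW) ⟨hw', hw.2⟩ hw h0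

/-! ### The topology of the Grassmannian -/

theorem isEmbedding_starProjection (k n : ℕ) :
    Topology.IsEmbedding fun V : Gr k n => V.sub.starProjection :=
  ⟨⟨rfl⟩, fun _ _ h => Subtype.ext (Submodule.starProjection_inj.1 h)⟩

instance (k n : ℕ) : T2Space (Gr k n) :=
  (isEmbedding_starProjection k n).t2Space

/-- Families of `r` nonzero pairwise orthogonal vectors. -/
abbrev OrthoFrame (r n : ℕ) : Type :=
  {u : Fin r → EuclideanSpace ℝ (Fin n) //
    (Pairwise fun i j => inner ℝ (u i) (u j) = 0) ∧ ∀ j, u j ≠ 0}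

/-- This formula shows that the projection onto the span of an orthogonal family depends
continuously on the family. -/
theorem starProjection_span_range {r n : ℕ} (u : OrthoFrame r n) :
    (Submodule.span ℝ (Set.range u.1)).starProjection =
      ∑ j, (‖u.1 j‖ ^ 2)⁻¹ • (innerSL ℝ (u.1 j)).smulRight (u.1 j) := by
  ext1 v
  have happ : (∑ j, (‖u.1 j‖ ^ 2)⁻¹ • (innerSL ℝ (u.1 j)).smulRight (u.1 j)) v =
      ∑ j, (‖u.1 j‖ ^ 2)⁻¹ • (inner ℝ (u.1 j) v • u.1 j) := by
    rw [sum_apply]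
    rfl
  rw [happ]
  refine Submodule.eq_starProjection_of_mem_orthogonal (Submodule.sum_mem _ fun j _ =>
    Submodule.smul_mem _ _ (Submodule.smul_mem _ _ (Submodule.subset_span ⟨j, rfl⟩))) ?_
  rw [Submodule.mem_orthogonal]
  intro x hx
  induction hx using Submodule.span_induction with
  | mem x hx =>
    obtain ⟨i, rfl⟩ := hx
    rw [inner_sub_right, inner_sum, Finset.sum_eq_single i]
    · rw [inner_smul_right, inner_smul_right, real_inner_self_eq_norm_sq]
      have : ‖u.1 i‖ ≠ 0 := norm_ne_zero_iff.2 (u.2.2 i)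
      field_simp
      ring
    · intro j _ hj
      rw [inner_smul_right, inner_smul_right, u.2.1 hj.symm, mul_zero, mul_zero]
    · simp
  | zero => simp
  | add x y _ _ hx hy => rw [inner_add_left, hx, hy, add_zero]
  | smul a x _ hx => rw [inner_smul_left, hx, mul_zero]

/-- The span of a family of nonzero pairwise orthogonal vectors. -/
noncomputable def OrthoFrame.toGr {r n : ℕ} (u : OrthoFrame r n) : Gr r n :=
  ⟨Submodule.span ℝ (Set.range u.1), by
    rw [finrank_span_eq_card (linearIndependent_of_ne_zero_of_inner_eq_zero u.2.2 u.2.1),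
      Fintype.card_fin]⟩

theorem OrthoFrame.continuous_toGr {r n : ℕ} :
    Continuous (OrthoFrame.toGr : OrthoFrame r n → Gr r n) := by
  rw [(isEmbedding_starProjection r n).continuous_iff]
  have : ((fun V : Gr r n => V.sub.starProjection) ∘ OrthoFrame.toGr) = fun u : OrthoFrame r n =>
      ∑ j, (‖u.1 j‖ ^ 2)⁻¹ • (innerSL ℝ (u.1 j)).smulRight (u.1 j) :=
    funext starProjection_span_range
  rw [this]
  refine continuous_finsetSum _ fun j _ => ?_
  have hj : Continuous fun u : OrthoFrame r n => u.1 j :=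
    (continuous_apply j).comp continuous_subtype_val
  refine ((hj.norm.pow 2).inv₀ fun u => ?_).smul ?_
  · exact pow_ne_zero 2 (norm_ne_zero_iff.2 (u.2.2 j))
  · exact ((ContinuousLinearMap.smulRightL ℝ _ _).continuous₂).comp
      (((innerSL ℝ).continuous.comp hj).prodMk hj)

/-- The orthogonal complement, as a map between Grassmannians. -/
noncomputable def Gr.perp {r k n : ℕ} (hn : r + k = n) (X : Gr r n) : Gr k n :=
  ⟨X.subᗮ, by rw [finrank_orthogonal]; omega⟩

theorem Gr.continuous_perp {r k n : ℕ} (hn : r + k = n) :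
    Continuous (Gr.perp hn : Gr r n → Gr k n) := by
  rw [(isEmbedding_starProjection k n).continuous_iff]
  have : ((fun V : Gr k n => V.sub.starProjection) ∘ Gr.perp hn) = fun X : Gr r n =>
      ContinuousLinearMap.id ℝ (EuclideanSpace ℝ (Fin n)) - X.sub.starProjection := by
    funext X
    ext1 v
    exact Submodule.starProjection_orthogonal_val v
  rw [this]
  exact continuous_const.sub (isEmbedding_starProjection r n).continuous

theorem OrthoFrame.isCompact_unit {r n : ℕ} {F : Set (Fin r → EuclideanSpace ℝ (Fin n))}
    (hF : IsClosed F) : IsCompact {u : OrthoFrame r n | u.1 ∈ F ∧ ∀ j, ‖u.1 j‖ = 1} := by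
  rw [Subtype.isCompact_iff]
  have himage : (Subtype.val '' {u : OrthoFrame r n | u.1 ∈ F ∧ ∀ j, ‖u.1 j‖ = 1}) =
      {u | (∀ i j, i ≠ j → inner ℝ (u i) (u j) = 0) ∧ u ∈ F ∧ ∀ j, ‖u j‖ = 1} := by
    ext u
    constructor
    · rintro ⟨u, hu, rfl⟩
      exact ⟨fun i j h => u.2.1 h, hu⟩
    · rintro ⟨h1, h2⟩
      exact ⟨⟨u, fun i j h => h1 i j h, fun j h => by simpa [h] using h2.2 j⟩, h2, rfl⟩
  rw [himage]
  refine Metric.isCompact_of_isClosed_isBounded ?_ ?_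
  · have h1 : IsClosed {u : Fin r → EuclideanSpace ℝ (Fin n) |
        ∀ i j, i ≠ j → inner ℝ (u i) (u j) = 0} := by
      simp only [Set.ofPred_forall]
      refine isClosed_iInter fun i => isClosed_iInter fun j => isClosed_iInter fun _ => ?_
      exact isClosed_eq (by fun_prop) continuous_const
    have h2 : IsClosed {u : Fin r → EuclideanSpace ℝ (Fin n) | ∀ j, ‖u j‖ = 1} := by
      simp only [Set.ofPred_forall]
      exact isClosed_iInter fun j => isClosed_eq (by fun_prop) continuous_const
    exact h1.inter (hF.inter h2)
  · refine (Metric.isBounded_closedBall (x := 0) (r := 1)).subset fun u hu => ?_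
    rw [mem_closedBall_zero_iff, pi_norm_le_iff_of_nonneg zero_le_one]
    exact fun j => (hu.2.2 j).le

instance (k n : ℕ) : CompactSpace (Gr k n) := by
  have h := (OrthoFrame.isCompact_unit (r := k) (n := n) isClosed_univ).image
    OrthoFrame.continuous_toGr
  refine ⟨h.of_isClosed_subset isClosed_univ fun V _ => ?_⟩
  -- every subspace is the span of an orthonormal family, and these families form a compact set
  let e := (stdOrthonormalBasis ℝ V.sub).reindex (finCongr V.2)
  have he : Orthonormal ℝ fun j => (e j : EuclideanSpace ℝ (Fin n)) :=
    e.orthonormal.comp_linearIsometry V.sub.subtypeₗᵢ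
  refine ⟨⟨fun j => (e j : EuclideanSpace ℝ (Fin n)), fun i j h => he.2 h, he.ne_zero⟩,
    ⟨Set.mem_univ _, he.1⟩, Subtype.ext ?_⟩
  have : (Set.range fun j => (e j : EuclideanSpace ℝ (Fin n))) = V.sub.subtype '' Set.range e := by
    rw [← Set.range_comp]; rfl
  simp only [OrthoFrame.toGr]
  rw [this, Submodule.span_image, ← e.coe_toBasis, e.toBasis.span_eq, Submodule.map_subtype_top]

/-- The closed graph theorem for maps into a compact space. -/
theorem continuous_of_isClosed_graph {X Y : Type*} [TopologicalSpace X] [TopologicalSpace Y]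
    [CompactSpace Y] {f : X → Y} (h : IsClosed {p : X × Y | p.2 = f p.1}) : Continuous f := by
  rw [continuous_iff_isClosed]
  intro C hC
  have := isClosedMap_fst_of_compactSpace _ (h.inter (hC.preimage continuous_snd))
  convert this using 1
  ext x
  constructor
  · exact fun hx => ⟨(x, f x), ⟨rfl, hx⟩, rfl⟩
  · rintro ⟨⟨x', y⟩, ⟨hy, hC⟩, rfl⟩
    simp only [Set.mem_ofPred_eq] at hy
    subst hy
    exact hC

/-- A subspace is mapped into another one if and only if the corresponding relation between
the projections holds; this is a closed condition on the pair of subspaces. -/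
theorem map_le_iff_comp_starProjection {m n : ℕ}
    (Z : EuclideanSpace ℝ (Fin n) →L[ℝ] EuclideanSpace ℝ (Fin m))
    (V : Submodule ℝ (EuclideanSpace ℝ (Fin n))) (Y : Submodule ℝ (EuclideanSpace ℝ (Fin m))) :
    V.map (Z : EuclideanSpace ℝ (Fin n) →ₗ[ℝ] EuclideanSpace ℝ (Fin m)) ≤ Y ↔
      Y.starProjection.comp (Z.comp V.starProjection) = Z.comp V.starProjection := by
  rw [Submodule.map_le_iff_le_comap]
  constructor
  · intro h
    ext1 v
    exact Submodule.starProjection_eq_self_iff.2 (h (Submodule.starProjection_apply_mem V v))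
  · intro h v hv
    have := congrArg (fun T => T v) h
    simp only [ContinuousLinearMap.comp_apply, Submodule.starProjection_eq_self_iff.2 hv] at this
    exact (Submodule.starProjection_eq_self_iff.1 this : Z v ∈ Y)

theorem isClosed_map_le {j k m n : ℕ}
    (Z : EuclideanSpace ℝ (Fin n) →L[ℝ] EuclideanSpace ℝ (Fin m)) :
    IsClosed {p : Gr k n × Gr j m |
      p.1.sub.map (Z : EuclideanSpace ℝ (Fin n) →ₗ[ℝ] EuclideanSpace ℝ (Fin m)) ≤ p.2.sub} := by
  simp only [map_le_iff_comp_starProjection]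
  have h1 : Continuous fun p : Gr k n × Gr j m => p.1.sub.starProjection :=
    (isEmbedding_starProjection k n).continuous.comp continuous_fst
  have h2 : Continuous fun p : Gr k n × Gr j m => p.2.sub.starProjection :=
    (isEmbedding_starProjection j m).continuous.comp continuous_snd
  exact isClosed_eq (h2.clm_comp (continuous_const.clm_comp h1)) (continuous_const.clm_comp h1)

/-! ### Closures of cells -/

theorem inner_eq_zero_of_blocks {n r : ℕ} {A : Fin r → Finset (Fin n)} (hA : IsBlocks A)
    {u : Fin r → EuclideanSpace ℝ (Fin n)} (hu : ∀ j, ∀ i ∉ A j, u j i = 0) :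
    Pairwise fun i j => inner ℝ (u i) (u j) = 0 := by
  intro j l hjl
  rw [PiLp.inner_apply]
  refine Finset.sum_eq_zero fun i _ => ?_
  by_cases hi : i ∈ A j
  · have : i ∉ A l := fun h => hjl (hA.eq_of_mem hi h)
    rw [hu l i this, inner_zero_right]
  · rw [hu j i hi, inner_zero_left]

/-- A frame is a family of nonzero pairwise orthogonal vectors. -/
def BlockFrame.toOrthoFrame {n r : ℕ} {A : Fin r → Finset (Fin n)} (hA : IsBlocks A)
    {u : Fin r → EuclideanSpace ℝ (Fin n)} (hu : BlockFrame A u) : OrthoFrame r n :=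
  ⟨u, inner_eq_zero_of_blocks hA fun j => (hu j).1, fun j h => by
    obtain ⟨i, hi⟩ := hA.1 j
    exact hu.ne_zero hi (by simp [h])⟩

/-- The union of the open cells whose blocks are contained in given blocks. -/
def closedCell {r : ℕ} (k n : ℕ) (A : Fin r → Finset (Fin n)) : Set (Gr k n) :=
  {V | ∃ B : Fin r → Finset (Fin n), IsBlocks B ∧ (∀ j, B j ⊆ A j) ∧ V ∈ openCell k n B}

theorem openCell_subset_closedCell {k n r : ℕ} {A : Fin r → Finset (Fin n)} (hA : IsBlocks A) :
    openCell k n A ⊆ closedCell k n A :=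
  fun _ hV => ⟨A, hA, fun _ => subset_rfl, hV⟩

/-- A closed cell is parametrised by the frames of unit vectors with weak sign conditions. -/
theorem closedCell_eq_image {k n r : ℕ} (hn : r + k = n) {A : Fin r → Finset (Fin n)}
    (hA : IsBlocks A) :
    closedCell k n A = Gr.perp hn '' (OrthoFrame.toGr '' {u : OrthoFrame r n |
      u.1 ∈ {u : Fin r → EuclideanSpace ℝ (Fin n) | ∀ j, (∀ i ∉ A j, u j i = 0) ∧
        ∀ i ∈ A j, 0 ≤ (-1 : ℝ) ^ ((i : ℕ) + j) * u j i} ∧ ∀ j, ‖u.1 j‖ = 1}) := by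
  ext V
  constructor
  · rintro ⟨B, hB, hBA, u, hu, hV⟩
    have hne : ∀ j, u j ≠ 0 := (hu.toOrthoFrame hB).2.2
    have hpos : ∀ j, 0 < ‖u j‖⁻¹ := fun j => inv_pos.2 (norm_pos_iff.2 (hne j))
    have hv : BlockFrame B fun j => ‖u j‖⁻¹ • u j := by
      refine fun j => ⟨fun i hi => by simp [(hu j).1 i hi], fun i hi => ?_⟩
      rw [PiLp.smul_apply, smul_eq_mul, mul_left_comm]
      exact mul_pos (hpos j) ((hu j).2 i hi)
    refine ⟨(hv.toOrthoFrame hB).toGr, ⟨hv.toOrthoFrame hB, ⟨fun j => ⟨fun i hi => ?_,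
      fun i hi => ?_⟩, fun j => ?_⟩, rfl⟩, ?_⟩
    · exact (hv j).1 i fun h => hi (hBA j h)
    · by_cases h : i ∈ B j
      · exact ((hv j).2 i h).le
      · exact (mul_eq_zero_of_right _ ((hv j).1 i h)).ge
    · exact norm_smul_inv_norm (hne j)
    · refine eq_of_orthogonal_eq ((Submodule.orthogonal_orthogonal _).trans ?_)
      refine (hv.span_eq hn hB fun j => ?_).symm
      rw [hV]
      exact Submodule.smul_mem _ _ (Submodule.subset_span ⟨j, rfl⟩)
  · rintro ⟨_, ⟨u, ⟨hu, -⟩, rfl⟩, rfl⟩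
    -- the blocks of the smaller cell are the supports of the vectors
    refine ⟨fun j => (A j).filter fun i => u.1 j i ≠ 0, ⟨fun j => ?_, fun i j hij a ha b hb => ?_⟩,
      fun j => Finset.filter_subset _ _, u.1, fun j => ⟨fun i hi => ?_, fun i hi => ?_⟩, ?_⟩
    · by_contra hc
      rw [Finset.not_nonempty_iff_eq_empty, Finset.filter_eq_empty_iff] at hc
      refine u.2.2 j ?_
      ext i
      by_cases hi : i ∈ A j
      · exact not_not.1 (hc hi)
      · exact (hu j).1 i hi
    · exact hA.2 i j hij a (Finset.mem_filter.1 ha).1 b (Finset.mem_filter.1 hb).1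
    · by_cases hiA : i ∈ A j
      · by_contra h
        exact hi (Finset.mem_filter.2 ⟨hiA, h⟩)
      · exact (hu j).1 i hiA
    · rw [Finset.mem_filter] at hi
      refine lt_of_le_of_ne ((hu j).2 i hi.1) (mul_ne_zero ?_ hi.2).symm
      exact pow_ne_zero _ (by norm_num)
    · exact Submodule.orthogonal_orthogonal _

theorem isCompact_closedCell {k n r : ℕ} (hn : r + k = n) {A : Fin r → Finset (Fin n)}
    (hA : IsBlocks A) : IsCompact (closedCell k n A) := by
  rw [closedCell_eq_image hn hA]
  refine ((OrthoFrame.isCompact_unit ?_).image OrthoFrame.continuous_toGr).image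
    (Gr.continuous_perp hn)
  have : {u : Fin r → EuclideanSpace ℝ (Fin n) | ∀ j, (∀ i ∉ A j, u j i = 0) ∧
        ∀ i ∈ A j, 0 ≤ (-1 : ℝ) ^ ((i : ℕ) + j) * u j i} =
      ⋂ j, ((⋂ i, ⋂ (_ : i ∉ A j), {u : Fin r → EuclideanSpace ℝ (Fin n) | u j i = 0}) ∩
        ⋂ i, ⋂ (_ : i ∈ A j), {u : Fin r → EuclideanSpace ℝ (Fin n) |
          0 ≤ (-1 : ℝ) ^ ((i : ℕ) + j) * u j i}) := by
    ext u
    simp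
  rw [this]
  refine isClosed_iInter fun j => IsClosed.inter ?_ ?_
  · exact isClosed_iInter fun i => isClosed_iInter fun _ =>
      isClosed_eq (by fun_prop) continuous_const
  · exact isClosed_iInter fun i => isClosed_iInter fun _ =>
      isClosed_le continuous_const (by fun_prop)

/-- A frame of smaller blocks is a limit of frames of larger blocks: small multiples of the signs
are added to the entries. -/
theorem openCell_subset_closure {k n r : ℕ} (hn : r + k = n) {A B : Fin r → Finset (Fin n)}
    (hA : IsBlocks A) (hB : IsBlocks B) (h : ∀ j, B j ⊆ A j) :
    openCell k n B ⊆ closure (openCell k n A) := by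
  rintro V ⟨u, hu, hV⟩
  have hsupp : ∀ t : NNReal, ∀ j, ∀ i ∉ A j, (u j + (t : ℝ) • signFrame A j) i = 0 := by
    intro t j i hi
    simp [(hu j).1 i fun hiB => hi (h j hiB), (blockFrame_signFrame A j).1 i hi]
  have hval : ∀ (t : NNReal) (j : Fin r), ∀ i ∈ A j, (-1 : ℝ) ^ ((i : ℕ) + j) *
      (u j + (t : ℝ) • signFrame A j) i = (-1 : ℝ) ^ ((i : ℕ) + j) * u j i + t := by
    intro t j i hi
    rw [PiLp.add_apply, PiLp.smul_apply, smul_eq_mul, mul_add, mul_left_comm,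
      neg_one_pow_mul_signFrame hi, mul_one]
  let f : NNReal → OrthoFrame r n := fun t => ⟨fun j => u j + (t : ℝ) • signFrame A j,
    inner_eq_zero_of_blocks hA (hsupp t), fun j h0 => by
      obtain ⟨i, hi⟩ := hB.1 j
      have h1 := hval t j i (h j hi)
      rw [show u j + (t : ℝ) • signFrame A j = 0 from h0] at h1
      have h2 := (hu j).2 i hi
      have h3 := t.2
      simp at h1
      linarith⟩
  have hf : Continuous f := by
    refine Continuous.subtype_mk (continuous_pi fun j => ?_) _
    fun_prop
  have hmem : ∀ t ∈ Set.Ioi (0 : NNReal), Gr.perp hn (f t).toGr ∈ openCell k n A := by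
    intro t ht
    refine ⟨(f t).1, fun j => ⟨hsupp t j, fun i hi => ?_⟩, Submodule.orthogonal_orthogonal _⟩
    refine lt_of_lt_of_eq ?_ (hval t j i hi).symm
    have ht' : (0 : ℝ) < t := ht
    by_cases hiB : i ∈ B j
    · linarith [(hu j).2 i hiB]
    · rw [(hu j).1 i hiB]
      linarith
  have h0 : Gr.perp hn (f 0).toGr = V := by
    refine eq_of_orthogonal_eq ((Submodule.orthogonal_orthogonal _).trans ?_)
    rw [hV]
    have : (f 0).1 = u := by
      funext j
      simp [f]
    exact congrArg (fun v => Submodule.span ℝ (Set.range v)) this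
  rw [← h0]
  have hc : Continuous fun t => Gr.perp hn (f t).toGr :=
    (Gr.continuous_perp hn).comp (OrthoFrame.continuous_toGr.comp hf)
  refine map_mem_closure (f := fun t => Gr.perp hn (f t).toGr) hc (s := Set.Ioi 0) ?_ hmem
  rw [closure_Ioi' ⟨1, one_pos⟩]
  exact Set.mem_Ici.2 le_rfl

/-- The closed cell is the image of a compact set of frames, and its points are limits of points of
the open cell. -/
theorem closure_openCell {k n r : ℕ} (hn : r + k = n) {A : Fin r → Finset (Fin n)}
    (hA : IsBlocks A) : closure (openCell k n A) = closedCell k n A := by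
  refine (closure_minimal (openCell_subset_closedCell hA)
    (isCompact_closedCell hn hA).isClosed).antisymm ?_
  rintro V ⟨B, hB, hBA, hV⟩
  exact openCell_subset_closure hn hA hB hBA hV

theorem openCell_subset_closure_iff {k n r : ℕ} (hn : r + k = n) {A B : Fin r → Finset (Fin n)}
    (hA : IsBlocks A) (hB : IsBlocks B) :
    openCell k n B ⊆ closure (openCell k n A) ↔ ∀ j, B j ⊆ A j := by
  refine ⟨fun h => ?_, openCell_subset_closure hn hA hB⟩
  obtain ⟨V, hV⟩ := openCell_nonempty hn hB
  have := h hV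
  rw [closure_openCell hn hA] at this
  obtain ⟨B', hB', hBA', hV'⟩ := this
  obtain rfl := eq_of_mem_openCell hB hB' hV hV'
  exact hBA'

theorem blockComplex_eq_iUnion {k n r : ℕ} (hr : 0 < r) :
    blockComplex r k n =
      ⋃ A ∈ {A : Fin r → Finset (Fin n) | IsBlocks A ∧ IsFull A}, closedCell k n A := by
  ext V
  simp only [Set.mem_iUnion]
  constructor
  · rintro ⟨A, hA, hV⟩
    obtain ⟨A', hA', hf, h⟩ := hA.exists_full hr
    exact ⟨A', ⟨hA', hf⟩, A, hA, h, hV⟩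
  · rintro ⟨A, -, B, hB, -, hV⟩
    exact ⟨B, hB, hV⟩

theorem isCompact_blockComplex {k n r : ℕ} (hr : 0 < r) (hn : r + k = n) :
    IsCompact (blockComplex r k n) := by
  rw [blockComplex_eq_iUnion hr]
  exact (Set.toFinite _).isCompact_biUnion fun A hA => isCompact_closedCell hn hA.1

theorem closure_iUnion_openCell {k n r : ℕ} (hr : 0 < r) (hn : r + k = n) :
    closure (⋃ A ∈ {A : Fin r → Finset (Fin n) | IsBlocks A ∧ IsFull A}, openCell k n A) =
      blockComplex r k n := by
  rw [blockComplex_eq_iUnion hr, (Set.toFinite _).closure_biUnion]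
  exact Set.iUnion₂_congr fun A hA => closure_openCell hn hA.1

/-! ### The maps to the amplituhedra -/

/-- The map `V ↦ Vᗮ ⊓ W`. -/
noncomputable def lineMap {k n : ℕ} {W : Gr (k + 1) n} (hW : W ∈ tpGr (k + 1) n)
    (V : tnnGr k n) : Gr 1 n :=
  ⟨V.1.subᗮ ⊓ W.sub, finrank_orthogonal_inf V.2 hW⟩

/-- The graph is closed, since a line is equal to `Vᗮ ⊓ W` if it is contained in `Vᗮ` and in `W`. -/
theorem continuous_lineMap {k n : ℕ} {W : Gr (k + 1) n} (hW : W ∈ tpGr (k + 1) n) :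
    Continuous (lineMap hW) := by
  refine continuous_of_isClosed_graph ?_
  have hn : k + (n - k) = n := by have := le_of_gr W; omega
  have hle := isClosed_map_le (j := n - k) (k := 1)
    (ContinuousLinearMap.id ℝ (EuclideanSpace ℝ (Fin n)))
  have hle' := isClosed_map_le (j := k + 1) (k := 1)
    (ContinuousLinearMap.id ℝ (EuclideanSpace ℝ (Fin n)))
  have h1 : Continuous fun p : tnnGr k n × Gr 1 n => (p.2, Gr.perp hn p.1.1) :=
    continuous_snd.prodMk
      ((Gr.continuous_perp hn).comp (continuous_subtype_val.comp continuous_fst))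
  have h2 : Continuous fun p : tnnGr k n × Gr 1 n => (p.2, W) :=
    continuous_snd.prodMk continuous_const
  convert (hle.preimage h1).inter (hle'.preimage h2) using 1
  ext ⟨V, X⟩
  have : X = lineMap hW V ↔ X.sub ≤ V.1.subᗮ ∧ X.sub ≤ W.sub := by
    rw [← le_inf_iff]
    constructor
    · rintro rfl
      exact le_rfl
    · intro h
      exact Subtype.ext (Submodule.eq_of_le_of_finrank_eq h
        (X.2.trans (finrank_orthogonal_inf V.2 hW).symm))
  refine this.trans (and_congr ?_ ?_)
  · exact Iff.of_eq (congrArg (· ≤ V.1.subᗮ) (Submodule.map_id X.sub).symm)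
  · exact Iff.of_eq (congrArg (· ≤ W.sub) (Submodule.map_id X.sub).symm)

theorem ker_toLpLin {m n : ℕ} (Z : Matrix (Fin m) (Fin n) ℝ) :
    LinearMap.ker (Matrix.toLpLin 2 2 Z) = (rowSpan Z)ᗮ := by
  ext w
  rw [mem_orthogonal_rowSpan_iff, LinearMap.mem_ker, Matrix.toLpLin_apply]
  exact WithLp.toLp_eq_zero 2

/-- The image of `V` under `Z` and the intersection of `Vᗮ` with the row span of `Z` determine each
other. -/
theorem map_toLpLin_eq_iff {m n : ℕ} {Z : Matrix (Fin m) (Fin n) ℝ}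
    {V V' : Submodule ℝ (EuclideanSpace ℝ (Fin n))} :
    V.map (Matrix.toLpLin 2 2 Z) = V'.map (Matrix.toLpLin 2 2 Z) ↔
      Vᗮ ⊓ rowSpan Z = V'ᗮ ⊓ rowSpan Z := by
  have key : ∀ V : Submodule ℝ (EuclideanSpace ℝ (Fin n)),
      V ⊔ (rowSpan Z)ᗮ = (Vᗮ ⊓ rowSpan Z)ᗮ := fun V => by
    rw [← Submodule.orthogonal_orthogonal (V ⊔ (rowSpan Z)ᗮ), ← Submodule.inf_orthogonal,
      Submodule.orthogonal_orthogonal]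
  constructor
  · intro h
    have h1 := congrArg (Submodule.comap (Matrix.toLpLin 2 2 Z)) h
    rw [Submodule.comap_map_eq, Submodule.comap_map_eq, ker_toLpLin, key, key] at h1
    simpa using congrArg Submodule.orthogonal h1
  · intro h
    have h1 := congrArg Submodule.orthogonal h
    rw [← key, ← key, ← ker_toLpLin] at h1
    have h2 := congrArg (Submodule.map (Matrix.toLpLin 2 2 Z)) h1
    have h3 := LinearMap.le_ker_iff_map.1 (le_refl (LinearMap.ker (Matrix.toLpLin 2 2 Z)))
    rwa [Submodule.map_sup, Submodule.map_sup, h3, sup_bot_eq, sup_bot_eq] at h2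

/-- The kernel of `Z` is `Wᗮ`, which meets `V` trivially because `Vᗮ ⊔ W` is the whole space. -/
theorem finrank_map_toLpLin {k n : ℕ} {V : Gr k n} (hV : V ∈ tnnGr k n) {W : Gr (k + 1) n}
    (hW : W ∈ tpGr (k + 1) n) {Z : Matrix (Fin (k + 1)) (Fin n) ℝ} (hZ : rowSpan Z = W.sub) :
    Module.finrank ℝ ↥(V.sub.map (Matrix.toLpLin 2 2 Z)) = k := by
  have htop : V.subᗮ ⊔ W.sub = ⊤ := by
    have h := Submodule.finrank_sup_add_finrank_inf_eq V.subᗮ W.sub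
    rw [finrank_orthogonal, W.2, finrank_orthogonal_inf hV hW] at h
    refine Submodule.eq_top_of_finrank_eq ?_
    rw [finrank_euclideanSpace_fin]
    have := le_of_gr W
    omega
  have hdisj : Disjoint V.sub (LinearMap.ker (Matrix.toLpLin 2 2 Z)) := by
    rw [ker_toLpLin, hZ, disjoint_iff, ← Submodule.orthogonal_orthogonal V.sub,
      Submodule.inf_orthogonal, htop, Submodule.top_orthogonal_eq_bot]
  refine Eq.trans ?_ V.2
  have hinj := LinearMap.injective_domRestrict_iff.2 hdisj
  rw [← LinearMap.finrank_range_of_inj hinj, LinearMap.range_domRestrict]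

/-- The map `V ↦ Z(V)`. -/
noncomputable def zMap {k n : ℕ} {W : Gr (k + 1) n} (hW : W ∈ tpGr (k + 1) n)
    {Z : Matrix (Fin (k + 1)) (Fin n) ℝ} (hZ : rowSpan Z = W.sub) (V : tnnGr k n) :
    Gr k (k + 1) :=
  ⟨V.1.sub.map (Matrix.toLpLin 2 2 Z), finrank_map_toLpLin V.2 hW hZ⟩

/-- The graph is closed, since a `k`-dimensional subspace that contains `Z(V)` is equal to it. -/
theorem continuous_zMap {k n : ℕ} {W : Gr (k + 1) n} (hW : W ∈ tpGr (k + 1) n)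
    {Z : Matrix (Fin (k + 1)) (Fin n) ℝ} (hZ : rowSpan Z = W.sub) : Continuous (zMap hW hZ) := by
  refine continuous_of_isClosed_graph ?_
  have hle := isClosed_map_le (j := k) (k := k) (LinearMap.toContinuousLinearMap
    (Matrix.toLpLin 2 2 Z))
  have h1 : Continuous fun p : tnnGr k n × Gr k (k + 1) => (p.1.1, p.2) :=
    (continuous_subtype_val.comp continuous_fst).prodMk continuous_snd
  convert hle.preimage h1 using 1
  ext ⟨V, Y⟩
  constructor
  · intro h
    simp only [Set.mem_ofPred_eq] at h
    subst h
    exact le_refl (zMap hW hZ V).sub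
  · intro h
    exact Subtype.ext (Submodule.eq_of_le_of_finrank_eq h
      ((finrank_map_toLpLin V.2 hW hZ).trans Y.2.symm)).symm

/-- A continuous map that is injective on a compact subset and takes all its values there is a
homeomorphism from this subset onto the range. -/
theorem exists_homeomorph {X Y : Type*} [TopologicalSpace X] [TopologicalSpace Y] [T2Space Y]
    {S T : Set X} (hST : S ⊆ T) (hS : IsCompact S) {f : T → Y} (hf : Continuous f)
    (hinj : ∀ (x x' : S), f ⟨x, hST x.2⟩ = f ⟨x', hST x'.2⟩ → x = x')
    (hsurj : ∀ x : T, ∃ x' : S, f ⟨x', hST x'.2⟩ = f x) {R : Set Y} (hR : R = Set.range f) :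
    ∃ Φ : S ≃ₜ R, ∀ x, (Φ x).1 = f ⟨x, hST x.2⟩ := by
  subst hR
  have : CompactSpace S := isCompact_iff_compactSpace.1 hS
  let g : S → Set.range f := fun x => ⟨f ⟨x, hST x.2⟩, Set.mem_range_self _⟩
  have hg : Continuous g :=
    (hf.comp (continuous_subtype_val.subtype_mk _)).subtype_mk _
  have hbij : Function.Bijective g := by
    refine ⟨fun x x' h => hinj x x' (congrArg Subtype.val h), ?_⟩
    rintro ⟨_, x, rfl⟩
    obtain ⟨x', hx'⟩ := hsurj x
    exact ⟨x', Subtype.ext hx'⟩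
  have hg' : Continuous (Equiv.ofBijective g hbij) := hg
  exact ⟨hg'.homeoOfEquivCompactToT2, fun x => rfl⟩

/-- The closure of the image of a relatively compact set is the image of its closure, for a map that
is only defined on a subset `T`. -/
theorem closure_image_preimage_val {X Y : Type*} [TopologicalSpace X] [CompactSpace X]
    [TopologicalSpace Y] [T2Space Y] {T D : Set X} (hD : closure D ⊆ T) {f : T → Y}
    (hf : Continuous f) :
    closure (f '' (Subtype.val ⁻¹' D)) = f '' (Subtype.val ⁻¹' closure D) := by
  refine subset_antisymm ?_ ?_
  · refine closure_minimal (Set.image_mono (Set.preimage_mono subset_closure)) ?_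
    refine (IsCompact.image ?_ hf).isClosed
    rw [Subtype.isCompact_iff, Subtype.image_preimage_coe, Set.inter_eq_right.2 hD]
    exact isClosed_closure.isCompact
  · refine Set.Subset.trans (Set.image_mono fun x hx => ?_) (image_closure_subset_closure_image hf)
    rw [closure_subtype, Subtype.image_preimage_coe,
      Set.inter_eq_right.2 (subset_closure.trans hD)]
    exact hx

/-! ### Strata -/

/-- The lines with a given sign vector are the ones that the cell with the same blocks cuts out. -/
theorem stratum_eq_image {k n r : ℕ} (hn : r + k = n) {W : Gr (k + 1) n}
    (hW : W ∈ tpGr (k + 1) n) {A : Fin r → Finset (Fin n)} (hA : IsBlocks A) {σ : SignVec n k}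
    (hσ : SignedBlocks A (twist σ.1)) :
    stratum W (Quotient.mk _ σ) = lineMap hW '' (Subtype.val ⁻¹' openCell k n A) := by
  ext X
  constructor
  · rintro ⟨hXW, w, hwX, τ, hτ, hwτ⟩
    have hw : SignedBlocks A (twistSign w) := by
      rw [twistSign, hwτ]
      rcases Quotient.exact hτ with h | h
      · rw [h]; exact hσ
      · rw [h, twist_neg]; exact hσ.neg
    have h0 : w ≠ 0 := by
      rw [Ne, ← signOf_eq_zero, hwτ]
      exact τ.2.1
    obtain ⟨V, hV, hwV⟩ := exists_mem_openCell hn hA hw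
    refine ⟨⟨V, openCell_subset_tnnGr hn hA hV⟩, hV, Subtype.ext ?_⟩
    exact eq_of_finrank_eq_one (finrank_orthogonal_inf (openCell_subset_tnnGr hn hA hV) hW) X.2
      ⟨hwV, hXW hwX⟩ hwX h0
  · rintro ⟨V, hV, rfl⟩
    refine ⟨inf_le_right, ?_⟩
    obtain ⟨w, hw, h0⟩ := exists_ne_zero_of_finrank_eq_one (finrank_orthogonal_inf V.2 hW)
    have hwA := signedBlocks_of_mem_openCell hn hA hV V.2 hW hw h0
    rcases SignedBlocks.eq_or_eq_neg hA (x := signOf w) hwA hσ with h | h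
    · exact ⟨w, hw, σ, rfl, h⟩
    · exact ⟨-w, neg_mem hw, σ, rfl, by rw [signOf_neg, h, neg_neg]⟩

theorem stratum_subset_closure_iff {k n r : ℕ} (hn : r + k = n) {W : Gr (k + 1) n}
    (hW : W ∈ tpGr (k + 1) n) {A B : Fin r → Finset (Fin n)} (hA : IsBlocks A) (hB : IsBlocks B)
    {σ τ : SignVec n k} (hσ : SignedBlocks B (twist σ.1)) (hτ : SignedBlocks A (twist τ.1)) :
    stratum W (Quotient.mk _ σ) ⊆ closure (stratum W (Quotient.mk _ τ)) ↔ ∀ j, B j ⊆ A j := by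
  have hcl : closure (openCell k n A) ⊆ tnnGr k n := by
    rw [closure_openCell hn hA]
    rintro V ⟨B, hB, -, hV⟩
    exact openCell_subset_tnnGr hn hB hV
  rw [stratum_eq_image hn hW hB hσ, stratum_eq_image hn hW hA hτ,
    closure_image_preimage_val hcl (continuous_lineMap hW),
    ← openCell_subset_closure_iff hn hA hB]
  refine ⟨fun h V hV => ?_, fun h => Set.image_mono (Set.preimage_mono h)⟩
  obtain ⟨V', hV', hVV'⟩ := h ⟨⟨V, openCell_subset_tnnGr hn hB hV⟩, hV, rfl⟩
  have hV'c : V'.1 ∈ blockComplex r k n := by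
    rw [Set.mem_preimage, closure_openCell hn hA] at hV'
    obtain ⟨C, hC, -, hV'⟩ := hV'
    exact ⟨C, hC, hV'⟩
  rw [← eq_of_mem_blockComplex hn hW hV'c ⟨B, hB, hV⟩ (congrArg Subtype.val hVV')]
  exact hV'

/-! ### The matroids and their cells -/

theorem IsBlockMatroid.matroidCell_eq {k n r : ℕ} (hn : r + k = n) {A : Fin r → Finset (Fin n)}
    (hA : IsBlocks A) {M : Matroid (Fin n)} (h : IsBlockMatroid A M) :
    matroidCell k n M = openCell k n A := by
  rw [matroidCell, h.setOf_isBase, posCell_blockBases hn hA]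

theorem IsBlockMatroid.blocks_eq {n r : ℕ} {A A' : Fin r → Finset (Fin n)} (hA : IsBlocks A)
    (hA' : IsBlocks A') {M : Matroid (Fin n)} (h : IsBlockMatroid A M)
    (h' : IsBlockMatroid A' M) : A = A' :=
  funext fun j => ((h.weakLE_iff hA hA' h').1 (fun _ => id) j).antisymm
    ((h'.weakLE_iff hA' hA h).1 (fun _ => id) j)

theorem subcomplex_eq {k n : ℕ} (hk : k < n) : subcomplex k n = blockComplex (n - k) k n := by
  have hn : n - k + k = n := Nat.sub_add_cancel hk.le
  ext V
  simp only [subcomplex, Set.mem_iUnion]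
  constructor
  · rintro ⟨M, hM, hV⟩
    obtain ⟨A, hA, hMA⟩ := exists_isBlockMatroid_of_mem_bcfwMatroidsBar hM
    exact ⟨A, hA, hMA.matroidCell_eq hn hA ▸ hV⟩
  · rintro ⟨A, hA, hV⟩
    obtain ⟨M, hMA⟩ := exists_isBlockMatroid hA
    exact ⟨M, hMA.mem_bcfwMatroidsBar hk hA, (hMA.matroidCell_eq hn hA).symm ▸ hV⟩

theorem bcfwCells_eq_openCell {k n r : ℕ} (hr : 0 < r) (hn : r + k = n) :
    bcfwCells k n = openCell k n '' {A : Fin r → Finset (Fin n) | IsBlocks A ∧ IsFull A} := by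
  obtain ⟨r, rfl⟩ := Nat.exists_eq_succ_of_ne_zero hr.ne'
  rw [bcfwCells_eq hn]
  exact Set.image_congr fun A hA => posCell_blockBases hn hA.1

theorem bcfwCells_eq_matroidCell {k n : ℕ} (hk : k < n) :
    bcfwCells k n = matroidCell k n '' bcfwMatroids n k := by
  have hn : n - k + k = n := Nat.sub_add_cancel hk.le
  rw [bcfwCells_eq_openCell (Nat.sub_pos_of_lt hk) hn]
  refine subset_antisymm ?_ ?_
  · rintro _ ⟨A, ⟨hA, hf⟩, rfl⟩
    obtain ⟨M, hM, hMA⟩ := exists_isBlockMatroid_mem_bcfwMatroids hk.le hA hf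
    exact ⟨M, hM, hMA.matroidCell_eq hn hA⟩
  · rintro _ ⟨M, hM, rfl⟩
    obtain ⟨A, hA, hf, hMA⟩ := exists_isBlockMatroid_of_mem_bcfwMatroids hM
    exact ⟨A, ⟨hA, hf⟩, (hMA.matroidCell_eq hn hA).symm⟩

theorem ncard_bcfwCells {k n : ℕ} (hk : k < n) : (bcfwCells k n).ncard = (n - 1).choose k := by
  have hn : n - k + k = n := Nat.sub_add_cancel hk.le
  have hr := Nat.sub_pos_of_lt hk
  rw [bcfwCells_eq_openCell hr hn, Set.InjOn.ncard_image, ncard_full_blocks (by omega) hr]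
  · exact Nat.choose_symm_of_eq_add (by omega)
  · intro A hA A' hA' h
    obtain ⟨V, hV⟩ := openCell_nonempty hn hA.1
    exact eq_of_mem_openCell hA.1 hA'.1 hV (h ▸ hV)

/-- The bijection between the matroids and the sign vectors modulo `±1` that belong to the same
blocks. -/
theorem exists_equiv_pSign {k n : ℕ} (hk : k < n) : ∃ Ω : bcfwMatroidsBar n k ≃ PSign n k,
    ∀ M : bcfwMatroidsBar n k, ∃ (A : Fin (n - k) → Finset (Fin n)) (σ : SignVec n k),
      IsBlocks A ∧ IsBlockMatroid A M.1 ∧ SignedBlocks A (twist σ.1) ∧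
        Ω M = Quotient.mk _ σ := by
  have hn : n - k + k = n := Nat.sub_add_cancel hk.le
  have hr := Nat.sub_pos_of_lt hk
  choose A hA hMA using fun M : bcfwMatroidsBar n k =>
    exists_isBlockMatroid_of_mem_bcfwMatroidsBar M.2
  let Ω : bcfwMatroidsBar n k → PSign n k := fun M =>
    Quotient.mk _ (blockSignVec hr hn (A M) (hA M))
  have hS := fun M => signedBlocks_blockSignVec hr hn (A M) (hA M)
  have hΩ : Function.Bijective Ω := by
    constructor
    · intro M M' h
      have h1 : A M = A M' := by
        refine (hS M).eq (hA M) (hA M') ?_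
        rcases Quotient.exact h with h | h
        · rw [h]; exact hS M'
        · rw [h, twist_neg]; exact (hS M').neg
      exact Subtype.ext ((hMA M).eq (hA M) (h1 ▸ hMA M'))
    · intro s
      induction s using Quotient.inductionOn with
      | h σ =>
        obtain ⟨B, hB, hσ⟩ := exists_blocks_of_signVec hr hn σ
        obtain ⟨M, hMB⟩ := exists_isBlockMatroid hB
        refine ⟨⟨M, hMB.mem_bcfwMatroidsBar hk hB⟩, Quotient.sound ?_⟩
        have h := hS ⟨M, hMB.mem_bcfwMatroidsBar hk hB⟩
        have hBA := hMB.blocks_eq hB (hA _) (hMA ⟨M, hMB.mem_bcfwMatroidsBar hk hB⟩)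
        exact SignedBlocks.eq_or_eq_neg (hA _) h (hBA ▸ hσ)
  exact ⟨Equiv.ofBijective Ω hΩ, fun M => ⟨A M, _, hA M, hMA M, hS M, rfl⟩⟩

/-! ### Homeomorphisms and the triangulation -/

theorem bAmplituhedron_eq_range {k n : ℕ} {W : Gr (k + 1) n} (hW : W ∈ tpGr (k + 1) n) :
    bAmplituhedron k 1 n W = Set.range (lineMap hW) := by
  ext X
  constructor
  · rintro ⟨V, hV, hX⟩
    exact ⟨⟨V, hV⟩, Subtype.ext hX.symm⟩
  · rintro ⟨V, rfl⟩
    exact ⟨V.1, V.2, rfl⟩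

theorem zImage_eq_image {k n : ℕ} {W : Gr (k + 1) n} (hW : W ∈ tpGr (k + 1) n)
    {Z : Matrix (Fin (k + 1)) (Fin n) ℝ} (hZ : rowSpan Z = W.sub) {C : Set (Gr k n)}
    (hC : C ⊆ tnnGr k n) : zImage Z C = zMap hW hZ '' (Subtype.val ⁻¹' C) := by
  ext Y
  constructor
  · rintro ⟨V, hV, hY⟩
    exact ⟨⟨V, hC hV⟩, hV, Subtype.ext hY.symm⟩
  · rintro ⟨V, hV, rfl⟩
    exact ⟨V.1, hV, rfl⟩

theorem exists_homeomorph_lineMap {k n r : ℕ} (hr : 0 < r) (hn : r + k = n) {W : Gr (k + 1) n}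
    (hW : W ∈ tpGr (k + 1) n) : ∃ Φ : blockComplex r k n ≃ₜ bAmplituhedron k 1 n W,
      ∀ V, (Φ V).1 = lineMap hW ⟨V, blockComplex_subset_tnnGr hn V.2⟩ := by
  refine exists_homeomorph (blockComplex_subset_tnnGr hn) (isCompact_blockComplex hr hn)
    (continuous_lineMap hW) (fun V V' h => ?_) (fun V => ?_) (bAmplituhedron_eq_range hW)
  · exact Subtype.ext (eq_of_mem_blockComplex hn hW V.2 V'.2 (congrArg Subtype.val h))
  · obtain ⟨V', hV', h⟩ := exists_mem_blockComplex hn hW V.2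
    exact ⟨⟨V', hV'⟩, Subtype.ext h⟩

theorem eq_of_map_toLpLin_eq {k n r : ℕ} (hn : r + k = n) {W : Gr (k + 1) n}
    (hW : W ∈ tpGr (k + 1) n) {Z : Matrix (Fin (k + 1)) (Fin n) ℝ} (hZ : rowSpan Z = W.sub)
    {V V' : Gr k n} (hV : V ∈ blockComplex r k n) (hV' : V' ∈ blockComplex r k n)
    (h : V.sub.map (Matrix.toLpLin 2 2 Z) = V'.sub.map (Matrix.toLpLin 2 2 Z)) : V = V' :=
  eq_of_mem_blockComplex hn hW hV hV' (hZ ▸ map_toLpLin_eq_iff.1 h)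

theorem exists_homeomorph_zMap {k n r : ℕ} (hr : 0 < r) (hn : r + k = n) {W : Gr (k + 1) n}
    (hW : W ∈ tpGr (k + 1) n) {Z : Matrix (Fin (k + 1)) (Fin n) ℝ} (hZ : rowSpan Z = W.sub) :
    ∃ Ψ : blockComplex r k n ≃ₜ amplituhedron k 1 n Z,
      ∀ V, (Ψ V).1 = zMap hW hZ ⟨V, blockComplex_subset_tnnGr hn V.2⟩ := by
  refine exists_homeomorph (blockComplex_subset_tnnGr hn) (isCompact_blockComplex hr hn)
    (continuous_zMap hW hZ) (fun V V' h => ?_) (fun V => ?_) ?_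
  · exact Subtype.ext (eq_of_map_toLpLin_eq hn hW hZ V.2 V'.2 (congrArg Subtype.val h))
  · obtain ⟨V', hV', h⟩ := exists_mem_blockComplex hn hW V.2
    exact ⟨⟨V', hV'⟩, Subtype.ext (map_toLpLin_eq_iff.2 (hZ.symm ▸ h))⟩
  · rw [amplituhedron, zImage_eq_image hW hZ subset_rfl]
    simp

theorem closure_iUnion_zImage {k n r : ℕ} (hr : 0 < r) (hn : r + k = n) {W : Gr (k + 1) n}
    (hW : W ∈ tpGr (k + 1) n) {Z : Matrix (Fin (k + 1)) (Fin n) ℝ} (hZ : rowSpan Z = W.sub) :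
    closure (⋃ C ∈ bcfwCells k n, zImage Z C) = amplituhedron k 1 n Z := by
  have hcl : closure (⋃ C ∈ bcfwCells k n, C) = blockComplex r k n := by
    rw [bcfwCells_eq_openCell hr hn, Set.biUnion_image, closure_iUnion_openCell hr hn]
  have hsub : closure (⋃ C ∈ bcfwCells k n, C) ⊆ tnnGr k n :=
    hcl.trans_subset (blockComplex_subset_tnnGr hn)
  have hC : ∀ C ∈ bcfwCells k n, C ⊆ tnnGr k n := fun C hC =>
    ((Set.subset_biUnion_of_mem (u := id) hC).trans subset_closure).trans hsub
  have hunion : (⋃ C ∈ bcfwCells k n, zImage Z C) =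
      zMap hW hZ '' (Subtype.val ⁻¹' ⋃ C ∈ bcfwCells k n, C) := by
    rw [Set.preimage_iUnion₂, Set.image_iUnion₂]
    exact Set.iUnion₂_congr fun C h => zImage_eq_image hW hZ (hC C h)
  rw [hunion, closure_image_preimage_val hsub (continuous_zMap hW hZ), hcl, amplituhedron,
    zImage_eq_image hW hZ subset_rfl]
  refine subset_antisymm (Set.image_mono fun V _ => V.2) ?_
  rintro _ ⟨V, -, rfl⟩
  obtain ⟨V', hV', h⟩ := exists_mem_blockComplex hn hW V.2
  exact ⟨⟨V', blockComplex_subset_tnnGr hn hV'⟩, hV',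
    Subtype.ext (map_toLpLin_eq_iff.2 (hZ.symm ▸ h))⟩

/-- Points of different cells are different, and `Z` separates the points of the complex. -/
theorem pairwiseDisjoint_zImage {k n r : ℕ} (hr : 0 < r) (hn : r + k = n) {W : Gr (k + 1) n}
    (hW : W ∈ tpGr (k + 1) n) {Z : Matrix (Fin (k + 1)) (Fin n) ℝ} (hZ : rowSpan Z = W.sub) :
    (bcfwCells k n).PairwiseDisjoint (zImage Z) := by
  rw [bcfwCells_eq_openCell hr hn]
  rintro _ ⟨A, hA, rfl⟩ _ ⟨A', hA', rfl⟩ hne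
  refine Set.disjoint_left.2 ?_
  rintro Y ⟨V, hV, hY⟩ ⟨V', hV', hY'⟩
  obtain rfl := eq_of_map_toLpLin_eq hn hW hZ ⟨A, hA.1, hV⟩ ⟨A', hA'.1, hV'⟩ (hY.symm.trans hY')
  exact hne (congrArg _ (eq_of_mem_openCell hA.1 hA'.1 hV hV'))

end Amplituhedron

theorem mainTheorem1 (n k : ℕ) (W : Gr (k + 1) n) (hW : W ∈ tpGr (k + 1) n) :
    -- the map `V ↦ Vᗮ ∩ W` sends totally nonnegative subspaces to lines
    (∀ V ∈ tnnGr k n, Module.finrank ℝ ↥(V.subᗮ ⊓ W.sub) = 1) ∧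
    -- the BCFW cells, their number, and the closed subcomplex they generate
    bcfwCells k n = matroidCell k n '' bcfwMatroids n k ∧
    (bcfwCells k n).ncard = (n - 1).choose k ∧
    (∀ M ∈ bcfwMatroidsBar n k, (matroidCell k n M).Nonempty) ∧
    subcomplex k n = closure (⋃ C ∈ bcfwCells k n, C) ∧
    -- `V ↦ Vᗮ ∩ W` is a homeomorphism and induces a poset isomorphism on the strata
    (∃ Φ : subcomplex k n ≃ₜ bAmplituhedron k 1 n W,
      (∀ V, (Φ V).1.sub = V.1.subᗮ ⊓ W.sub) ∧
      ∃ Ω : bcfwMatroidsBar n k ≃ PSign n k,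
        (∀ M : bcfwMatroidsBar n k, (fun V => (Φ V).1) '' {V | V.1 ∈ matroidCell k n M.1} =
          stratum W (Ω M)) ∧
        (∀ M M' : bcfwMatroidsBar n k, WeakLE M.1 M'.1 ↔ (Ω M).LE' (Ω M')) ∧
        (∀ M M' : bcfwMatroidsBar n k,
          matroidCell k n M.1 ⊆ closure (matroidCell k n M'.1) ↔ WeakLE M.1 M'.1) ∧
        (∀ s t : PSign n k, stratum W s ⊆ closure (stratum W t) ↔ s.LE' t)) ∧
    -- the images of the BCFW cells triangulate the amplituhedron
    (∀ Z : Matrix (Fin (k + 1)) (Fin n) ℝ, PositiveMinors Z → rowSpan Z = W.sub →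
      (∀ V ∈ tnnGr k n,
        Module.finrank ℝ ↥(V.sub.map (Matrix.toLpLin 2 2 Z)) = k) ∧
      (∃ Ψ : subcomplex k n ≃ₜ amplituhedron k 1 n Z,
        ∀ V, (Ψ V).1.sub = V.1.sub.map (Matrix.toLpLin 2 2 Z)) ∧
      (∀ C ∈ bcfwCells k n,
        Set.InjOn (fun V : Gr k n => V.sub.map (Matrix.toLpLin 2 2 Z)) C) ∧
      (bcfwCells k n).PairwiseDisjoint (zImage Z) ∧
      closure (⋃ C ∈ bcfwCells k n, zImage Z C) = amplituhedron k 1 n Z) := by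
  have hk : k < n := le_of_gr W
  have hn : n - k + k = n := Nat.sub_add_cancel hk.le
  have hr : 0 < n - k := Nat.sub_pos_of_lt hk
  have hcells := bcfwCells_eq_openCell hr hn
  refine ⟨fun V hV => finrank_orthogonal_inf hV hW, bcfwCells_eq_matroidCell hk,
    ncard_bcfwCells hk, fun M hM => ?_, ?_, ?_, fun Z _ hZ => ⟨fun V hV =>
      finrank_map_toLpLin hV hW hZ, ?_, fun C hC V hV V' hV' h => ?_,
      pairwiseDisjoint_zImage hr hn hW hZ, closure_iUnion_zImage hr hn hW hZ⟩⟩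
  · obtain ⟨A, hA, hMA⟩ := exists_isBlockMatroid_of_mem_bcfwMatroidsBar hM
    rw [hMA.matroidCell_eq hn hA]
    exact openCell_nonempty hn hA
  · rw [hcells, Set.biUnion_image, closure_iUnion_openCell hr hn, subcomplex_eq hk]
  · rw [subcomplex_eq hk]
    obtain ⟨Φ, hΦ⟩ := exists_homeomorph_lineMap hr hn hW
    obtain ⟨Ω, hΩ⟩ := exists_equiv_pSign hk
    refine ⟨Φ, fun V => congrArg Subtype.val (hΦ V), Ω, fun M => ?_, fun M M' => ?_,
      fun M M' => ?_, fun s t => ?_⟩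
    · obtain ⟨A, σ, hA, hMA, hσ, h⟩ := hΩ M
      rw [h, stratum_eq_image hn hW hA hσ, hMA.matroidCell_eq hn hA]
      ext X
      constructor
      · rintro ⟨V, hV, rfl⟩
        exact ⟨⟨V, blockComplex_subset_tnnGr hn V.2⟩, hV, (hΦ V).symm⟩
      · rintro ⟨V, hV, rfl⟩
        exact ⟨⟨V, A, hA, hV⟩, hV, hΦ _⟩
    · obtain ⟨A, σ, hA, hMA, hσ, h⟩ := hΩ M
      obtain ⟨A', σ', hA', hMA', hσ', h'⟩ := hΩ M'
      rw [h, h', psign_le_iff hA hA' hσ hσ', hMA.weakLE_iff hA hA' hMA']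
    · obtain ⟨A, σ, hA, hMA, hσ, h⟩ := hΩ M
      obtain ⟨A', σ', hA', hMA', hσ', h'⟩ := hΩ M'
      rw [hMA.matroidCell_eq hn hA, hMA'.matroidCell_eq hn hA',
        openCell_subset_closure_iff hn hA' hA, hMA.weakLE_iff hA hA' hMA']
    · induction s using Quotient.inductionOn with
      | h σ =>
        induction t using Quotient.inductionOn with
        | h τ =>
          obtain ⟨A, hA, hσ⟩ := exists_blocks_of_signVec hr hn σ
          obtain ⟨B, hB, hτ⟩ := exists_blocks_of_signVec hr hn τ
          rw [stratum_subset_closure_iff hn hW hB hA hσ hτ, psign_le_iff hA hB hσ hτ]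
  · rw [subcomplex_eq hk]
    obtain ⟨Ψ, hΨ⟩ := exists_homeomorph_zMap hr hn hW hZ
    exact ⟨Ψ, fun V => congrArg Subtype.val (hΨ V)⟩
  · rw [hcells] at hC
    obtain ⟨A, hA, rfl⟩ := hC
    exact eq_of_map_toLpLin_eq hn hW hZ ⟨A, hA.1, hV⟩ ⟨A, hA.1, hV'⟩ h
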